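/- **Maps.** A planar map is an embedding of a connected finite graph (loops and multiple edges allowed) in the oriented sphere, up to orientation-preserving homeomorphism, with one distinguished oriented edge, the root. It is separable if its edges can be partitioned into two nonempty sets such that exactly one vertex is incident to edges of both sets. A non-separable planar map is a planar map with at least two edges that is not separable. Let $\mathcal M_n$ be the set of non-separable planar maps with $n+1$ edges. **Trees.** The depth of the root of a rooted tree is $0$. A decorated tree is a rooted plane tree whose leaves carry integer labels at least $-1$, such that, with leaves taken in traversal (counterclockwise) order: 1. a leaf adjacent to a vertex of depth $p$ has a label strictly smaller than $p$; 2. every internal node of depth $p>0$ has at least one descendant leaf with a label at most $p-2$; 3. if $t$ is a node of depth $p$ and $T'$ is the sub-tree rooted at a child of $t$, then every leaf of $T'$ that precedes a leaf of $T'$ labelled $p$ has a label at least $p$. Let $\mathcal T_n$ be the set of decorated trees with $n$ edges (those leading to leaves included). **The map $\mathrm T$.** Let $M$ be a non-separable planar map whose root points from $v$ to $u$. Explore $M$ depth-first, in clockwise order around each vertex, starting from $v$ and the root, where $v$ has depth $-1$ and $u$ has depth $0$. Each edge is explored once. When the exploration of an edge from the current vertex $w$ meets an already visited vertex $x$, the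 edge is replaced by a leaf attached to $w$ and labelled with the depth of $x$. This gives a plane tree (among the children of a vertex, those explored first come last in traversal order) in which $v$ has the single child $u$. Delete the edge $(v,u)$; the resulting tree, rooted at $u$, is $\mathrm T(M)$. **The map $\mathrm S$.** Let $T$ be a decorated tree with root $u$. Attach to $u$ (in the corner of $u$ that precedes its first child and follows its last child in traversal order) an edge to a new vertex $v$, of depth $-1$, and make it the root, pointing from $v$ to $u$. Then, for each leaf $\ell$, starting from the last one in traversal order, let $t$ be its parent, $p$ its label, $s$ its ancestor of depth $p$, and $e$ the first edge on the path from $s$ to $\ell$; replace $\ell$ by an edge from $t$ to $s$ whose end at $s$ is attached just after $e$ in clockwise order around $s$. The result is $\mathrm S(T)$. **Theorem.** For every $n>0$, $\mathrm T$ is a bijection from $\mathcal M_n$ to $\mathcal T_n$, $\mathrm S$ maps $\mathcal T_n$ into $\mathcal M_n$, and $\mathrm S$ is the inverse of $\mathrm T$. -/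

import Mathlib

/-! ## Rooted maps

A map on an oriented closed surface, given by its rotation system. Each edge `e` consists of the two
darts (oriented edges) `(e, true)` and `(e, false)`; a dart is based at its origin vertex. The
permutation `cw` sends a dart to the next dart in clockwise order around its origin. -/

/-- A rooted rotation system with finitely many edges. -/
structure RootedMap where
  E : Type
  finite : Finite E
  cw : Equiv.Perm (E × Bool)
  root : E × Bool

attribute [instance] RootedMap.finite

namespace RootedMap

/-- Oriented edges. -/
abbrev Dart (M : RootedMap) : Type := M.E × Bool

/-- The same edge with the opposite orientation. -/
def flip {E : Type} : Equiv.Perm (E × Bool) :=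
  Equiv.prodCongr (Equiv.refl E) Equiv.boolNot

/-- Vertices: cycles of the clockwise rotation. -/
abbrev Vertex (M : RootedMap) : Type :=
  Quotient (Equiv.Perm.SameCycle.setoid M.cw)

/-- Faces: cycles of the permutation `d ↦ cw (flip d)`. -/
abbrev Face (M : RootedMap) : Type :=
  Quotient (Equiv.Perm.SameCycle.setoid (M.cw * flip))

/-- The origin of a dart. -/
def origin (M : RootedMap) (d : M.Dart) : M.Vertex :=
  Quotient.mk (Equiv.Perm.SameCycle.setoid M.cw) d

/-- The vertex `v` is an endpoint of the edge `e`. -/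
def Incident (M : RootedMap) (v : M.Vertex) (e : M.E) : Prop :=
  ∃ b : Bool, M.origin (e, b) = v

/-- Connectedness: one can pass between any two darts by rotations and reversals. -/
def Connected (M : RootedMap) : Prop :=
  ∀ x y : M.Dart, ∃ g ∈ Subgroup.closure {M.cw, flip}, g x = y

/-- A map on the sphere: connected, with Euler characteristic `V - E + F = 2`. -/
def IsPlanar (M : RootedMap) : Prop :=
  M.Connected ∧ Nat.card M.Vertex + Nat.card M.Face = Nat.card M.E + 2

/-- The edges can be partitioned into two nonempty sets with exactly one vertex incident
to edges of both. -/
def Separable (M : RootedMap) : Prop :=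
  ∃ A : Set M.E, A.Nonempty ∧ Aᶜ.Nonempty ∧
    ∃! v : M.Vertex, (∃ e ∈ A, M.Incident v e) ∧ (∃ e ∈ Aᶜ, M.Incident v e)

/-- Non-separable planar maps have at least two edges. -/
def IsNonSeparablePlanar (M : RootedMap) : Prop :=
  M.IsPlanar ∧ 2 ≤ Nat.card M.E ∧ ¬ M.Separable

/-- Isomorphisms of rooted maps (orientation-preserving, root-preserving). -/
structure Iso (M N : RootedMap) where
  toEquiv : M.Dart ≃ N.Dart
  map_flip : ∀ d, toEquiv (flip d) = flip (toEquiv d)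
  map_cw : ∀ d, toEquiv (M.cw d) = N.cw (toEquiv d)
  map_root : toEquiv M.root = N.root

/-- Rooted maps are considered up to isomorphism. -/
instance setoid : Setoid RootedMap where
  r M N := Nonempty (Iso M N)
  iseqv :=
    { refl := fun _ => ⟨⟨Equiv.refl _, fun _ => rfl, fun _ => rfl, rfl⟩⟩
      symm := by
        rintro M N ⟨f⟩
        refine ⟨⟨f.toEquiv.symm, fun d => ?_, fun d => ?_, ?_⟩⟩
        · rw [Equiv.symm_apply_eq, f.map_flip, Equiv.apply_symm_apply]
        · rw [Equiv.symm_apply_eq, f.map_cw, Equiv.apply_symm_apply]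
        · rw [Equiv.symm_apply_eq, f.map_root]
      trans := by
        rintro M N K ⟨f⟩ ⟨g⟩
        refine ⟨⟨f.toEquiv.trans g.toEquiv, fun d => ?_, fun d => ?_, ?_⟩⟩
        · simp only [Equiv.trans_apply, f.map_flip, g.map_flip]
        · simp only [Equiv.trans_apply, f.map_cw, g.map_cw]
        · simp only [Equiv.trans_apply, f.map_root, g.map_root] }

end RootedMap

/-- Isomorphism classes of rooted maps. -/
def MapClass : Type 1 := Quotient RootedMap.setoid

/-- The set of non-separable planar maps with `n + 1` edges. -/
def nonSeparableMaps (n : ℕ) : Set MapClass :=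
  {c | ∃ M : RootedMap, M.IsNonSeparablePlanar ∧ Nat.card M.E = n + 1 ∧
    c = Quotient.mk RootedMap.setoid M}

/-! ## Plane trees with labelled leaves -/

/-- Rooted plane trees with an integer label on each leaf. The children of a node are listed
in traversal order, that is in counterclockwise order starting from the parent side. -/
inductive PTree : Type
  | leaf (label : ℤ) : PTree
  | node (children : List PTree) : PTree

namespace PTree

/-- The number of edges, including those leading to leaves. -/
def numEdges : PTree → ℕ
  | leaf _ => 0
  | node cs => (cs.map (fun c => numEdges c + 1)).sum

/-- The leaf labels in traversal order. -/
def leafLabels : PTree → List ℤ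
  | leaf z => [z]
  | node cs => (cs.map leafLabels).flatten

/-- The sub-tree at an address; the address lists the (0-based) child indices on the path from the
root, so that its length is the depth. -/
def at? : PTree → List ℕ → Option PTree
  | t, [] => some t
  | leaf _, _ :: _ => none
  | node cs, i :: p => cs[i]?.bind (fun c => at? c p)

/-- The addresses of all vertices of the tree (leaves included), in preorder. -/
def nodes : PTree → List (List ℕ)
  | leaf _ => [[]]
  | node cs => [] :: ((cs.map nodes).mapIdx (fun i l => l.map (i :: ·))).flatten

/-- Decorated trees. -/
structure IsDecorated (t : PTree) : Prop where
  /-- Vertices without children are leaves, which carry a label. -/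
  children_ne_nil : ∀ p, t.at? p ≠ some (node [])
  /-- Labels are at least `-1`. -/
  neg_one_le : ∀ z ∈ t.leafLabels, -1 ≤ z
  /-- A leaf attached to a vertex of depth `d` has a label smaller than `d`. -/
  label_lt : ∀ p i z, t.at? (p ++ [i]) = some (leaf z) → z < (p.length : ℤ)
  /-- An internal node of depth `d > 0` has a descendant leaf with a label at most `d - 2`. -/
  exists_le : ∀ p cs, t.at? p = some (node cs) → 0 < p.length →
    ∃ z ∈ (node cs).leafLabels, z ≤ (p.length : ℤ) - 2
  /-- In the sub-tree at a child of a node of depth `d`, leaves preceding a leaf labelled `d`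
  have labels at least `d`. -/
  le_of_before : ∀ p cs, t.at? p = some (node cs) → ∀ c ∈ cs, ∀ l₁ l₂ : List ℤ,
    c.leafLabels = l₁ ++ (p.length : ℤ) :: l₂ → ∀ y ∈ l₁, (p.length : ℤ) ≤ y

end PTree

/-- The set of decorated trees with `n` edges. -/
def decoratedTrees (n : ℕ) : Set PTree :=
  {t | t.IsDecorated ∧ t.numEdges = n}

/-! ## From maps to trees: the exploration -/

/-- The state of the exploration: the depths of the visited vertices (a vertex is represented by
all of its darts), and the darts of the edges already explored. -/
structure ExploreState (D : Type) where
  depth : D → Option ℤ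
  used : Set D

namespace RootedMap

/-- All darts at the origin of `d`, in clockwise order, starting with `d`. -/
noncomputable def around (M : RootedMap) (d : M.Dart) : List M.Dart :=
  (List.range (Function.minimalPeriod M.cw d)).map (fun i => M.cw^[i] d)

/-- Record that the edge of `d` has been explored. -/
def markEdge (M : RootedMap) (d : M.Dart) (st : ExploreState M.Dart) : ExploreState M.Dart where
  depth := st.depth
  used := {x | x ∈ st.used ∨ x = d ∨ x = flip d}

open Classical in
/-- Record that the origin of `d` is visited at depth `k`. -/
noncomputable def visit (M : RootedMap) (d : M.Dart) (k : ℤ) (st : ExploreState M.Dart) :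
    ExploreState M.Dart where
  depth := fun x => if M.origin x = M.origin d then some k else st.depth x
  used := st.used

open Classical in
/-- Depth-first exploration from a visited vertex of depth `k`, along the darts of the given list
(the remaining darts at this vertex, in clockwise order). The result consists of the children
produced, in traversal order (those explored first come last), and of the new state. The edges
already explored are skipped; an edge leading to a visited vertex gives a leaf labelled with the
depth of that vertex; otherwise the new vertex is explored before going on. The first argument
bounds the number of nested calls; the number of darts is enough. -/
noncomputable def explore (M : RootedMap) :
    ℕ → ℤ → List M.Dart → ExploreState M.Dart → List PTree × ExploreState M.Dart
  | 0, _, _, st => ([], st)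
  | _ + 1, _, [], st => ([], st)
  | fuel + 1, k, d :: ds, st =>
    if d ∈ st.used then explore M fuel k ds st
    else
      match st.depth (flip d) with
      | some j =>
        let r := explore M fuel k ds (M.markEdge d st)
        (r.1 ++ [PTree.leaf j], r.2)
      | none =>
        let r₁ := explore M fuel (k + 1) (M.around (flip d)).tail
          (M.visit (flip d) (k + 1) (M.markEdge d st))
        let r₂ := explore M fuel k ds r₁.2
        (r₂.1 ++ [PTree.node r₁.1], r₂.2)

/-- The sub-trees at the root vertex `v` in the exploration tree; `v` has depth `-1`, and the
exploration starts with the root. -/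
noncomputable def explorationForest (M : RootedMap) : List PTree :=
  (M.explore (Nat.card M.Dart) (-1) (M.around M.root)
    (M.visit M.root (-1) ⟨fun _ => none, ∅⟩)).1

/-- The root vertex of the exploration tree has a unique child (for a non-separable map); the
edge to this child is deleted. The value in all other cases is irrelevant. -/
noncomputable def explorationTree (M : RootedMap) : PTree :=
  match M.explorationForest with
  | [t] => t
  | _ => PTree.leaf 0

/-! The exploration is invariant under isomorphism. -/

theorem Iso.map_iterate {M N : RootedMap} (f : Iso M N) (i : ℕ) (d : M.Dart) :
    f.toEquiv (M.cw^[i] d) = N.cw^[i] (f.toEquiv d) :=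
  Function.Semiconj.iterate_right (f := f.toEquiv) f.map_cw i d

theorem Iso.around {M N : RootedMap} (f : Iso M N) (d : M.Dart) :
    N.around (f.toEquiv d) = (M.around d).map f.toEquiv := by
  have h : Function.minimalPeriod N.cw (f.toEquiv d) = Function.minimalPeriod M.cw d := by
    rw [Function.minimalPeriod_eq_minimalPeriod_iff]
    intro i
    simp only [Function.IsPeriodicPt, Function.IsFixedPt, ← f.map_iterate]
    exact f.toEquiv.apply_eq_iff_eq
  simp only [RootedMap.around, h, List.map_map]
  exact List.map_congr_left fun i _ => (f.map_iterate i d).symm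

theorem Iso.origin_eq_iff {M N : RootedMap} (f : Iso M N) (x y : M.Dart) :
    N.origin (f.toEquiv x) = N.origin (f.toEquiv y) ↔ M.origin x = M.origin y := by
  have h : N.cw = f.toEquiv.permCongr M.cw := by
    ext1 z
    rw [Equiv.permCongr_apply, f.map_cw, Equiv.apply_symm_apply]
  have hz : ∀ i : ℤ, (N.cw ^ i) (f.toEquiv x) = f.toEquiv ((M.cw ^ i) x) := by
    intro i
    have : N.cw ^ i = f.toEquiv.permCongr (M.cw ^ i) := by
      rw [h]
      exact (map_zpow f.toEquiv.permCongrHom M.cw i).symm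
    rw [this, Equiv.permCongr_apply, Equiv.symm_apply_apply]
  rw [origin, origin, origin, origin, Quotient.eq, Quotient.eq]
  change N.cw.SameCycle _ _ ↔ M.cw.SameCycle _ _
  simp only [Equiv.Perm.SameCycle, hz, f.toEquiv.apply_eq_iff_eq]

theorem Iso.explore {M N : RootedMap} (f : Iso M N) (fuel : ℕ) :
    ∀ (k : ℤ) (ds : List M.Dart) (st : ExploreState M.Dart) (st' : ExploreState N.Dart),
      (∀ x, st'.depth (f.toEquiv x) = st.depth x) →
      (∀ x, f.toEquiv x ∈ st'.used ↔ x ∈ st.used) →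
      (N.explore fuel k (ds.map f.toEquiv) st').1 = (M.explore fuel k ds st).1 ∧
      (∀ x, (N.explore fuel k (ds.map f.toEquiv) st').2.depth (f.toEquiv x) =
        (M.explore fuel k ds st).2.depth x) ∧
      (∀ x, f.toEquiv x ∈ (N.explore fuel k (ds.map f.toEquiv) st').2.used ↔
        x ∈ (M.explore fuel k ds st).2.used) := by
  induction fuel with
  | zero =>
    intro k ds st st' h₁ h₂
    simpa only [RootedMap.explore, true_and] using ⟨h₁, h₂⟩
  | succ fuel ih =>
    intro k ds st st' h₁ h₂
    cases ds with
    | nil => simpa only [RootedMap.explore, List.map_nil, true_and] using ⟨h₁, h₂⟩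
    | cons d ds =>
      have hm : ∀ x, f.toEquiv x ∈ (N.markEdge (f.toEquiv d) st').used ↔
          x ∈ (M.markEdge d st).used := by
        intro x
        simp only [markEdge, Set.mem_ofPred_eq, h₂, ← f.map_flip, f.toEquiv.apply_eq_iff_eq]
      simp only [RootedMap.explore, List.map_cons]
      by_cases hd : d ∈ st.used
      · rw [if_pos hd, if_pos ((h₂ d).2 hd)]
        exact ih k ds st st' h₁ h₂
      · rw [if_neg hd, if_neg (mt (h₂ d).1 hd), ← f.map_flip, h₁]
        cases hj : st.depth (flip d) with
        | some j =>
          obtain ⟨a, b, c⟩ := ih k ds (M.markEdge d st) (N.markEdge (f.toEquiv d) st') h₁ hm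
          exact ⟨by simp only [a], b, c⟩
        | none =>
          have hv : ∀ x, (N.visit (f.toEquiv (flip d)) (k + 1)
              (N.markEdge (f.toEquiv d) st')).depth (f.toEquiv x) =
              (M.visit (flip d) (k + 1) (M.markEdge d st)).depth x := by
            intro x
            by_cases hx : M.origin x = M.origin (flip d)
            · simp only [visit, hx, (f.origin_eq_iff _ _).2 hx, if_true]
            · simp only [visit, hx, mt (f.origin_eq_iff _ _).1 hx, if_false, markEdge, h₁]
          obtain ⟨a, b, c⟩ := ih (k + 1) (M.around (flip d)).tail
            (M.visit (flip d) (k + 1) (M.markEdge d st))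
            (N.visit (f.toEquiv (flip d)) (k + 1) (N.markEdge (f.toEquiv d) st')) hv hm
          rw [List.map_tail, ← f.around] at a b c
          obtain ⟨a', b', c'⟩ := ih k ds _ _ b c
          exact ⟨by simp only [a, a'], b', c'⟩

theorem Iso.explorationTree_eq {M N : RootedMap} (f : Iso M N) :
    M.explorationTree = N.explorationTree := by
  have hf : N.explorationForest = M.explorationForest := by
    have h := (f.explore (Nat.card M.Dart) (-1) (M.around M.root)
      (M.visit M.root (-1) ⟨fun _ => none, ∅⟩)
      (N.visit (f.toEquiv M.root) (-1) ⟨fun _ => none, ∅⟩)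
      (fun x => by
        by_cases hx : M.origin x = M.origin M.root
        · simp only [visit, hx, (f.origin_eq_iff _ _).2 hx, if_true]
        · simp only [visit, hx, mt (f.origin_eq_iff _ _).1 hx, if_false])
      (fun x => by simp only [visit, Set.mem_empty_iff_false])).1
    rw [← f.around, f.map_root, Nat.card_congr f.toEquiv] at h
    simp only [explorationForest]
    rw [Nat.card_congr f.toEquiv]
    exact h
  simp only [explorationTree, hf]

end RootedMap

/-- The transformation `T` from maps (up to isomorphism) to trees. -/
noncomputable def explorationMap : MapClass → PTree :=
  Quotient.lift RootedMap.explorationTree (fun _ _ h => h.elim fun f => f.explorationTree_eq)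

/-! ## From trees to maps: the reconnection -/

namespace PTree

theorem mem_nodes_iff (p : List ℕ) : ∀ t : PTree, p ∈ t.nodes ↔ (t.at? p).isSome := by
  induction p with
  | nil => intro t; cases t <;> simp [nodes, at?]
  | cons i p ih =>
    intro t
    cases t with
    | leaf z => simp [nodes, at?]
    | node cs =>
      simp only [nodes, at?, List.mem_cons, reduceCtorEq, false_or, List.mem_flatten,
        List.mem_mapIdx, List.length_map, List.getElem_map]
      constructor
      · rintro ⟨l, ⟨j, hj, rfl⟩, hl⟩
        obtain ⟨q, hq, hqp⟩ := List.mem_map.1 hl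
        obtain ⟨rfl, rfl⟩ := List.cons.inj hqp
        rw [List.getElem?_eq_getElem hj]
        exact (ih _).1 hq
      · intro h
        by_cases hi : i < cs.length
        · rw [List.getElem?_eq_getElem hi] at h
          exact ⟨_, ⟨i, hi, rfl⟩, List.mem_map.2 ⟨p, (ih _).2 h, rfl⟩⟩
        · rw [List.getElem?_eq_none (by omega)] at h
          simp at h

theorem nil_mem_nodes (t : PTree) : [] ∈ t.nodes := by
  rw [mem_nodes_iff]
  simp [at?]

theorem take_mem_nodes (p : List ℕ) : ∀ (t : PTree) (k : ℕ), p ∈ t.nodes → p.take k ∈ t.nodes := by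
  induction p with
  | nil => intro t k h; simpa using h
  | cons i p ih =>
    intro t k h
    cases k with
    | zero => exact t.nil_mem_nodes
    | succ k =>
      rw [mem_nodes_iff] at h ⊢
      cases t with
      | leaf z => simp [at?] at h
      | node cs =>
        cases hc : cs[i]? with
        | none => simp [at?, hc] at h
        | some c =>
          simp only [at?, hc, Option.bind_some, List.take_succ_cons] at h ⊢
          exact (mem_nodes_iff _ _).1 (ih c k ((mem_nodes_iff _ _).2 h))

/-- The vertices of a tree `t`. They are also the edges of the map to be built: the vertex `p`
stands for the edge from `p` to its parent, the parent of the root `u` of the tree being a new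
vertex `v`. The dart `(p, true)` is based at the parent and points to `p`; the dart
`(p, false)` is based at `p` and points to the parent. -/
abbrev Node (t : PTree) : Type := {p : List ℕ // p ∈ t.nodes}

/-- The children of a vertex in traversal order. -/
def childNodes (t : PTree) (p : t.Node) : List t.Node :=
  t.nodes.attach.filter (fun q => q.1 ≠ [] ∧ q.1.dropLast = p.1)

/-- The darts at the vertex `p` of the tree in clockwise order: first the edge to the parent, then
the edges to the children, from the last one to the first one. -/
def nodeDarts (t : PTree) (p : t.Node) : List (t.Node × Bool) :=
  (p, false) :: (t.childNodes p).reverse.map (fun q => (q, true))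

/-- The clockwise rotation for the tree with the edge from `v` to the root `u` attached. -/
def treeRotation (t : PTree) : Equiv.Perm (t.Node × Bool) :=
  (t.nodes.attach.map (fun p => (t.nodeDarts p).formPerm)).prod

/-- The leaves with their labels, in traversal order. -/
def leavesList (t : PTree) : List (t.Node × ℤ) :=
  t.nodes.attach.filterMap (fun p =>
    match t.at? p.1 with
    | some (leaf z) => some (p, z)
    | _ => none)

/-- The lower vertex of the first edge on the path to `p` from its ancestor of depth `z`, where `v`
has depth `-1`. -/
def firstEdge (t : PTree) (p : t.Node) (z : ℤ) : t.Node :=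
  ⟨p.1.take (z + 1).toNat, take_mem_nodes p.1 t _ p.2⟩

/-- Reconnection of the leaf `p` with label `z`: its end at the leaf, which forms a vertex
of its own, is moved just after the edge `firstEdge` in clockwise order around the ancestor of
depth `z`. (If `x` is fixed by `r`, then `r * swap e x` inserts `x` just after `e` in the cycle
of `e` under `r`.) -/
def reconnectLeaf (t : PTree) (r : Equiv.Perm (t.Node × Bool)) (l : t.Node × ℤ) :
    Equiv.Perm (t.Node × Bool) :=
  r * Equiv.swap (t.firstEdge l.1 l.2, true) (l.1, false)

/-- The map obtained by reconnecting all leaves, starting from the last one in traversal order,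
and rooted at the edge from `v` to `u`. -/
def reconnect (t : PTree) : RootedMap where
  E := t.Node
  finite := inferInstance
  cw := t.leavesList.reverse.foldl t.reconnectLeaf t.treeRotation
  root := (⟨[], t.nil_mem_nodes⟩, true)

end PTree

/-- The transformation `S` from trees to maps (up to isomorphism). -/
def reconnectionMap (t : PTree) : MapClass :=
  Quotient.mk RootedMap.setoid t.reconnect

/-!
Both transformations are compared with the full record of a depth-first exploration, the `Forest`:
the list of the darts at a vertex in clockwise order, each being a `leaf` (the first end of an edge
to a visited vertex), a `back` (the second end of an edge already explored) or a `node` (an edge to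
a new vertex, with the forest behind it). Such a forest represents a map (`Forest.Represents`) if
every dart occurs exactly once, the rotation is the one that the forest shows, and the labels are
those of a depth-first exploration (`IsDFS`). Every connected map is represented
(`Forest.exists_represents`), and the exploration of a represented map returns the trees of the
forest (`Represents.explorationForest_eq`). The theorem is therefore a statement about the places
of the second ends.

*Planarity.* The darts of a forest form one long word, the `contour`, along a walk around the
exploration tree. The rotation composed with the reversal of the tree edges is a single cycle that
reads this word, and every edge is a chord joining two places of it. Multiplying a cycle by the
transpositions of `m` chords gives `m + 1` cycles exactly if the chords do not cross, since a
transposition splits a cycle or merges two (`IsContour.numCycles_of_noncrossing`,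
`IsContour.noncrossing_of_numCycles`). The tree edges do not cross, which counts the vertices; the
faces are counted by the other edges, so that Euler's formula says that these do not cross
(`Represents.isPlanar_iff`).

*Non-separability.* If no edge led from the subtree at a child of a vertex to a proper ancestor of
this vertex, the vertex would separate the subtree from the rest of the map. Hence every subtree has
an escaping edge (`IsDFS.hasEscapes`). An escaping edge must not cross an edge that closes at the
vertex; therefore the second ends of the leaves labelled by the depth of the vertex come
immediately after the child from which these leaves descend, in traversal order (`IsTight`), and the
labels satisfy the conditions on decorated trees (`IsDFS.isTight_and_isDecorated`). Conversely, in a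
forest with these properties the edges do not cross (`IsTight.noncrossing_leaves`), and the escaping
edges prevent a separation (`Represents.isNonSeparablePlanar`).

*Reconnection.* Multiplying by the transpositions of the reconnection inserts the second ends
one by one into the cycles of the tree rotation (`Equiv.Perm.IsCycList.foldr_mul_swap`), which
yields precisely a forest with the second ends at these places
(`PTree.IsDecorated.exists_represents`). A forest of this kind is determined by its trees up to
the names of the edges (`Represents.nonempty_iso_of_toTrees_eq`). So a non-separable planar map is
isomorphic to the reconnection of its exploration tree, and a decorated tree is the exploration
tree of its reconnection.
-/

/-! ### Cycles of a permutation multiplied by a transposition -/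

namespace Equiv.Perm

variable {α : Type*}

/-- The number of cycles of a permutation, fixed points included. -/
noncomputable def numCycles (σ : Equiv.Perm α) : ℕ :=
  Nat.card (Quotient (SameCycle.setoid σ))

theorem SameCycle.apply_eq_of_invariant {β : Type*} {σ : Equiv.Perm α} {f : α → β}
    (hf : ∀ z, f (σ z) = f z) {x y : α} (h : σ.SameCycle x y) : f x = f y := by
  obtain ⟨i, rfl⟩ := h
  induction i with
  | zero => simp
  | succ n ih =>
    rw [add_comm, zpow_add, mul_apply, zpow_one, hf, ih]
  | pred n ih =>
    rw [ih, ← hf ((σ ^ (-(n : ℤ) - 1)) x)]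
    congr 1
    rw [← mul_apply, ← zpow_one_add]
    congr 2
    ring

theorem SameCycle.mem_of_invariant [Finite α] {σ : Equiv.Perm α} {s : Set α}
    (hs : ∀ z ∈ s, σ z ∈ s) {x y : α} (h : σ.SameCycle x y) (hx : x ∈ s) : y ∈ s := by
  obtain ⟨i, rfl⟩ := h.exists_nat_pow_eq
  induction i with
  | zero => simpa
  | succ n ih =>
    rw [pow_succ', mul_apply]
    exact hs _ (ih ⟨n, by simp⟩)

variable [DecidableEq α] [Finite α]

/-- The product sends `y` to `σ x`, and from there follows the cycle of `x` under `σ` up to `x`. -/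
theorem sameCycle_mul_swap_of_not_sameCycle {σ : Equiv.Perm α} {x y : α}
    (h : ¬ σ.SameCycle x y) : (σ * swap x y).SameCycle x y := by
  have key : ∀ j : ℕ, (σ * swap x y).SameCycle y ((σ ^ (j + 1)) x) ∨
      (σ * swap x y).SameCycle y x := by
    intro j
    induction j with
    | zero => exact Or.inl ⟨1, by simp⟩
    | succ j ih =>
      rcases ih with ih | ih
      · by_cases hx : (σ ^ (j + 1)) x = x
        · exact Or.inr (by rwa [hx] at ih)
        · have hy : (σ ^ (j + 1)) x ≠ y := fun e => h ⟨(j + 1 : ℕ), by exact_mod_cast e⟩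
          refine Or.inl (ih.trans ⟨1, ?_⟩)
          rw [zpow_one, mul_apply, swap_apply_of_ne_of_ne hx hy, ← mul_apply, ← pow_succ']
      · exact Or.inr ih
  obtain ⟨n, hn, hx⟩ := (SameCycle.refl σ x).exists_pow_eq'
  have hpos := orderOf_pos σ
  rcases key (orderOf σ - 1) with h1 | h1
  · rw [Nat.sub_add_cancel hpos, pow_orderOf_eq_one, one_apply] at h1
    exact h1.symm
  · exact h1.symm

theorem not_sameCycle_mul_swap_of_sameCycle {σ : Equiv.Perm α} {x y : α} (hxy : x ≠ y)
    (h : σ.SameCycle x y) : ¬ (σ * swap x y).SameCycle x y := by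
  classical
  have hex : ∃ k : ℕ, (σ ^ k) x = y := h.exists_nat_pow_eq
  set k := Nat.find hex with hk
  have hky : (σ ^ k) x = y := Nat.find_spec hex
  have hmin : ∀ j < k, (σ ^ j) x ≠ y := fun j hj => Nat.find_min hex hj
  have hx : ∀ j, 1 ≤ j → j ≤ k → (σ ^ j) x ≠ x := by
    intro j h1 h2 e
    refine hmin (k - j) (by omega) ?_
    rw [← hky]
    conv_lhs => rw [← e]
    rw [← mul_apply, ← pow_add, Nat.sub_add_cancel h2]
  have hk0 : k ≠ 0 := fun e => hxy (by rw [← hky, e, pow_zero, one_apply])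
  -- The iterates of `x` from the first one up to `y` form an invariant set without `x`.
  let s : Set α := {z | ∃ j, 1 ≤ j ∧ j ≤ k ∧ (σ ^ j) x = z}
  intro hs
  have : x ∈ s := by
    refine SameCycle.mem_of_invariant ?_ hs.symm (⟨k, by omega, le_rfl, hky⟩ : y ∈ s)
    rintro z ⟨j, h1, h2, rfl⟩
    rcases h2.lt_or_eq with h2 | h2
    · refine ⟨j + 1, by omega, by omega, ?_⟩
      rw [mul_apply, swap_apply_of_ne_of_ne (hx j h1 h2.le) (hmin j h2), ← mul_apply, ← pow_succ']
    · refine ⟨1, le_rfl, by omega, ?_⟩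
      rw [h2, hky, mul_apply, swap_apply_right, pow_one]
  obtain ⟨j, h1, h2, e⟩ := this
  exact hx j h1 h2 e

/-- A transposition of two points in different cycles merges these cycles. -/
theorem numCycles_mul_swap_of_not_sameCycle {σ : Equiv.Perm α} {x y : α}
    (h : ¬ σ.SameCycle x y) : (σ * swap x y).numCycles + 1 = σ.numCycles := by
  classical
  have hs := sameCycle_mul_swap_of_not_sameCycle h
  let q : α → Quotient (SameCycle.setoid σ) := Quotient.mk _
  let q' : α → Quotient (SameCycle.setoid (σ * swap x y)) := Quotient.mk _
  have hq : ∀ a b, q a = q b ↔ σ.SameCycle a b := fun a b => Quotient.eq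
  have hq' : ∀ a b, q' a = q' b ↔ (σ * swap x y).SameCycle a b := fun a b => Quotient.eq
  have hstep : ∀ z, q' (σ z) = q' z := by
    intro z
    have h1 : q' (σ z) = q' (swap x y z) := by
      rw [hq']
      exact SameCycle.symm ⟨1, by simp⟩
    rw [h1]
    rcases eq_or_ne z x with rfl | hx
    · rw [swap_apply_left]; exact (hq' _ _).2 hs.symm
    · rcases eq_or_ne z y with rfl | hy
      · rw [swap_apply_right]; exact (hq' _ _).2 hs
      · rw [swap_apply_of_ne_of_ne hx hy]
  let f : α → Quotient (SameCycle.setoid σ) := fun z => if q z = q y then q x else q z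
  have hqs : ∀ z, q (σ z) = q z := fun z => (hq _ _).2 (SameCycle.symm ⟨1, by simp⟩)
  have hxy : q x ≠ q y := fun e => h ((hq _ _).1 e)
  have hf : ∀ z, f ((σ * swap x y) z) = f z := by
    intro z
    simp only [f, mul_apply, hqs]
    rcases eq_or_ne z x with rfl | hx
    · simp [swap_apply_left, hxy]
    · rcases eq_or_ne z y with rfl | hy
      · simp [swap_apply_right]
      · rw [swap_apply_of_ne_of_ne hx hy]
  let g : {c : Quotient (SameCycle.setoid σ) // c ≠ q y} →
      Quotient (SameCycle.setoid (σ * swap x y)) := fun c =>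
    Quotient.lift q' (fun a b hab => SameCycle.apply_eq_of_invariant hstep hab) c.1
  have hg : Function.Bijective g := by
    constructor
    · rintro ⟨a, ha⟩ ⟨b, hb⟩ hab
      induction a using Quotient.inductionOn with | _ a
      induction b using Quotient.inductionOn with | _ b
      have e : f a = f b := SameCycle.apply_eq_of_invariant hf ((hq' _ _).1 hab)
      have ha' : q a ≠ q y := ha
      have hb' : q b ≠ q y := hb
      simp only [f, ha', hb', if_false] at e
      exact Subtype.ext e
    · intro c
      induction c using Quotient.inductionOn with | _ c
      by_cases hc : q c = q y
      · refine ⟨⟨q x, hxy⟩, ?_⟩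
        have h2 : q' c = q' y := SameCycle.apply_eq_of_invariant hstep ((hq _ _).1 hc)
        exact ((hq' _ _).2 hs).trans h2.symm
      · exact ⟨⟨q c, hc⟩, rfl⟩
  rw [numCycles, numCycles, ← Nat.card_congr (Equiv.ofBijective g hg)]
  have e := Nat.card_congr (Equiv.sumCompl (fun c : Quotient (SameCycle.setoid σ) => c = q y))
  rw [Nat.card_sum, Nat.card_unique, add_comm] at e
  exact e

/-- A transposition of two points in the same cycle splits this cycle. -/
theorem numCycles_mul_swap_of_sameCycle {σ : Equiv.Perm α} {x y : α} (hxy : x ≠ y)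
    (h : σ.SameCycle x y) : (σ * swap x y).numCycles = σ.numCycles + 1 := by
  have := numCycles_mul_swap_of_not_sameCycle (not_sameCycle_mul_swap_of_sameCycle hxy h)
  rw [mul_assoc, swap_mul_self, mul_one] at this
  exact this.symm

theorem numCycles_mul_swap_le {σ : Equiv.Perm α} {x y : α} (hxy : x ≠ y) :
    (σ * swap x y).numCycles ≤ σ.numCycles + 1 := by
  by_cases h : σ.SameCycle x y
  · exact (numCycles_mul_swap_of_sameCycle hxy h).le
  · have := numCycles_mul_swap_of_not_sameCycle h
    omega

end Equiv.Perm

/-! ### Chords on a cycle -/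

namespace RootedMap

open Equiv Equiv.Perm

variable {E : Type}

@[simp] theorem flip_apply (e : E) (b : Bool) : flip (e, b) = (e, !b) := rfl

@[simp] theorem flip_fst (x : E × Bool) : (flip x).1 = x.1 := rfl

@[simp] theorem flip_flip (x : E × Bool) : flip (flip x) = x := by
  obtain ⟨e, b⟩ := x
  simp

theorem flip_ne (x : E × Bool) : flip x ≠ x := by
  obtain ⟨e, b⟩ := x
  simp

theorem eq_flip_iff {x y : E × Bool} : x = flip y ↔ flip x = y :=
  ⟨fun h => by rw [h, flip_flip], fun h => by rw [← h, flip_flip]⟩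

theorem eq_or_eq_flip {x y : E × Bool} (h : x.1 = y.1) : x = y ∨ x = flip y := by
  obtain ⟨e, b⟩ := x
  obtain ⟨e', b'⟩ := y
  simp only at h
  subst h
  cases b <;> cases b' <;> simp

open Classical in
/-- Reversal of the edges of a finite set; the darts of the other edges are fixed. -/
noncomputable def flipOn (S : Finset E) : Equiv.Perm (E × Bool) where
  toFun x := if x.1 ∈ S then flip x else x
  invFun x := if x.1 ∈ S then flip x else x
  left_inv x := by by_cases h : x.1 ∈ S <;> simp [h]
  right_inv x := by by_cases h : x.1 ∈ S <;> simp [h]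

theorem flipOn_of_mem {S : Finset E} {x : E × Bool} (h : x.1 ∈ S) : flipOn S x = flip x := by
  simp [flipOn, h]

theorem flipOn_of_notMem {S : Finset E} {x : E × Bool} (h : x.1 ∉ S) : flipOn S x = x := by
  simp [flipOn, h]

theorem flipOn_mul_self (S : Finset E) : flipOn S * flipOn S = 1 := by
  ext1 x
  by_cases h : x.1 ∈ S
  · rw [Perm.mul_apply, flipOn_of_mem h, flipOn_of_mem (by simpa using h), flip_flip, one_apply]
  · rw [Perm.mul_apply, flipOn_of_notMem h, flipOn_of_notMem h, one_apply]

open Classical in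
theorem flipOn_mul_flip [Fintype E] (S : Finset E) : flipOn S * flip = flipOn Sᶜ := by
  ext1 x
  by_cases h : x.1 ∈ S
  · rw [Perm.mul_apply, flipOn_of_mem (by simpa using h), flip_flip,
      flipOn_of_notMem (by simpa using h)]
  · rw [Perm.mul_apply, flipOn_of_notMem (by simpa using h), flipOn_of_mem (by simpa using h)]

theorem flipOn_insert [DecidableEq E] {S : Finset E} {e : E} (he : e ∉ S) {x : E × Bool}
    (hx : x.1 = e) : flipOn (insert e S) = flipOn S * swap x (flip x) := by
  ext1 y
  rw [Perm.mul_apply]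
  by_cases hy : y.1 = e
  · rw [flipOn_of_mem (by simp [hy])]
    rcases eq_or_eq_flip (hy.trans hx.symm) with rfl | rfl
    · rw [swap_apply_left, flipOn_of_notMem (by simpa [hy])]
    · rw [swap_apply_right, flip_flip, flipOn_of_notMem (by simpa [hx])]
  · have h1 : y ≠ x := fun h => hy (h ▸ hx)
    have h2 : y ≠ flip x := fun h => hy (by rw [h]; exact hx)
    rw [swap_apply_of_ne_of_ne h1 h2]
    by_cases h : y.1 ∈ S
    · rw [flipOn_of_mem h, flipOn_of_mem (by simp [h])]
    · rw [flipOn_of_notMem h, flipOn_of_notMem (by simp [h, hy])]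

/-- The edges of `S`, seen as chords between the positions of their darts, do not cross. -/
def Noncrossing (pos : E × Bool → ℕ) (S : Finset E) : Prop :=
  ∀ x y : E × Bool, x.1 ∈ S → y.1 ∈ S →
    ¬ (pos x < pos y ∧ pos y < pos (flip x) ∧ pos (flip x) < pos (flip y))

/-- The permutation `φ` moves every dart to the next position; the last dart can go anywhere,
so that `φ` is a single cycle. -/
structure IsContour (φ : Equiv.Perm (E × Bool)) (pos : E × Bool → ℕ) : Prop where
  injective : Function.Injective pos
  apply_eq : ∀ x y, pos x < pos y → pos (φ x) = pos x + 1

variable {φ : Equiv.Perm (E × Bool)} {pos : E × Bool → ℕ}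

theorem IsContour.sameCycle (h : IsContour φ pos) (x y : E × Bool) : φ.SameCycle x y := by
  suffices H : ∀ n, ∀ x y, pos y = pos x + n → φ.SameCycle x y by
    rcases le_total (pos x) (pos y) with hxy | hxy
    · exact H (pos y - pos x) x y (by omega)
    · exact (H (pos x - pos y) y x (by omega)).symm
  intro n
  induction n with
  | zero => intro x y hxy; rw [h.injective hxy]
  | succ n ih =>
    intro x y hxy
    have h1 := h.apply_eq x y (by omega)
    exact SameCycle.trans ⟨1, by simp⟩ (ih (φ x) y (by omega))

theorem IsContour.numCycles [Nonempty E] (h : IsContour φ pos) : φ.numCycles = 1 := by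
  rw [Equiv.Perm.numCycles, Nat.card_eq_one_iff_unique]
  refine ⟨⟨fun a b => ?_⟩, ⟨Quotient.mk _ (Classical.arbitrary E, true)⟩⟩
  induction a using Quotient.inductionOn with | _ a
  induction b using Quotient.inductionOn with | _ b
  exact Quotient.sound (h.sameCycle a b)

/-- The face to the right of the first end of a chord leads to its second end: chords met on the
way are nested in the given chord, and the face passes them from end to end. -/
theorem IsContour.sameCycle_of_noncrossing (h : IsContour φ pos) {S : Finset E} {a : E × Bool}
    (haS : a.1 ∉ S) (hab : pos a < pos (flip a))
    (hS : ∀ x y : E × Bool, (x = a ∨ x.1 ∈ S) → (y = a ∨ y.1 ∈ S) →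
      ¬ (pos x < pos y ∧ pos y < pos (flip x) ∧ pos (flip x) < pos (flip y))) :
    (φ * flipOn S).SameCycle a (flip a) := by
  suffices H : ∀ n, ∀ z, pos z + n = pos (flip a) → pos a < pos z →
      (∀ y : E × Bool, y.1 ∈ S → pos a < pos y → pos y < pos z → pos (flip y) < pos z) →
      (φ * flipOn S).SameCycle z (flip a) by
    have h1 := h.apply_eq a _ hab
    refine SameCycle.trans ⟨1, ?_⟩ (H (pos (flip a) - (pos a + 1)) (φ a) (by omega) (by omega)
      (fun y _ _ _ => by omega))
    rw [zpow_one, Perm.mul_apply, flipOn_of_notMem haS]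
  intro n
  induction n using Nat.strong_induction_on with
  | _ n ih =>
    intro z hz haz hinv
    rcases Nat.eq_zero_or_pos n with rfl | hn
    · rw [h.injective hz]
    by_cases hzS : z.1 ∈ S
    · have hne : pos (flip z) ≠ pos z := fun e => flip_ne z (h.injective e)
      have hne' : pos (flip z) ≠ pos (flip a) := fun e => by
        rw [flip.injective (h.injective e)] at haz
        exact lt_irrefl _ haz
      have hne'' : pos (flip z) ≠ pos a := fun e => haS (by
        rw [← h.injective e]; simpa using hzS)
      rcases lt_or_gt_of_ne hne with h1 | h1
      · exfalso
        rcases lt_or_gt_of_ne hne'' with h2 | h2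
        · refine hS (flip z) a (Or.inr (by simpa using hzS)) (Or.inl rfl) ?_
          rw [flip_flip]
          omega
        · have := hinv (flip z) (by simpa using hzS) h2 h1
          rw [flip_flip] at this
          omega
      · have h2 : pos (flip z) < pos (flip a) := by
          have := hS a z (Or.inl rfl) (Or.inr hzS)
          omega
        have h3 := h.apply_eq (flip z) _ h2
        refine SameCycle.trans ⟨1, ?_⟩ (ih (pos (flip a) - (pos (flip z) + 1)) (by omega)
          (φ (flip z)) (by omega) (by omega) ?_)
        · rw [zpow_one, Perm.mul_apply, flipOn_of_mem hzS]
        · intro y hyS hay hyz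
          rw [h3] at hyz ⊢
          rcases lt_trichotomy (pos y) (pos z) with h4 | h4 | h4
          · have := hinv y hyS hay h4
            omega
          · rw [h.injective h4]
            omega
          · by_cases h5 : pos y = pos (flip z)
            · rw [h.injective h5, flip_flip]
              omega
            · have := hS z y (Or.inr hzS) (Or.inr hyS)
              omega
    · have h3 := h.apply_eq z (flip a) (by omega)
      refine SameCycle.trans ⟨1, ?_⟩ (ih (n - 1) (by omega) (φ z) (by omega) (by omega) ?_)
      · rw [zpow_one, Perm.mul_apply, flipOn_of_notMem hzS]
      · intro y hyS hay hyz
        have hne : pos y ≠ pos z := fun e => hzS (h.injective e ▸ hyS)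
        have := hinv y hyS hay (by omega)
        omega

/-- Each of several noncrossing chords splits one face in two: its two ends lie on the same face of
the other chords. -/
theorem IsContour.numCycles_of_noncrossing [Finite E] [Nonempty E] (h : IsContour φ pos)
    {S : Finset E} (hS : Noncrossing pos S) : (φ * flipOn S).numCycles = S.card + 1 := by
  classical
  induction S using Finset.induction_on with
  | empty =>
    have : flipOn (∅ : Finset E) = 1 := by
      ext1 x
      rw [flipOn_of_notMem (by simp), one_apply]
    rw [this, mul_one, h.numCycles, Finset.card_empty]
  | insert e S he ih =>
    have hS' : Noncrossing pos S := fun x y hx hy =>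
      hS x y (Finset.mem_insert_of_mem hx) (Finset.mem_insert_of_mem hy)
    obtain ⟨a, rfl, ha⟩ : ∃ a : E × Bool, a.1 = e ∧ pos a < pos (flip a) := by
      rcases lt_trichotomy (pos (e, true)) (pos (flip (e, true))) with h1 | h1 | h1
      · exact ⟨_, rfl, h1⟩
      · exact absurd (h.injective h1).symm (flip_ne _)
      · exact ⟨flip (e, true), rfl, by rwa [flip_flip]⟩
    rw [flipOn_insert he rfl, ← mul_assoc, numCycles_mul_swap_of_sameCycle (flip_ne a).symm, ih hS',
      Finset.card_insert_of_notMem he]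
    refine h.sameCycle_of_noncrossing he ha fun x y hx hy => hS x y ?_ ?_
    · rcases hx with rfl | hx
      · exact Finset.mem_insert_self _ _
      · exact Finset.mem_insert_of_mem hx
    · rcases hy with rfl | hy
      · exact Finset.mem_insert_self _ _
      · exact Finset.mem_insert_of_mem hy

theorem numCycles_mul_flipOn_union_le [Finite E] [DecidableEq E] (S T : Finset E)
    (hST : Disjoint S T) :
    (φ * flipOn (T ∪ S)).numCycles ≤ (φ * flipOn T).numCycles + S.card := by
  classical
  induction S using Finset.induction_on with
  | empty => simp
  | insert e S he ih =>
    rw [Finset.disjoint_insert_left] at hST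
    have h1 : e ∉ T ∪ S := by simp [hST.1, he]
    have h2 : T ∪ insert e S = insert e (T ∪ S) := by
      ext; simp only [Finset.mem_union, Finset.mem_insert]; tauto
    have := ih hST.2
    have h3 := numCycles_mul_swap_le (σ := φ * flipOn (T ∪ S)) (flip_ne (e, true)).symm
    have h4 := flipOn_insert h1 (x := (e, true)) rfl
    rw [mul_assoc, ← h4] at h3
    rw [h2, Finset.card_insert_of_notMem he]
    omega

/-- Two crossing chords do not split the cycle, so that each of the other chords would have to
create more than one cycle. -/
theorem IsContour.noncrossing_of_numCycles [Finite E] [Nonempty E] (h : IsContour φ pos)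
    {S : Finset E} (hS : (φ * flipOn S).numCycles = S.card + 1) : Noncrossing pos S := by
  classical
  intro x y hx hy ⟨h1, h2, h3⟩
  have hxy : x.1 ≠ y.1 := by
    intro e
    rcases eq_or_eq_flip e with rfl | rfl
    · omega
    · rw [flip_flip] at *
      omega
  have hφ : (φ * flipOn {x.1, y.1}).numCycles = 1 := by
    have e1 : ({x.1, y.1} : Finset E) = insert y.1 (insert x.1 ∅) := by
      ext; simp [or_comm]
    rw [e1, flipOn_insert (x := y) (by simpa using hxy.symm) rfl,
      flipOn_insert (x := x) (by simp) rfl]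
    have e2 : flipOn (∅ : Finset E) = 1 := by
      ext1 x
      rw [flipOn_of_notMem (by simp), one_apply]
    rw [e2, one_mul, ← mul_assoc]
    have e3 := numCycles_mul_swap_of_sameCycle (flip_ne x).symm (h.sameCycle x (flip x))
    rw [h.numCycles] at e3
    have e4 : ¬ (φ * swap x (flip x)).SameCycle y (flip y) := by
      intro hs
      -- After `x` is cut, the darts strictly after `x` up to `flip x` form a face.
      let I : Set (E × Bool) := {z | pos x < pos z ∧ pos z ≤ pos (flip x)}
      have : flip y ∈ I := by
        refine SameCycle.mem_of_invariant (s := I) ?_ hs ⟨h1, h2.le⟩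
        rintro z ⟨h4, h5⟩
        rw [Perm.mul_apply]
        by_cases hz : z = flip x
        · rw [hz, swap_apply_right]
          have := h.apply_eq x (flip x) (by omega)
          constructor <;> omega
        · have h6 : pos z ≠ pos (flip x) := fun e => hz (h.injective e)
          have := h.apply_eq z (flip x) (by omega)
          rw [swap_apply_of_ne_of_ne (fun e => by rw [e] at h4; omega) hz]
          constructor <;> omega
      exact absurd this.2 (by omega)
    have := numCycles_mul_swap_of_not_sameCycle e4
    omega
  have hsub : ({x.1, y.1} : Finset E) ⊆ S := by
    intro z hz
    simp only [Finset.mem_insert, Finset.mem_singleton] at hz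
    rcases hz with rfl | rfl <;> assumption
  have h4 := numCycles_mul_flipOn_union_le (φ := φ) (S \ {x.1, y.1}) {x.1, y.1}
    Finset.sdiff_disjoint
  rw [Finset.union_sdiff_of_subset hsub, hS, hφ, Finset.card_sdiff_of_subset hsub,
    Finset.card_pair hxy] at h4
  have := Finset.card_le_card hsub
  rw [Finset.card_pair hxy] at this
  omega

end RootedMap

/-! ### Exploration forests -/

/-- The trace of an exploration around a vertex: the list of the remaining darts at this vertex, in
clockwise order, each with what is found behind it. Along `leaf d j` an already visited vertex of
depth `j` is reached; `back d` is an edge already explored from its other end; along `node d sub` a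
new vertex is reached, and `sub` describes its darts other than `flip d`. -/
inductive Forest (D : Type) : Type
  | nil : Forest D
  | leaf (d : D) (label : ℤ) (rest : Forest D) : Forest D
  | back (d : D) (rest : Forest D) : Forest D
  | node (d : D) (sub rest : Forest D) : Forest D

namespace Forest

open RootedMap (flip)

/-- The darts at the vertex itself. -/
def tops {D : Type} : Forest D → List D
  | nil => []
  | leaf d _ rest => d :: rest.tops
  | back d rest => d :: rest.tops
  | node d _ rest => d :: rest.tops

/-- The darts at the vertex itself that are the second ends of explored edges. -/
def backs {D : Type} : Forest D → List D
  | nil => []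
  | leaf _ _ rest => rest.backs
  | back d rest => d :: rest.backs
  | node _ _ rest => rest.backs

/-- The maximal initial run of second ends. -/
def initialBacks {D : Type} : Forest D → List D
  | back d rest => d :: rest.initialBacks
  | _ => []

/-- All the second ends of explored edges, at all vertices. -/
def allBacks {D : Type} : Forest D → List D
  | nil => []
  | leaf _ _ rest => rest.allBacks
  | back d rest => d :: rest.allBacks
  | node _ sub rest => sub.allBacks ++ rest.allBacks

/-- The leaves with their labels in traversal order, which is opposite to the order of the
exploration. -/
def leaves {D : Type} : Forest D → List (D × ℤ)
  | nil => []
  | leaf d j rest => rest.leaves ++ [(d, j)]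
  | back _ rest => rest.leaves
  | node _ sub rest => rest.leaves ++ sub.leaves

/-- The darts that lead to new vertices. -/
def treeDarts {D : Type} : Forest D → List D
  | nil => []
  | leaf _ _ rest => rest.treeDarts
  | back _ rest => rest.treeDarts
  | node d sub rest => d :: (sub.treeDarts ++ rest.treeDarts)

/-- The darts along which edges are explored. -/
def openings {D : Type} : Forest D → List D
  | nil => []
  | leaf d _ rest => d :: rest.openings
  | back _ rest => rest.openings
  | node d sub rest => d :: (sub.openings ++ rest.openings)

/-- The plane trees of an exploration, in traversal order. -/
def toTrees {D : Type} : Forest D → List PTree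
  | nil => []
  | leaf _ j rest => rest.toTrees ++ [PTree.leaf j]
  | back _ rest => rest.toTrees
  | node _ sub rest => rest.toTrees ++ [PTree.node sub.toTrees]

variable {E : Type}

/-- All darts in the order of a walk around the exploration trees. -/
def contour : Forest (E × Bool) → List (E × Bool)
  | nil => []
  | leaf d _ rest => d :: rest.contour
  | back d rest => d :: rest.contour
  | node d sub rest => d :: (sub.contour ++ flip d :: rest.contour)

/-- The second ends, in clockwise order, of the edges whose first ends are the leaves with
label `k`. -/
def closings (k : ℤ) (F : Forest (E × Bool)) : List (E × Bool) :=
  (F.leaves.filter (fun l => l.2 = k)).map (fun l => flip l.1)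

/-- The labels fit together as in a depth-first exploration: a forest at a vertex of depth `k`, of
which the part already read contains the leaves `pre`. A second end has its first end among the
leaves already read, with label `k`; conversely a leaf with label `k` has its second end later at
the same vertex. -/
def IsDFS : ℤ → List ((E × Bool) × ℤ) → Forest (E × Bool) → Prop
  | _, _, nil => True
  | k, pre, leaf d j rest =>
    j ≤ k ∧ (j = k → flip d ∈ rest.backs) ∧ IsDFS k (pre ++ [(d, j)]) rest
  | k, pre, back d rest => (flip d, k) ∈ pre ∧ IsDFS k pre rest
  | k, pre, node _ sub rest =>
    IsDFS (k + 1) [] sub ∧ (∀ l, (l, k) ∈ sub.leaves → flip l ∈ rest.backs) ∧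
      IsDFS k (pre ++ sub.leaves) rest

/-- The second ends are at the places prescribed by the reconnection: those of the leaves labelled
by the depth of the vertex follow immediately the child from which these leaves descend. -/
def IsTight : ℤ → Forest (E × Bool) → Prop
  | _, nil => True
  | k, leaf _ _ rest => rest.initialBacks = [] ∧ IsTight k rest
  | k, back _ rest => IsTight k rest
  | k, node _ sub rest =>
    sub.initialBacks = [] ∧ rest.initialBacks = sub.closings k ∧ IsTight (k + 1) sub ∧
      IsTight k rest

/-- The conditions on decorated trees, for a forest at a vertex of depth `k`. -/
def IsDecorated {D : Type} : ℤ → Forest D → Prop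
  | _, nil => True
  | k, leaf _ j rest => -1 ≤ j ∧ j < k ∧ IsDecorated k rest
  | k, back _ rest => IsDecorated k rest
  | k, node _ sub rest =>
    (0 ≤ k → ∃ l ∈ sub.leaves, l.2 ≤ k - 1) ∧
      sub.leaves.Pairwise (fun a b => b.2 = k → k ≤ a.2) ∧ sub.toTrees ≠ [] ∧
      IsDecorated (k + 1) sub ∧ IsDecorated k rest

/-- From every child of a vertex of depth `k` some edge leads to a proper ancestor of this
vertex. -/
def HasEscapes {D : Type} : ℤ → Forest D → Prop
  | _, nil => True
  | k, leaf _ j rest => j ≤ k - 1 ∧ HasEscapes k rest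
  | k, back _ rest => HasEscapes k rest
  | k, node _ sub rest =>
    (∃ l ∈ sub.leaves, l.2 ≤ k - 1) ∧ HasEscapes (k + 1) sub ∧ HasEscapes k rest

/-! ### Positions along the contour -/

theorem initialBacks_subset {D : Type} {F : Forest D} {x : D} (h : x ∈ F.initialBacks) :
    x ∈ F.backs := by
  induction F with
  | nil => simp [initialBacks] at h
  | leaf => simp [initialBacks] at h
  | node => simp [initialBacks] at h
  | back d rest ih =>
    simp only [initialBacks, List.mem_cons, backs] at h ⊢
    exact h.imp id ih

theorem backs_subset_tops {D : Type} {F : Forest D} {x : D} (h : x ∈ F.backs) : x ∈ F.tops := by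
  induction F with
  | nil => simp [backs] at h
  | leaf d j rest ih => exact List.mem_cons_of_mem _ (ih h)
  | node d sub rest _ ih => exact List.mem_cons_of_mem _ (ih h)
  | back d rest ih =>
    simp only [backs, List.mem_cons, tops] at h ⊢
    exact h.imp id ih

theorem tops_subset_contour {F : Forest (E × Bool)} {x : E × Bool} (h : x ∈ F.tops) :
    x ∈ F.contour := by
  induction F with
  | nil => simp [tops] at h
  | leaf d j rest ih => simp only [tops, List.mem_cons, contour] at h ⊢; exact h.imp id ih
  | node d sub rest _ ih =>
    simp only [tops, List.mem_cons, contour, List.mem_append] at h ⊢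
    exact h.imp id fun h => Or.inr (Or.inr (ih h))
  | back d rest ih => simp only [tops, List.mem_cons, contour] at h ⊢; exact h.imp id ih

theorem leaves_subset_contour {F : Forest (E × Bool)} {l : (E × Bool) × ℤ} (h : l ∈ F.leaves) :
    l.1 ∈ F.contour := by
  induction F with
  | nil => simp [leaves] at h
  | leaf d j rest ih =>
    simp only [leaves, List.mem_append, List.mem_singleton] at h
    rcases h with h | rfl
    · exact List.mem_cons_of_mem _ (ih h)
    · exact List.mem_cons_self
  | back d rest ih => exact List.mem_cons_of_mem _ (ih h)
  | node d sub rest ih1 ih2 =>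
    simp only [leaves, List.mem_append, contour, List.mem_cons] at h ⊢
    rcases h with h | h
    · exact Or.inr (Or.inr (Or.inr (ih2 h)))
    · exact Or.inr (Or.inl (ih1 h))

theorem backs_subset_contour {F : Forest (E × Bool)} {x : E × Bool} (h : x ∈ F.backs) :
    x ∈ F.contour :=
  tops_subset_contour (backs_subset_tops h)

theorem mem_contour_iff {F : Forest (E × Bool)} {x : E × Bool} :
    x ∈ F.contour ↔ (∃ j, (x, j) ∈ F.leaves) ∨ x ∈ F.allBacks ∨ x ∈ F.treeDarts ∨
      flip x ∈ F.treeDarts := by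
  induction F with
  | nil => simp [contour, leaves, allBacks, treeDarts]
  | leaf d j rest ih =>
    simp only [contour, List.mem_cons, ih, leaves, List.mem_append, Prod.mk.injEq,
      List.not_mem_nil, or_false, allBacks, treeDarts, exists_or, exists_and_left, exists_eq,
      and_true]
    tauto
  | back d rest ih =>
    simp only [contour, List.mem_cons, ih, leaves, allBacks, treeDarts]
    tauto
  | node d sub rest ih1 ih2 =>
    simp only [contour, List.mem_cons, ih1, ih2, leaves, List.mem_append, allBacks, treeDarts,
      exists_or, RootedMap.eq_flip_iff]
    grind

theorem mem_closings {k : ℤ} {F : Forest (E × Bool)} {x : E × Bool} :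
    x ∈ F.closings k ↔ (flip x, k) ∈ F.leaves := by
  simp only [closings, List.mem_map, List.mem_filter, decide_eq_true_eq]
  constructor
  · rintro ⟨⟨d, j⟩, ⟨h, rfl⟩, rfl⟩
    simpa using h
  · intro h
    exact ⟨(flip x, k), ⟨h, rfl⟩, by simp⟩

theorem exists_leaf_toTrees_ne_nil {D : Type} {F : Forest D} {l : D × ℤ} (h : l ∈ F.leaves) :
    F.toTrees ≠ [] := by
  induction F with
  | nil => simp [leaves] at h
  | leaf => simp [toTrees]
  | back d rest ih => exact ih h
  | node => simp [toTrees]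

variable {pos : E × Bool → ℕ}

theorem pairwise_initialBacks {F : Forest (E × Bool)}
    (h : F.contour.Pairwise (fun x y => pos x < pos y)) :
    F.initialBacks.Pairwise (fun x y => pos x < pos y) := by
  induction F with
  | nil => simp [initialBacks]
  | leaf => simp [initialBacks]
  | node => simp [initialBacks]
  | back d rest ih =>
    simp only [initialBacks, contour, List.pairwise_cons] at h ⊢
    exact ⟨fun x hx => h.1 x (backs_subset_contour (initialBacks_subset hx)), ih h.2⟩

theorem pairwise_leaves {F : Forest (E × Bool)}
    (h : F.contour.Pairwise (fun x y => pos x < pos y)) :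
    F.leaves.Pairwise (fun x y => pos y.1 < pos x.1) := by
  induction F with
  | nil => simp [leaves]
  | leaf d j rest ih =>
    simp only [contour, List.pairwise_cons] at h
    simp only [leaves, List.pairwise_append, List.pairwise_singleton, List.mem_singleton, true_and]
    refine ⟨ih h.2, ?_⟩
    rintro a ha b rfl
    exact h.1 _ (leaves_subset_contour ha)
  | back d rest ih =>
    simp only [contour, List.pairwise_cons] at h
    exact ih h.2
  | node d sub rest ih1 ih2 =>
    simp only [contour, List.pairwise_cons, List.pairwise_append] at h
    obtain ⟨-, h1, ⟨-, h2⟩, h3⟩ := h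
    simp only [leaves, List.pairwise_append]
    exact ⟨ih2 h2, ih1 h1, fun a ha b hb => h3 _ (leaves_subset_contour hb) _
      (List.mem_cons_of_mem _ (leaves_subset_contour ha))⟩

theorem pos_initialBacks_lt_leaf {F : Forest (E × Bool)}
    (h : F.contour.Pairwise (fun x y => pos x < pos y)) {x : E × Bool} (hx : x ∈ F.initialBacks)
    {l : (E × Bool) × ℤ} (hl : l ∈ F.leaves) : pos x < pos l.1 := by
  induction F with
  | nil => simp [initialBacks] at hx
  | leaf => simp [initialBacks] at hx
  | node => simp [initialBacks] at hx
  | back d rest ih =>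
    simp only [initialBacks, contour, List.pairwise_cons, List.mem_cons] at h hx
    rcases hx with rfl | hx
    · exact h.1 _ (leaves_subset_contour hl)
    · exact ih h.2 hx hl

theorem noncrossing_treeDarts {F : Forest (E × Bool)}
    (h : F.contour.Pairwise (fun x y => pos x < pos y)) {x y : E × Bool}
    (hx : x ∈ F.treeDarts) (hy : y ∈ F.treeDarts) :
    ¬ (pos x < pos y ∧ pos y < pos (flip x) ∧ pos (flip x) < pos (flip y)) := by
  have hmem : ∀ {G : Forest (E × Bool)} {z}, z ∈ G.treeDarts → z ∈ G.contour ∧ flip z ∈ G.contour :=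
    fun hz => ⟨mem_contour_iff.2 (by tauto), mem_contour_iff.2 (by simp [hz])⟩
  induction F with
  | nil => simp [treeDarts] at hx
  | leaf d j rest ih => exact ih (List.pairwise_cons.1 h).2 hx hy
  | back d rest ih => exact ih (List.pairwise_cons.1 h).2 hx hy
  | node d sub rest ih1 ih2 =>
    simp only [contour, List.pairwise_cons, List.pairwise_append, List.mem_append,
      List.mem_cons] at h
    obtain ⟨h0, h1, ⟨h4, h2⟩, h3⟩ := h
    simp only [treeDarts, List.mem_cons, List.mem_append] at hx hy
    rintro ⟨ha, hb, hc⟩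
    rcases hx with rfl | hx | hx <;> rcases hy with rfl | hy | hy
    · omega
    · have := h3 _ (hmem hy).2 _ (Or.inl rfl)
      omega
    · have := h4 _ (hmem hy).1
      omega
    · have := h0 _ (Or.inl (hmem hx).1)
      omega
    · exact ih1 h1 hx hy ⟨ha, hb, hc⟩
    · have := h3 _ (hmem hx).2 _ (Or.inr (hmem hy).1)
      omega
    · have := h0 _ (Or.inr (Or.inr (hmem hx).1))
      omega
    · have := h3 _ (hmem hy).1 _ (Or.inr (hmem hx).1)
      omega
    · exact ih2 h2 hx hy ⟨ha, hb, hc⟩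

theorem pos_treeDart_lt {F : Forest (E × Bool)}
    (h : F.contour.Pairwise (fun x y => pos x < pos y)) {x : E × Bool}
    (hx : x ∈ F.treeDarts) : pos x < pos (flip x) := by
  induction F with
  | nil => simp [treeDarts] at hx
  | leaf d j rest ih => exact ih (List.pairwise_cons.1 h).2 hx
  | back d rest ih => exact ih (List.pairwise_cons.1 h).2 hx
  | node d sub rest ih1 ih2 =>
    simp only [contour, List.pairwise_cons, List.pairwise_append, List.mem_append,
      List.mem_cons] at h
    obtain ⟨h0, h1, ⟨h4, h2⟩, h3⟩ := h
    simp only [treeDarts, List.mem_cons, List.mem_append] at hx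
    rcases hx with rfl | hx | hx
    · exact h0 _ (Or.inr (Or.inl rfl))
    · exact ih1 h1 hx
    · exact ih2 h2 hx

/-! ### The depth-first property -/

theorem IsDFS.flip_initialBack_mem {k : ℤ} {pre : List ((E × Bool) × ℤ)} {F : Forest (E × Bool)}
    (h : F.IsDFS k pre) {x : E × Bool} (hx : x ∈ F.initialBacks) : (flip x, k) ∈ pre := by
  induction F generalizing pre with
  | nil => simp [initialBacks] at hx
  | leaf => simp [initialBacks] at hx
  | node => simp [initialBacks] at hx
  | back d rest ih =>
    simp only [initialBacks, List.mem_cons] at hx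
    rcases hx with rfl | hx
    · exact h.1
    · exact ih h.2 hx

theorem IsDFS.initialBacks_eq_nil {k : ℤ} {F : Forest (E × Bool)} (h : F.IsDFS k []) :
    F.initialBacks = [] := by
  rw [List.eq_nil_iff_forall_not_mem]
  intro x hx
  simpa using h.flip_initialBack_mem hx

theorem IsDFS.flip_back_mem {k : ℤ} {pre : List ((E × Bool) × ℤ)} {F : Forest (E × Bool)}
    (h : F.IsDFS k pre) {x : E × Bool} (hx : x ∈ F.backs) : (flip x, k) ∈ pre ++ F.leaves := by
  induction F generalizing pre with
  | nil => simp [backs] at hx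
  | leaf d j rest ih =>
    have := ih h.2.2 hx
    simp only [List.mem_append, leaves] at this ⊢
    tauto
  | node d sub rest _ ih =>
    have := ih h.2.2 hx
    simp only [List.mem_append, leaves] at this ⊢
    tauto
  | back d rest ih =>
    simp only [backs, List.mem_cons] at hx
    rcases hx with rfl | hx
    · exact List.mem_append_left _ h.1
    · exact ih h.2 hx

/-- A leaf whose label is the depth of the vertex closes at this vertex. -/
theorem IsDFS.flip_leaf_mem_backs {k : ℤ} {pre : List ((E × Bool) × ℤ)} {F : Forest (E × Bool)}
    (h : F.IsDFS k pre) {x : E × Bool} (hx : (x, k) ∈ F.leaves) : flip x ∈ F.backs := by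
  induction F generalizing pre with
  | nil => simp [leaves] at hx
  | leaf d j rest ih =>
    simp only [leaves, List.mem_append, List.mem_singleton, Prod.mk.injEq] at hx
    rcases hx with hx | ⟨rfl, hx⟩
    · exact ih h.2.2 hx
    · exact h.2.1 hx.symm
  | node d sub rest _ ih =>
    simp only [leaves, List.mem_append] at hx
    rcases hx with hx | hx
    · exact ih h.2.2 hx
    · exact h.2.1 _ hx
  | back d rest ih => exact List.mem_cons_of_mem _ (ih h.2 hx)

/-- The edge of a leaf whose label is at least the depth of the vertex closes inside the forest. -/
theorem IsDFS.flip_leaf_mem {k : ℤ} {pre : List ((E × Bool) × ℤ)} {F : Forest (E × Bool)}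
    (h : F.IsDFS k pre) {l : (E × Bool) × ℤ} (hl : l ∈ F.leaves) (hk : k ≤ l.2) :
    flip l.1 ∈ F.contour := by
  induction F generalizing pre k with
  | nil => simp [leaves] at hl
  | leaf d j rest ih =>
    simp only [leaves, List.mem_append, List.mem_singleton] at hl
    rcases hl with hl | rfl
    · exact List.mem_cons_of_mem _ (ih h.2.2 hl hk)
    · exact List.mem_cons_of_mem _ (backs_subset_contour (h.2.1 (le_antisymm h.1 hk)))
  | back d rest ih => exact List.mem_cons_of_mem _ (ih h.2 hl hk)
  | node d sub rest ih1 ih2 =>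
    simp only [leaves, List.mem_append, contour, List.mem_cons] at hl ⊢
    rcases hl with hl | hl
    · exact Or.inr (Or.inr (Or.inr (ih2 h.2.2 hl hk)))
    · rcases hk.lt_or_eq with hk | hk
      · exact Or.inr (Or.inl (ih1 h.1 hl hk))
      · exact Or.inr (Or.inr (Or.inr (backs_subset_contour (h.2.1 l.1 (by rw [hk]; exact hl)))))

theorem IsDFS.flip_allBacks_mem {k : ℤ} {pre : List ((E × Bool) × ℤ)} {F : Forest (E × Bool)}
    (h : F.IsDFS k pre) (hp : F.contour.Pairwise (fun x y => pos x < pos y))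
    (hpre : ∀ l ∈ pre, ∀ y ∈ F.contour, pos l.1 < pos y) {x : E × Bool} (hx : x ∈ F.allBacks) :
    (∃ j, k ≤ j ∧ (flip x, j) ∈ pre ++ F.leaves) ∧ pos (flip x) < pos x := by
  induction F generalizing pre k with
  | nil => simp [allBacks] at hx
  | leaf d j rest ih =>
    simp only [contour, List.pairwise_cons] at hp
    obtain ⟨⟨i, hi, h1⟩, h2⟩ := ih h.2.2 hp.2 (by
      simp only [List.mem_append, List.mem_singleton]
      rintro l (hl | rfl) y hy
      · exact hpre l hl y (List.mem_cons_of_mem _ hy)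
      · exact hp.1 _ hy) hx
    refine ⟨⟨i, hi, ?_⟩, h2⟩
    simp only [List.mem_append, leaves] at h1 ⊢
    tauto
  | back d rest ih =>
    simp only [contour, List.pairwise_cons] at hp
    simp only [allBacks, List.mem_cons] at hx
    rcases hx with rfl | hx
    · exact ⟨⟨k, le_rfl, List.mem_append_left _ h.1⟩, hpre _ h.1 _ List.mem_cons_self⟩
    · exact ih h.2 hp.2 (fun l hl y hy => hpre l hl y (List.mem_cons_of_mem _ hy)) hx
  | node d sub rest ih1 ih2 =>
    simp only [contour, List.pairwise_cons, List.pairwise_append, List.mem_append,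
      List.mem_cons] at hp hpre
    obtain ⟨h0, h1, ⟨h4, h2⟩, h3⟩ := hp
    simp only [allBacks, List.mem_append] at hx
    rcases hx with hx | hx
    · obtain ⟨⟨i, hi, h5⟩, h6⟩ := ih1 h.1 h1 (by simp) hx
      refine ⟨⟨i, by omega, ?_⟩, h6⟩
      simp only [List.nil_append, List.mem_append, leaves] at h5 ⊢
      tauto
    · obtain ⟨⟨i, hi, h5⟩, h6⟩ := ih2 h.2.2 h2 (by
        simp only [List.mem_append]
        rintro l (hl | hl) y hy
        · exact hpre l hl y (by tauto)
        · exact h3 _ (leaves_subset_contour hl) _ (Or.inr hy)) hx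
      refine ⟨⟨i, hi, ?_⟩, h6⟩
      simp only [List.mem_append, leaves] at h5 ⊢
      tauto

end Forest

namespace Forest

open RootedMap (flip)

variable {E : Type} {pos : E × Bool → ℕ}

/-! ### Noncrossing edges and the places of the second ends -/

/-- Two distinct members of a pairwise related list are related in one of the two orders. -/
theorem pairwise_mem {α : Type*} {r : α → α → Prop} {l : List α} (h : l.Pairwise r) {x y : α}
    (hx : x ∈ l) (hy : y ∈ l) (hxy : x ≠ y) : r x y ∨ r y x := by
  induction h with
  | nil => simp at hx
  | cons h _ ih =>
    rw [List.mem_cons] at hx hy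
    rcases hx with rfl | hx <;> rcases hy with rfl | hy
    · exact absurd rfl hxy
    · exact Or.inl (h _ hy)
    · exact Or.inr (h _ hx)
    · exact ih hx hy

/-- Second ends are determined by the noncrossing condition: they appear in the order opposite to
that of the first ends, which is the traversal order. -/
theorem eq_closings {k : ℤ} {sub : Forest (E × Bool)} {B : List (E × Bool)}
    (hsub : sub.contour.Pairwise (fun x y => pos x < pos y))
    (hB : B.Pairwise (fun x y => pos x < pos y))
    (hlt : ∀ x ∈ sub.contour, ∀ y ∈ B, pos x < pos y)
    (hmem : ∀ x, x ∈ B ↔ (flip x, k) ∈ sub.leaves)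
    (hnc : ∀ a ∈ sub.leaves, ∀ b ∈ sub.leaves, ¬ (pos a.1 < pos b.1 ∧ pos b.1 < pos (flip a.1) ∧
      pos (flip a.1) < pos (flip b.1))) :
    B = sub.closings k := by
  have : Std.Irrefl (fun x y : E × Bool => pos x < pos y) := ⟨fun x => lt_irrefl _⟩
  have : Std.Antisymm (fun x y : E × Bool => pos x < pos y) := ⟨fun x y h1 h2 => by omega⟩
  refine List.Pairwise.eq_of_mem_iff hB ?_ fun x => by rw [hmem, mem_closings]
  rw [closings, List.pairwise_map]
  refine List.Pairwise.imp_of_mem ?_ ((pairwise_leaves hsub).filter _)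
  intro a b ha hb hab
  simp only [List.mem_filter, decide_eq_true_eq] at ha hb
  have hfa : flip a.1 ∈ B := by rw [hmem, RootedMap.flip_flip, ← ha.2]; exact ha.1
  have hfb : flip b.1 ∈ B := by rw [hmem, RootedMap.flip_flip, ← hb.2]; exact hb.1
  have h1 := hlt _ (leaves_subset_contour ha.1) _ hfb
  have h2 := hnc b hb.1 a ha.1
  rcases Nat.lt_trichotomy (pos (flip a.1)) (pos (flip b.1)) with h3 | h3 | h3
  · exact h3
  · exfalso
    have h4 : flip a.1 = flip b.1 := by
      by_contra hne
      have := pairwise_mem hB hfa hfb hne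
      omega
    have h5 := flip.injective h4
    rw [h5] at hab
    omega
  · exact absurd ⟨hab, h1, h3⟩ h2

/-- A second end beyond the initial run is separated from the beginning by a leaf that escapes. -/
theorem HasEscapes.exists_leaf_lt {k : ℤ} {F : Forest (E × Bool)} (h : F.HasEscapes k)
    (hp : F.contour.Pairwise (fun x y => pos x < pos y)) {x : E × Bool} (hx : x ∈ F.backs)
    (hx' : x ∉ F.initialBacks) : ∃ l ∈ F.leaves, l.2 ≤ k - 1 ∧ pos l.1 < pos x := by
  induction F with
  | nil => simp [backs] at hx
  | leaf d j rest ih =>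
    exact ⟨(d, j), by simp [leaves], h.1, (List.pairwise_cons.1 hp).1 _ (backs_subset_contour hx)⟩
  | back d rest ih =>
    simp only [backs, initialBacks, List.mem_cons, not_or] at hx hx'
    exact ih h (List.pairwise_cons.1 hp).2 (hx.resolve_left hx'.1) hx'.2
  | node d sub rest _ ih =>
    obtain ⟨l, hl, hlk⟩ := h.1
    simp only [contour, List.pairwise_cons, List.pairwise_append] at hp
    exact ⟨l, by simp [leaves, hl], hlk, hp.2.2.2 _ (leaves_subset_contour hl) _
      (List.mem_cons_of_mem _ (backs_subset_contour hx))⟩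

/-- In a noncrossing exploration where every child has an edge to a proper ancestor, the second ends
are where the reconnection puts them, and the tree is decorated. -/
theorem IsDFS.isTight_and_isDecorated {k : ℤ} {pre : List ((E × Bool) × ℤ)}
    {F : Forest (E × Bool)} (h : F.IsDFS k pre) (hesc : F.HasEscapes k)
    (hp : F.contour.Pairwise (fun x y => pos x < pos y))
    (hpre : ∀ l ∈ pre, ∀ y ∈ F.contour, pos l.1 < pos y)
    (hout : ∀ l ∈ F.leaves, l.2 < k → ∀ y ∈ F.contour, pos y < pos (flip l.1))
    (hnc : ∀ a ∈ pre ++ F.leaves, ∀ b ∈ pre ++ F.leaves, ¬ (pos a.1 < pos b.1 ∧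
      pos b.1 < pos (flip a.1) ∧ pos (flip a.1) < pos (flip b.1)))
    (hneg : ∀ l ∈ F.leaves, -1 ≤ l.2) : F.IsTight k ∧ F.IsDecorated k := by
  induction F generalizing pre k with
  | nil => exact ⟨trivial, trivial⟩
  | leaf d j rest ih =>
    simp only [contour, List.pairwise_cons] at hp
    simp only [leaves, List.mem_append, contour, List.mem_cons, List.not_mem_nil, or_false]
      at hpre hout hneg hnc
    obtain ⟨h1, h2⟩ := ih (pre := pre ++ [(d, j)]) h.2.2 hesc.2 hp.2
      (by
        simp only [List.mem_append, List.mem_singleton]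
        rintro l (hl | rfl) y hy
        · exact hpre l hl y (Or.inr hy)
        · exact hp.1 y hy)
      (fun l hl hlk y hy => hout l (Or.inl hl) hlk y (Or.inr hy))
      (by
        simp only [List.mem_append, List.mem_singleton]
        intro a ha b hb
        exact hnc a (by tauto) b (by tauto))
      (fun l hl => hneg l (Or.inl hl))
    have hj : j < k := by have := hesc.1; omega
    refine ⟨⟨?_, h1⟩, ⟨hneg _ (Or.inr rfl), hj, h2⟩⟩
    rw [List.eq_nil_iff_forall_not_mem]
    intro x hx
    have hx' := h.2.2.flip_initialBack_mem hx
    have hxc := backs_subset_contour (initialBacks_subset hx)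
    simp only [List.mem_append, List.mem_singleton, Prod.mk.injEq] at hx'
    rcases hx' with hx' | ⟨-, hx'⟩
    -- A second end right after the leaf `d` would belong to an edge crossing that of `d`.
    · refine hnc _ (Or.inl hx') _ (Or.inr (Or.inr rfl)) ⟨hpre _ hx' _ (Or.inl rfl), ?_⟩
      simp only [RootedMap.flip_flip]
      exact ⟨hp.1 _ hxc, hout _ (Or.inr rfl) hj _ (Or.inr hxc)⟩
    · omega
  | back d rest ih =>
    simp only [contour, List.pairwise_cons, List.mem_cons] at hp hout hpre
    exact ih h.2 hesc hp.2 (fun l hl y hy => hpre l hl y (Or.inr hy))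
      (fun l hl hlk y hy => hout l hl hlk y (Or.inr hy)) hnc hneg
  | node d sub rest ih1 ih2 =>
    simp only [contour, List.pairwise_cons, List.pairwise_append, List.mem_append,
      List.mem_cons] at hp
    obtain ⟨h0, hp1, ⟨h4, hp2⟩, h3⟩ := hp
    simp only [leaves, List.mem_append, contour, List.mem_cons] at hpre hout hneg hnc
    obtain ⟨⟨l', hl', hlk'⟩, hesc1, hesc2⟩ := hesc
    obtain ⟨hd1, hd2, hd3⟩ := h
    obtain ⟨t1, t2⟩ := ih1 hd1 hesc1 hp1 (by simp)
      (by
        intro l hl hlk y hy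
        rcases (Int.lt_add_one_iff.1 hlk).lt_or_eq with hlk | hlk
        · exact hout l (Or.inr hl) hlk y (Or.inr (Or.inl hy))
        · exact h3 _ hy _ (Or.inr (backs_subset_contour (hd2 l.1 (by rw [← hlk]; exact hl)))))
      (by
        intro a ha b hb
        simp only [List.nil_append] at ha hb
        exact hnc a (by tauto) b (by tauto))
      (fun l hl => hneg l (Or.inr hl))
    obtain ⟨t3, t4⟩ := ih2 (pre := pre ++ sub.leaves) hd3 hesc2 hp2
      (by
        simp only [List.mem_append]
        rintro l (hl | hl) y hy
        · exact hpre l hl y (by tauto)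
        · exact h3 _ (leaves_subset_contour hl) y (Or.inr hy))
      (fun l hl hlk y hy => hout l (Or.inl hl) hlk y (by tauto))
      (by
        simp only [List.mem_append]
        intro a ha b hb
        exact hnc a (by tauto) b (by tauto))
      (fun l hl => hneg l (Or.inl hl))
    refine ⟨⟨hd1.initialBacks_eq_nil, ?_, t1, t3⟩, ⟨fun _ => ⟨l', hl', hlk'⟩, ?_,
      exists_leaf_toTrees_ne_nil hl', t2, t4⟩⟩
    · refine eq_closings hp1 (pairwise_initialBacks hp2) (fun x hx y hy =>
        h3 x hx y (Or.inr (backs_subset_contour (initialBacks_subset hy)))) (fun x => ⟨fun hx => ?_,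
          fun hx => ?_⟩) (fun a ha b hb => hnc a (by tauto) b (by tauto))
      · have hx' := hd3.flip_initialBack_mem hx
        have hxc := backs_subset_contour (initialBacks_subset hx)
        rw [List.mem_append] at hx'
        refine hx'.resolve_left fun hx' => ?_
        -- Otherwise the edge of `x` crosses the escaping edge of the leaf `l'` of `sub`.
        refine hnc _ (Or.inl hx') _ (Or.inr (Or.inr hl')) ⟨hpre _ hx' _
          (Or.inr (Or.inl (leaves_subset_contour hl'))), ?_⟩
        simp only [RootedMap.flip_flip]
        exact ⟨h3 _ (leaves_subset_contour hl') _ (Or.inr hxc),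
          hout _ (Or.inr hl') (by omega) _ (by tauto)⟩
      · by_contra hx'
        have hxb : x ∈ rest.backs := by simpa using hd2 _ hx
        -- Otherwise an escaping edge starts between the leaf and its second end, and crosses it.
        obtain ⟨l, hl, hlk, hlx⟩ := hesc2.exists_leaf_lt hp2 hxb hx'
        refine hnc _ (Or.inr (Or.inr hx)) _ (Or.inr (Or.inl hl)) ⟨h3 _
          (leaves_subset_contour hx) _ (Or.inr (leaves_subset_contour hl)), ?_⟩
        simp only [RootedMap.flip_flip]
        exact ⟨hlx, hout _ (Or.inl hl) (by omega) _ (by have := backs_subset_contour hxb; tauto)⟩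
    · refine List.Pairwise.imp_of_mem ?_ (pairwise_leaves hp1)
      intro a b ha hb hab hbk
      by_contra hak
      -- The edge of `a`, which escapes, starts between the two ends of the edge of `b`.
      have hbb := backs_subset_contour (hd2 b.1 (by rw [← hbk]; exact hb))
      exact hnc b (Or.inr (Or.inr hb)) a (Or.inr (Or.inr ha)) ⟨hab,
        h3 _ (leaves_subset_contour ha) _ (Or.inr hbb),
        hout a (Or.inr ha) (by omega) _ (by tauto)⟩

/-- Reconnection at the prescribed places gives the trace of a depth-first exploration: the second
ends are read after the leaves they belong to, at the vertices given by the labels. -/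
theorem IsTight.isDFS {k : ℤ} {pre : List ((E × Bool) × ℤ)} {F : Forest (E × Bool)}
    (h : F.IsTight k) (hdec : F.IsDecorated k)
    (hpre : ∀ x ∈ F.initialBacks, (flip x, k) ∈ pre) : F.IsDFS k pre := by
  induction F generalizing pre k with
  | nil => trivial
  | leaf d j rest ih =>
    exact ⟨hdec.2.1.le, fun e => absurd e hdec.2.1.ne, ih h.2 hdec.2.2 (by simp [h.1])⟩
  | back d rest ih =>
    simp only [initialBacks, List.mem_cons] at hpre
    exact ⟨hpre _ (Or.inl rfl), ih h hdec fun x hx => hpre x (Or.inr hx)⟩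
  | node d sub rest ih1 ih2 =>
    obtain ⟨h1, h2, h3, h4⟩ := h
    refine ⟨ih1 h3 hdec.2.2.2.1 (by simp [h1]), fun l hl => initialBacks_subset ?_,
      ih2 h4 hdec.2.2.2.2 fun x hx => ?_⟩
    · rw [h2, mem_closings]
      simpa using hl
    · rw [h2, mem_closings] at hx
      exact List.mem_append_right _ hx

/-- Edges reconnected at the prescribed places do not cross. -/
theorem IsTight.noncrossing_leaves {k : ℤ} {pre : List ((E × Bool) × ℤ)} {F : Forest (E × Bool)}
    (h : F.IsTight k) (hdec : F.IsDecorated k) (hdfs : F.IsDFS k pre)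
    (hp : F.contour.Pairwise (fun x y => pos x < pos y))
    {a b : (E × Bool) × ℤ} (ha : a ∈ F.leaves) (hb : b ∈ F.leaves) (hak : k ≤ a.2)
    (hab : pos a.1 < pos b.1) (hba : pos b.1 < pos (flip a.1)) :
    pos (flip b.1) < pos (flip a.1) := by
  induction F generalizing pre k with
  | nil => simp [leaves] at ha
  | leaf d j rest ih =>
    simp only [contour, List.pairwise_cons] at hp
    simp only [leaves, List.mem_append, List.mem_singleton] at ha hb
    rcases ha with ha | rfl
    · rcases hb with hb | rfl
      · exact ih h.2 hdec.2.2 hdfs.2.2 hp.2 ha hb hak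
      · exact absurd hab (hp.1 _ (leaves_subset_contour ha)).not_gt
    · exact absurd hak (by have := hdec.2.1; omega)
  | back d rest ih => exact ih h hdec hdfs.2 (List.pairwise_cons.1 hp).2 ha hb hak
  | node d sub rest ih1 ih2 =>
    simp only [contour, List.pairwise_cons, List.pairwise_append, List.mem_append,
      List.mem_cons] at hp
    obtain ⟨h0, hp1, ⟨h4, hp2⟩, h3⟩ := hp
    simp only [leaves, List.mem_append] at ha hb
    obtain ⟨-, hr, ht1, ht2⟩ := h
    obtain ⟨-, hc, -, hdec1, hdec2⟩ := hdec
    have hin : ∀ c ∈ sub.leaves, c.2 = k → flip c.1 ∈ rest.initialBacks := by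
      intro c hc hck
      rw [hr, mem_closings, RootedMap.flip_flip, ← hck]
      exact hc
    -- An edge of `sub` closes inside `sub` if its label exceeds `k`, and right after `sub` if its
    -- label is `k`.
    rcases ha with ha | ha
    · rcases hb with hb | hb
      · exact ih2 ht2 hdec2 hdfs.2.2 hp2 ha hb hak
      · have := h3 _ (leaves_subset_contour hb) _ (Or.inr (leaves_subset_contour ha))
        omega
    · rcases hb with hb | hb
      · rcases hak.lt_or_eq with hak | hak
        · have := hdfs.1.flip_leaf_mem ha hak
          have := h3 _ this _ (Or.inr (leaves_subset_contour hb))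
          omega
        · have := pos_initialBacks_lt_leaf hp2 (hin a ha hak.symm) hb
          omega
      · rcases hak.lt_or_eq with hak | hak
        · exact ih1 ht1 hdec1 hdfs.1 hp1 ha hb hak
        · have hfa := hin a ha hak.symm
          have hfa' := backs_subset_contour (initialBacks_subset hfa)
          have hne : b ≠ a := by rintro rfl; omega
          -- As `b` precedes `a` in traversal order, its label is at least `k`.
          have hkb : k ≤ b.2 := by
            rcases pairwise_mem ((pairwise_leaves hp1).and hc) hb ha hne with h5 | h5
            · exact h5.2 hak.symm
            · omega
          rcases hkb.lt_or_eq with hkb | hkb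
          · exact h3 _ (hdfs.1.flip_leaf_mem hb hkb) _ (Or.inr hfa')
          · have hs := pairwise_initialBacks hp2
            rw [hr, closings, List.pairwise_map] at hs
            rcases pairwise_mem (((pairwise_leaves hp1).filter _).and hs)
              (List.mem_filter.2 ⟨hb, by simpa using hkb.symm⟩)
              (List.mem_filter.2 ⟨ha, by simpa using hak.symm⟩) hne with h5 | h5
            · exact h5.2
            · omega

end Forest

/-! ### Cyclic lists -/

/-- The elements of `a :: l` form a cycle of `σ`, in this order. -/
def Equiv.Perm.IsCycList {α : Type*} (σ : Equiv.Perm α) (a : α) (l : List α) : Prop :=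
  List.IsChain (fun x y => σ x = y) (a :: (l ++ [a]))

namespace Equiv.Perm.IsCycList

variable {α : Type*} {σ : Equiv.Perm α} {a : α} {l : List α}

theorem apply_mem_of_isChain {b c : α} {m : List α}
    (h : List.IsChain (fun x y => σ x = y) (b :: (m ++ [c]))) :
    ∀ x ∈ b :: m, σ x ∈ m ++ [c] := by
  induction m generalizing b with
  | nil =>
    intro x hx
    simp only [List.mem_singleton, List.nil_append] at hx ⊢
    rw [hx]
    exact (List.isChain_cons_cons.1 h).1
  | cons d m ih =>
    intro x hx
    rw [List.cons_append, List.isChain_cons_cons] at h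
    rcases List.mem_cons.1 hx with rfl | hx
    · rw [h.1]; simp
    · exact List.mem_cons_of_mem _ (ih h.2 x hx)

theorem apply_mem (h : σ.IsCycList a l) {x : α} (hx : x ∈ a :: l) : σ x ∈ a :: l := by
  have := apply_mem_of_isChain h x hx
  simp only [List.mem_append, List.mem_cons] at this ⊢
  tauto

theorem sameCycle_of_isChain {b : α} {m : List α}
    (h : List.IsChain (fun x y => σ x = y) (b :: m)) : ∀ x ∈ b :: m, σ.SameCycle b x := by
  induction m generalizing b with
  | nil =>
    intro x hx
    rw [List.mem_singleton.1 hx]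
  | cons d m ih =>
    intro x hx
    rw [List.isChain_cons_cons] at h
    rcases List.mem_cons.1 hx with rfl | hx
    · exact SameCycle.refl _ _
    · exact SameCycle.trans ⟨1, by simpa using h.1⟩ (ih h.2 x hx)

theorem sameCycle_iff [Finite α] (h : σ.IsCycList a l) {x : α} :
    σ.SameCycle a x ↔ x ∈ a :: l := by
  refine ⟨fun hx => ?_, fun hx => sameCycle_of_isChain h x ?_⟩
  · exact SameCycle.mem_of_invariant (s := {x | x ∈ a :: l}) (fun z hz => h.apply_mem hz) hx
      List.mem_cons_self
  · rw [← List.cons_append]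
    exact List.mem_append_left _ hx

theorem iterate_getElem_of_isChain {b : α} {m : List α}
    (h : List.IsChain (fun x y => σ x = y) (b :: m)) (i : ℕ) (hi : i < (b :: m).length) :
    (b :: m)[i] = σ^[i] b := by
  induction i with
  | zero => rfl
  | succ i ih =>
    rw [Function.iterate_succ_apply', ← ih (by omega)]
    exact (List.isChain_iff_getElem.1 h i hi).symm

end Equiv.Perm.IsCycList

namespace RootedMap

open Equiv.Perm

theorem origin_eq_iff_sameCycle {M : RootedMap} {x y : M.Dart} :
    M.origin x = M.origin y ↔ M.cw.SameCycle x y := by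
  rw [origin, origin, Quotient.eq]
  rfl

/-- The list `around` is a cycle of the rotation without repetition. -/
theorem around_isCycList (M : RootedMap) (d : M.Dart) :
    M.around d = d :: (M.around d).tail ∧ M.cw.IsCycList d (M.around d).tail ∧
      (M.around d).Nodup := by
  have hper : 0 < Function.minimalPeriod M.cw d :=
    Function.minimalPeriod_pos_of_mem_periodicPts
      (M.cw.injective.mem_periodicPts d)
  obtain ⟨n, hn⟩ := Nat.exists_eq_add_of_lt hper
  rw [zero_add] at hn
  have h1 : M.around d = d :: (M.around d).tail := by
    simp [around, hn, List.range_succ_eq_map]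
  refine ⟨h1, ?_, ?_⟩
  · rw [IsCycList, ← List.cons_append, ← h1, List.isChain_iff_getElem]
    intro i hi
    have hlen : (M.around d).length = Function.minimalPeriod M.cw d := by simp [around]
    simp only [List.length_append, List.length_singleton, hlen] at hi
    rw [List.getElem_append_left (by omega)]
    rcases (show i + 1 < Function.minimalPeriod M.cw d ∨ i + 1 = Function.minimalPeriod M.cw d by
      omega) with h | h
    · rw [List.getElem_append_left (by omega)]
      simp [around, ← Function.iterate_succ_apply']
    · rw [List.getElem_append_right (by omega)]
      simp only [around, List.getElem_map, List.getElem_range, List.getElem_singleton]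
      rw [← Function.iterate_succ_apply' (f := M.cw), Nat.succ_eq_add_one, h]
      exact Function.iterate_minimalPeriod
  · rw [around, List.nodup_map_iff_inj_on List.nodup_range]
    intro i hi j hj hij
    exact Function.iterate_injOn_Iio_minimalPeriod (List.mem_range.1 hi) (List.mem_range.1 hj) hij

theorem around_eq {M : RootedMap} {d : M.Dart} {l : List M.Dart} (h : M.cw.IsCycList d l)
    (hn : (d :: l).Nodup) : M.around d = d :: l := by
  have hper : Function.minimalPeriod M.cw d = (d :: l).length := by
    have hit := IsCycList.iterate_getElem_of_isChain h
    have h1 : M.cw^[l.length + 1] d = d := by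
      rw [← hit (l.length + 1) (by simp)]
      simp
    refine le_antisymm (Function.IsPeriodicPt.minimalPeriod_le (by simp) h1) ?_
    by_contra hlt
    push Not at hlt
    have hper : 0 < Function.minimalPeriod M.cw d :=
      Function.minimalPeriod_pos_of_mem_periodicPts (M.cw.injective.mem_periodicPts d)
    have h2 := hit (Function.minimalPeriod M.cw d) (by simp at hlt ⊢; omega)
    rw [Function.iterate_minimalPeriod] at h2
    have h3 : (d :: l)[Function.minimalPeriod M.cw d] = (d :: l)[0] := by
      simp only [List.getElem_cons_zero]
      conv_rhs => rw [← h2]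
      simp only [← List.cons_append]
      rw [List.getElem_append_left]
    have := (hn.getElem_inj_iff).1 h3
    omega
  refine List.ext_getElem (by simp [around, hper]) fun i h1 h2 => ?_
  have := IsCycList.iterate_getElem_of_isChain h i (by simp at h2 ⊢; omega)
  simp only [around, List.getElem_map, List.getElem_range]
  rw [← this]
  simp only [← List.cons_append]
  rw [List.getElem_append_left h2]

end RootedMap

namespace Forest

open RootedMap (flip flipOn flipOn_of_mem flipOn_of_notMem IsContour Noncrossing)
open Equiv.Perm

variable {E : Type}

/-- The forest follows the rotation `σ` at each of its new vertices. -/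
def IsRotation (σ : Equiv.Perm (E × Bool)) : Forest (E × Bool) → Prop
  | nil => True
  | leaf _ _ rest => IsRotation σ rest
  | back _ rest => IsRotation σ rest
  | node d sub rest => σ.IsCycList (flip d) sub.tops ∧ IsRotation σ sub ∧ IsRotation σ rest

/-- The forest is the trace of a depth-first exploration of the whole map `M`, starting with the
root at depth `-1`. -/
structure Represents (M : RootedMap) (F : Forest M.Dart) : Prop where
  nodup : F.contour.Nodup
  mem : ∀ d, d ∈ F.contour
  rootRotation : ∃ l, F.tops = M.root :: l ∧ M.cw.IsCycList M.root l
  rotation : F.IsRotation M.cw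
  dfs : F.IsDFS (-1) []
  neg_one_le : ∀ l ∈ F.leaves, -1 ≤ l.2

/-- Every dart of the contour is a leaf, a second end, or one of the two darts of a tree edge. -/
theorem contour_perm (F : Forest (E × Bool)) :
    F.contour.Perm (F.leaves.map Prod.fst ++ (F.allBacks ++ (F.treeDarts ++
      F.treeDarts.map flip))) := by
  rw [← Multiset.coe_eq_coe]
  induction F with
  | nil => rfl
  | leaf d j rest ih =>
    simp only [contour, leaves, allBacks, treeDarts, List.map_append, List.map_cons, List.map_nil,
      ← Multiset.coe_add, ← Multiset.cons_coe, ih, ← Multiset.singleton_add, Multiset.coe_nil]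
    abel
  | back d rest ih =>
    simp only [contour, leaves, allBacks, treeDarts,
      ← Multiset.coe_add, ← Multiset.cons_coe, ih, ← Multiset.singleton_add]
    abel
  | node d sub rest ih1 ih2 =>
    simp only [contour, leaves, allBacks, treeDarts, List.map_append, List.map_cons,
      ← Multiset.coe_add, ← Multiset.cons_coe, ih1, ih2, ← Multiset.singleton_add]
    abel

/-- The edges along which new vertices are reached. -/
noncomputable def treeEdges (F : Forest (E × Bool)) : Finset E :=
  open Classical in (F.treeDarts.map Prod.fst).toFinset

theorem mem_treeEdges {F : Forest (E × Bool)} {x : E × Bool} :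
    x.1 ∈ F.treeEdges ↔ x ∈ F.treeDarts ∨ flip x ∈ F.treeDarts := by
  simp only [treeEdges, List.mem_toFinset, List.mem_map]
  constructor
  · rintro ⟨y, hy, hyx⟩
    rcases RootedMap.eq_or_eq_flip hyx with rfl | rfl
    · exact Or.inl hy
    · exact Or.inr hy
  · rintro (h | h)
    · exact ⟨x, h, rfl⟩
    · exact ⟨flip x, h, rfl⟩

theorem notMem_treeEdges {F : Forest (E × Bool)} (h : F.contour.Nodup) {x : E × Bool}
    (hx : x ∈ F.leaves.map Prod.fst ++ F.allBacks) : x.1 ∉ F.treeEdges := by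
  have h1 := F.contour_perm.nodup_iff.1 h
  rw [← List.append_assoc, List.nodup_append] at h1
  rw [mem_treeEdges]
  rintro (h2 | h2)
  · exact h1.2.2 x hx x (List.mem_append_left _ h2) rfl
  · exact h1.2.2 x hx x (List.mem_append_right _ (List.mem_map.2 ⟨_, h2, by simp⟩)) rfl

theorem head?_contour_append (F : Forest (E × Bool)) (b : List (E × Bool)) :
    (F.contour ++ b).head? = (F.tops ++ b).head? := by
  cases F <;> simp [contour, tops]

/-- After tree edges have been contracted in the rotation, the next dart is the next one along the
contour. -/
theorem isChain_contour {σ : Equiv.Perm (E × Bool)} {S : Finset E} {F : Forest (E × Bool)}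
    {b : E × Bool} (hrot : F.IsRotation σ)
    (htop : List.IsChain (fun x y => σ x = y) (F.tops ++ [b]))
    (h1 : ∀ x ∈ F.treeDarts, x.1 ∈ S)
    (h2 : ∀ x ∈ F.leaves.map Prod.fst ++ F.allBacks, x.1 ∉ S) :
    List.IsChain (fun x y => (σ * flipOn S) x = y) (F.contour ++ [b]) := by
  induction F generalizing b with
  | nil => simp [contour]
  | leaf d j rest ih =>
    simp only [tops, contour, List.cons_append, List.isChain_cons] at htop ⊢
    rw [head?_contour_append, mul_apply, flipOn_of_notMem (h2 d (by simp [leaves]))]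
    refine ⟨htop.1, ih hrot htop.2 h1 fun x hx => h2 x ?_⟩
    simp only [leaves, List.map_append, List.mem_append, allBacks] at hx ⊢
    tauto
  | back d rest ih =>
    simp only [tops, contour, List.cons_append, List.isChain_cons] at htop ⊢
    rw [head?_contour_append, mul_apply, flipOn_of_notMem (h2 d (by simp [allBacks]))]
    refine ⟨htop.1, ih hrot htop.2 h1 fun x hx => h2 x ?_⟩
    simp only [leaves, allBacks, List.mem_append, List.mem_cons] at hx ⊢
    tauto
  | node d sub rest ih1 ih2 =>
    obtain ⟨hc, hr1, hr2⟩ := hrot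
    rw [IsCycList, List.isChain_cons] at hc
    simp only [treeDarts, List.mem_cons, List.mem_append, leaves, List.map_append,
      allBacks] at h1 h2
    have h3 := ih1 (b := flip d) hr1 hc.2 (fun x hx => h1 x (by tauto))
      (fun x hx => h2 x (by rw [List.mem_append] at hx; tauto))
    simp only [tops, List.cons_append, List.isChain_cons] at htop
    have h4 := ih2 (b := b) hr2 htop.2 (fun x hx => h1 x (by tauto))
      (fun x hx => h2 x (by rw [List.mem_append] at hx; tauto))
    have hd : d.1 ∈ S := h1 d (Or.inl rfl)
    have e : (node d sub rest).contour ++ [b] =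
        d :: (sub.contour ++ flip d :: (rest.contour ++ [b])) := by simp [contour]
    rw [e, List.isChain_cons]
    constructor
    · have : (sub.contour ++ flip d :: (rest.contour ++ [b])).head? =
          (sub.tops ++ [flip d]).head? := by
        rw [← head?_contour_append]
        cases sub.contour <;> simp
      rw [this, mul_apply, flipOn_of_mem hd]
      exact hc.1
    · rw [List.isChain_split]
      refine ⟨h3, ?_⟩
      rw [List.isChain_cons, head?_contour_append, mul_apply,
        flipOn_of_mem (x := flip d) (by simpa using hd), RootedMap.flip_flip]
      exact ⟨htop.1, h4⟩

open Classical in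
/-- The position of a dart along the contour. -/
noncomputable def pos (F : Forest (E × Bool)) (x : E × Bool) : ℕ := F.contour.idxOf x

theorem pairwise_pos {F : Forest (E × Bool)} (h : F.contour.Nodup) :
    F.contour.Pairwise (fun x y => F.pos x < F.pos y) := by
  classical
  rw [List.pairwise_iff_getElem]
  intro i j hi hj hij
  rw [pos, pos, h.idxOf_getElem, h.idxOf_getElem]
  exact hij

namespace Represents

variable {M : RootedMap} {F : Forest M.Dart}

theorem pairwise (h : Represents M F) : F.contour.Pairwise (fun x y => F.pos x < F.pos y) :=
  pairwise_pos h.nodup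

theorem isContour (h : Represents M F) : IsContour (M.cw * flipOn F.treeEdges) F.pos := by
  classical
  obtain ⟨l, hl, hc⟩ := h.rootRotation
  have h1 := isChain_contour (b := M.root) (S := F.treeEdges) h.rotation
    (by rw [hl, List.cons_append]; exact hc) (fun x hx => mem_treeEdges.2 (Or.inl hx))
    (fun x hx => notMem_treeEdges h.nodup hx)
  refine ⟨fun x y hxy => (List.idxOf_inj (h.mem x)).1 hxy, fun x y hxy => ?_⟩
  have hy := List.idxOf_lt_length_of_mem (h.mem y)
  have h2 := List.isChain_iff_getElem.1 h1 (F.pos x) (by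
    simp only [pos, List.length_append, List.length_singleton] at hxy ⊢; omega)
  have hx1 : F.pos x + 1 < F.contour.length := by
    simp only [pos] at hxy ⊢; omega
  rw [List.getElem_append_left (by omega), List.getElem_append_left hx1] at h2
  have h3 : F.contour[F.pos x] = x := List.getElem_idxOf _
  rw [h3] at h2
  rw [h2]
  exact h.nodup.idxOf_getElem _ _

theorem connected (h : Represents M F) : M.Connected := by
  intro x y
  have hc := h.isContour.sameCycle x y
  refine SameCycle.mem_of_invariant
    (s := {z | ∃ g ∈ Subgroup.closure {M.cw, flip}, g x = z}) ?_ hc ⟨1, one_mem _, rfl⟩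
  rintro z ⟨g, hg, rfl⟩
  have h1 : M.cw ∈ Subgroup.closure {M.cw, flip} := Subgroup.subset_closure (by simp)
  have h2 : flip ∈ Subgroup.closure {M.cw, flip} := Subgroup.subset_closure (by simp)
  by_cases hz : (g x).1 ∈ F.treeEdges
  · exact ⟨M.cw * (RootedMap.flip * g), mul_mem h1 (mul_mem h2 hg), by simp [flipOn_of_mem hz]⟩
  · exact ⟨M.cw * g, mul_mem h1 hg, by simp [flipOn_of_notMem hz]⟩

/-- Euler's formula: the vertices are the faces of the contour cut along the tree edges, and the
faces are those of the contour cut along the other edges. -/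
theorem isPlanar_iff (h : Represents M F) :
    M.IsPlanar ↔ ∀ x y : M.Dart, x.1 ∉ F.treeEdges → y.1 ∉ F.treeEdges →
      ¬ (F.pos x < F.pos y ∧ F.pos y < F.pos (flip x) ∧ F.pos (flip x) < F.pos (flip y)) := by
  classical
  have := Fintype.ofFinite M.E
  have : Nonempty M.E := ⟨M.root.1⟩
  have hφ := h.isContour
  have hV : Nat.card M.Vertex = F.treeEdges.card + 1 := by
    rw [← hφ.numCycles_of_noncrossing (S := F.treeEdges) ?_, mul_assoc, RootedMap.flipOn_mul_self,
      mul_one]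
    · rfl
    · have hlt : ∀ {x : M.Dart}, x.1 ∈ F.treeEdges → F.pos x < F.pos (flip x) →
          x ∈ F.treeDarts := by
        intro x hx hlt
        refine (mem_treeEdges.1 hx).resolve_right fun hx' => ?_
        have := pos_treeDart_lt h.pairwise hx'
        rw [RootedMap.flip_flip] at this
        omega
      rintro x y hx hy ⟨h1, h2, h3⟩
      exact noncrossing_treeDarts h.pairwise (hlt hx (by omega)) (hlt hy (by omega)) ⟨h1, h2, h3⟩
  have hF : Nat.card M.Face = (M.cw * flipOn F.treeEdges * flipOn F.treeEdgesᶜ).numCycles := by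
    rw [← RootedMap.flipOn_mul_flip, ← mul_assoc, mul_assoc M.cw,
      RootedMap.flipOn_mul_self, mul_one]
    rfl
  have hE : Nat.card M.E = F.treeEdges.card + F.treeEdgesᶜ.card := by
    rw [Nat.card_eq_fintype_card, Finset.card_add_card_compl]
  have hnc : (M.cw * flipOn F.treeEdges * flipOn F.treeEdgesᶜ).numCycles = F.treeEdgesᶜ.card + 1 ↔
      Noncrossing F.pos F.treeEdgesᶜ :=
    ⟨hφ.noncrossing_of_numCycles, hφ.numCycles_of_noncrossing⟩
  rw [RootedMap.IsPlanar, and_iff_right h.connected, hV, hF, hE]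
  simp only [Noncrossing, Finset.mem_compl] at hnc
  rw [← hnc]
  omega

end Represents

end Forest

namespace Forest

open RootedMap (flip)
open Equiv.Perm

variable {E : Type}

/-! ### Noncrossing leaves and planarity -/

/-- Only the edges outside the tree can cross; each of them has its first end at a leaf. -/
theorem Represents.isPlanar_iff_leaves {M : RootedMap} {F : Forest M.Dart} (h : Represents M F) :
    M.IsPlanar ↔ ∀ a ∈ F.leaves, ∀ b ∈ F.leaves, ¬ (F.pos a.1 < F.pos b.1 ∧
      F.pos b.1 < F.pos (flip a.1) ∧ F.pos (flip a.1) < F.pos (flip b.1)) := by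
  have hleaf : ∀ a ∈ F.leaves, a.1.1 ∉ F.treeEdges := fun a ha =>
    notMem_treeEdges h.nodup (List.mem_append_left _ (List.mem_map_of_mem ha))
  have hopen : ∀ x : M.Dart, x.1 ∉ F.treeEdges → F.pos x < F.pos (flip x) →
      ∃ j, (x, j) ∈ F.leaves := by
    intro x hx hlt
    rcases mem_contour_iff.1 (h.mem x) with h1 | h1 | h1
    · exact h1
    · have := (h.dfs.flip_allBacks_mem h.pairwise (by simp) h1).2
      omega
    · exact absurd (mem_treeEdges.2 h1) hx
  rw [h.isPlanar_iff]
  constructor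
  · intro H a ha b hb
    exact H a.1 b.1 (hleaf a ha) (hleaf b hb)
  · rintro H x y hx hy ⟨h1, h2, h3⟩
    obtain ⟨i, hi⟩ := hopen x hx (by omega)
    obtain ⟨j, hj⟩ := hopen y hy (by omega)
    exact H _ hi _ hj ⟨h1, h2, h3⟩

/-! ### Forests without new edges -/

theorem leaves_eq_nil_of_toTrees_eq_nil {D : Type} {F : Forest D} (h : F.toTrees = []) :
    F.leaves = [] := by
  by_contra hne
  obtain ⟨l, hl⟩ := List.exists_mem_of_ne_nil _ hne
  exact exists_leaf_toTrees_ne_nil hl h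

theorem initialBacks_of_toTrees_eq_nil {F : Forest (E × Bool)} (h : F.toTrees = []) :
    F.initialBacks = F.backs ∧ F.contour = F.backs := by
  induction F with
  | nil => exact ⟨rfl, rfl⟩
  | leaf => simp [toTrees] at h
  | node => simp [toTrees] at h
  | back d rest ih =>
    obtain ⟨h1, h2⟩ := ih h
    simp only [initialBacks, backs, contour, h1, h2, and_self]

theorem isTight_of_toTrees_eq_nil {F : Forest (E × Bool)} (h : F.toTrees = []) (k : ℤ) :
    F.IsTight k ∧ F.IsDecorated k := by
  induction F with
  | nil => exact ⟨trivial, trivial⟩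
  | leaf => simp [toTrees] at h
  | node => simp [toTrees] at h
  | back d rest ih => exact ih h

/-- Nothing escapes from the root vertex, the only vertex of depth `-1`. -/
theorem HasEscapes.toTrees_eq_nil {F : Forest (E × Bool)} (h : F.HasEscapes (-1))
    (hneg : ∀ l ∈ F.leaves, -1 ≤ l.2) : F.toTrees = [] := by
  induction F with
  | nil => rfl
  | leaf d j rest ih =>
    have h1 := hneg (d, j) (by simp [leaves])
    have h2 := h.1
    simp only at h1
    omega
  | node d sub rest ih1 ih2 =>
    obtain ⟨l, hl, hlk⟩ := h.1
    have := hneg l (by simp [leaves, hl])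
    omega
  | back d rest ih => exact ih h hneg

theorem IsDecorated.hasEscapes {D : Type} {F : Forest D} {k : ℤ} (h : F.IsDecorated k)
    (hk : 0 ≤ k) : F.HasEscapes k := by
  induction F generalizing k with
  | nil => trivial
  | leaf d j rest ih => exact ⟨by have := h.2.1; omega, ih h.2.2 hk⟩
  | back d rest ih => exact ih h hk
  | node d sub rest ih1 ih2 => exact ⟨h.1 hk, ih1 h.2.2.2.1 (by omega), ih2 h.2.2.2.2 hk⟩

/-! ### Vertices of the forest -/

/-- The contour of a forest can be left by the rotation only at the vertex of the forest. -/
theorem IsRotation.apply_mem {σ : Equiv.Perm (E × Bool)} {F : Forest (E × Bool)}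
    (h : F.IsRotation σ) {y : E × Bool} (hy : y ∈ F.contour) : y ∈ F.tops ∨ σ y ∈ F.contour := by
  induction F with
  | nil => simp [contour] at hy
  | leaf d j rest ih =>
    simp only [contour, tops, List.mem_cons] at hy ⊢
    have := ih h
    tauto
  | back d rest ih =>
    simp only [contour, tops, List.mem_cons] at hy ⊢
    have := ih h
    tauto
  | node d sub rest ih1 ih2 =>
    obtain ⟨hc, h1, h2⟩ := h
    simp only [contour, tops, List.mem_cons, List.mem_append] at hy ⊢
    have key : ∀ x, x ∈ flip d :: sub.tops → σ x = flip d ∨ σ x ∈ sub.contour := fun x hx =>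
      (List.mem_cons.1 (hc.apply_mem hx)).imp id tops_subset_contour
    rcases hy with hy | hy | rfl | hy
    · tauto
    · rcases ih1 h1 hy with h3 | h3
      · have := key _ (List.mem_cons_of_mem _ h3)
        tauto
      · tauto
    · have := key _ List.mem_cons_self
      tauto
    · have := ih2 h2 hy
      tauto

theorem flip_treeDart_notMem_tops {F : Forest (E × Bool)} (h : F.contour.Nodup) {d : E × Bool}
    (hd : d ∈ F.treeDarts) : flip d ∉ F.tops := by
  have hmem : ∀ {G : Forest (E × Bool)} {z}, z ∈ G.treeDarts → flip z ∈ G.contour :=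
    fun hz => mem_contour_iff.2 (by simp [hz])
  induction F with
  | nil => simp [treeDarts] at hd
  | leaf d' j rest ih =>
    simp only [contour, List.nodup_cons] at h
    simp only [tops, List.mem_cons, not_or]
    exact ⟨fun e => h.1 (e ▸ hmem hd), ih h.2 hd⟩
  | back d' rest ih =>
    simp only [contour, List.nodup_cons] at h
    simp only [tops, List.mem_cons, not_or]
    exact ⟨fun e => h.1 (e ▸ hmem hd), ih h.2 hd⟩
  | node d' sub rest ih1 ih2 =>
    simp only [contour, List.nodup_cons, List.nodup_append, List.mem_append, List.mem_cons,
      not_or] at h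
    obtain ⟨⟨h1, h2, h3⟩, h4, ⟨h5, h6⟩, h7⟩ := h
    simp only [treeDarts, List.mem_cons, List.mem_append] at hd
    simp only [tops, List.mem_cons, not_or]
    rcases hd with rfl | hd | hd
    · exact ⟨Ne.symm h2, fun h => h5 (tops_subset_contour h)⟩
    · exact ⟨fun e => h1 (e ▸ hmem hd), fun h => h7 _ (hmem hd) _
        (Or.inr (tops_subset_contour h)) rfl⟩
    · exact ⟨fun e => h3 (e ▸ hmem hd), ih2 h6 hd⟩

/-! ### Separating vertices -/

/-- A set `B` of darts, one of which is `d`, that can be left only at the vertex of `d`, separates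
the map if this vertex has an edge outside `B`. -/
theorem separable_of_closed {M : RootedMap} {B : Set M.Dart} {d z : M.Dart} (hd : d ∈ B)
    (hcw : ∀ y ∈ B, y ≠ d → M.cw y ∈ B ∧ M.cw y ≠ d)
    (hflip : ∀ y ∈ B, flip y ∈ B ∨ M.cw.SameCycle d (flip y))
    (hz : M.cw.SameCycle d z) (hzB : z ∉ B) (hzB' : flip z ∉ B) : M.Separable := by
  let A : Set M.E := {e | (e, true) ∈ B ∨ (e, false) ∈ B}
  have hA : ∀ x : M.Dart, x.1 ∈ A ↔ x ∈ B ∨ flip x ∈ B := by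
    rintro ⟨e, b⟩
    cases b
    · exact or_comm
    · rfl
  have hdA : d.1 ∈ A := (hA d).2 (Or.inl hd)
  have hzA : z.1 ∉ A := fun h => ((hA z).1 h).elim hzB hzB'
  refine ⟨A, ⟨_, hdA⟩, ⟨_, hzA⟩, M.origin d, ⟨⟨_, hdA, d.2, rfl⟩, ⟨_, hzA, z.2, ?_⟩⟩, ?_⟩
  · exact RootedMap.origin_eq_iff_sameCycle.2 hz.symm
  · rintro w ⟨⟨e, he, b, hb⟩, ⟨e', he', b', hb'⟩⟩
    rw [← hb] at hb' ⊢
    have hs := RootedMap.origin_eq_iff_sameCycle.1 hb'.symm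
    rw [RootedMap.origin_eq_iff_sameCycle]
    by_cases hx : (e, b) ∈ B
    · by_cases hxd : (e, b) = d
      · rw [hxd]
      · exfalso
        refine he' ((hA (e', b')).2 (Or.inl ?_))
        exact (SameCycle.mem_of_invariant (s := {y | y ∈ B ∧ y ≠ d})
          (fun y hy => hcw y hy.1 hy.2) hs ⟨hx, hxd⟩).1
    · have hx' := ((hA (e, b)).1 he).resolve_left hx
      have := hflip _ hx'
      rw [RootedMap.flip_flip] at this
      exact (this.resolve_left hx).symm

/-- In a non-separable map every subtree has an edge to a proper ancestor of its parent: otherwise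
the parent would be a separating vertex. The dart `z` is another dart at the vertex. -/
theorem IsDFS.hasEscapes {M : RootedMap} (hM : ¬ M.Separable) {F : Forest M.Dart} {k : ℤ}
    {pre : List (M.Dart × ℤ)} (h : F.IsDFS k pre) (hrot : F.IsRotation M.cw)
    (hn : F.contour.Nodup) {z : M.Dart} (hz : ∀ x ∈ F.tops, M.cw.SameCycle z x)
    (hzF : z ∉ F.contour) (hzF' : flip z ∉ F.contour) : F.HasEscapes k := by
  induction F generalizing k pre z with
  | nil => trivial
  | leaf d j rest ih =>
    simp only [contour, List.nodup_cons, List.mem_cons, not_or, tops] at hn hzF hzF' hz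
    refine ⟨?_, ih h.2.2 hrot hn.2 (fun x hx => hz x (Or.inr hx)) hzF.2 hzF'.2⟩
    by_contra hj
    have hjk : j = k := by have := h.1; omega
    refine hM (separable_of_closed (B := {d}) (d := d) (z := z) rfl
      (fun y hy hyd => absurd hy hyd) ?_ (hz d (Or.inl rfl)).symm hzF.1 hzF'.1)
    rintro y rfl
    exact Or.inr ((hz y (Or.inl rfl)).symm.trans (hz _ (Or.inr (backs_subset_tops (h.2.1 hjk)))))
  | back d rest ih =>
    simp only [contour, List.nodup_cons, List.mem_cons, not_or, tops] at hn hzF hzF' hz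
    exact ih h.2 hrot hn.2 (fun x hx => hz x (Or.inr hx)) hzF.2 hzF'.2
  | node d sub rest ih1 ih2 =>
    simp only [contour, List.nodup_cons, List.nodup_append, List.mem_append, List.mem_cons,
      not_or] at hn hzF hzF'
    simp only [tops, List.mem_cons] at hz
    obtain ⟨⟨n1, n2, n3⟩, n4, ⟨n5, n6⟩, n7⟩ := hn
    obtain ⟨hc, hr1, hr2⟩ := hrot
    have hfd : flip d ∉ sub.contour := fun hf => n7 _ hf _ (Or.inl rfl) rfl
    refine ⟨?_, ih1 h.1 hr1 n4 (z := flip d)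
      (fun x hx => hc.sameCycle_iff.2 (List.mem_cons_of_mem _ hx)) hfd
      (by rwa [RootedMap.flip_flip]),
      ih2 h.2.2 hr2 n6 (fun x hx => hz x (Or.inr hx)) hzF.2.2.2 hzF'.2.2.2⟩
    by_contra hall
    push Not at hall
    -- All darts of the edge `d` and of the subtree behind it.
    refine hM (separable_of_closed (B := {x | x = d ∨ x = flip d ∨ x ∈ sub.contour}) (d := d)
      (z := z) (Or.inl rfl) ?_ ?_ (hz d (Or.inl rfl)).symm (by simp only [Set.mem_ofPred_eq]; tauto)
      (by simp only [Set.mem_ofPred_eq]; tauto))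
    · intro y hy hyd
      have h1 : M.cw y = flip d ∨ M.cw y ∈ sub.contour := by
        have key : ∀ x, x ∈ flip d :: sub.tops → M.cw x = flip d ∨ M.cw x ∈ sub.contour :=
          fun x hx => (List.mem_cons.1 (hc.apply_mem hx)).imp id tops_subset_contour
        rcases hy with hy | rfl | hy
        · exact absurd hy hyd
        · exact key _ List.mem_cons_self
        · rcases hr1.apply_mem hy with h1 | h1
          · exact key _ (List.mem_cons_of_mem _ h1)
          · exact Or.inr h1
      refine ⟨Or.inr h1, ?_⟩
      rintro e
      rw [e] at h1
      rcases h1 with h1 | h1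
      · exact n2 h1
      · exact n1 h1
    · rintro y (rfl | rfl | hy)
      · exact Or.inl (Or.inr (Or.inl rfl))
      · exact Or.inl (Or.inl (RootedMap.flip_flip _))
      · rcases mem_contour_iff.1 hy with ⟨j, hj⟩ | hy' | hy' | hy'
        · rcases (Int.sub_one_lt_iff.1 (hall _ hj)).lt_or_eq with hk | hk
          · exact Or.inl (Or.inr (Or.inr (h.1.flip_leaf_mem hj hk)))
          · refine Or.inr ((hz d (Or.inl rfl)).symm.trans (hz _ (Or.inr (backs_subset_tops
              (h.2.1 _ ?_)))))
            rw [hk]; exact hj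
        · obtain ⟨⟨j, -, hj⟩, -⟩ := h.1.flip_allBacks_mem (pairwise_pos n4) (by simp) hy'
          exact Or.inl (Or.inr (Or.inr (leaves_subset_contour hj)))
        · exact Or.inl (Or.inr (Or.inr (mem_contour_iff.2 (by simp [hy']))))
        · exact Or.inl (Or.inr (Or.inr (mem_contour_iff.2 (by simp [hy']))))

/-- A connected map with a loop and at least one further edge is separable. -/
theorem _root_.RootedMap.Connected.separable_of_loop {M : RootedMap} (hc : M.Connected)
    (h2 : 2 ≤ Nat.card M.E) {d : M.Dart} (hd : M.cw.SameCycle d (flip d)) : M.Separable := by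
  by_cases hz : ∃ z, M.cw.SameCycle d z ∧ z.1 ≠ d.1
  · obtain ⟨z, hz, hzd⟩ := hz
    refine separable_of_closed (B := {d}) (d := d) (z := z) rfl
      (fun y hy hyd => absurd hy hyd) ?_ hz (fun e => hzd (by rw [Set.mem_singleton_iff.1 e]))
      (fun e => hzd (by rw [← Set.mem_singleton_iff.1 e]; rfl))
    rintro y rfl
    exact Or.inr hd
  -- Otherwise the two darts of the loop form a vertex, and a connected component.
  · exfalso
    push Not at hz
    have key : ∀ g ∈ Subgroup.closure {M.cw, flip}, ∀ x : M.Dart, (g x).1 = d.1 ↔ x.1 = d.1 := by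
      have hcyc : ∀ x : M.Dart, x.1 = d.1 ↔ M.cw.SameCycle d x := by
        refine fun x => ⟨fun hx => ?_, hz x⟩
        rcases RootedMap.eq_or_eq_flip hx with rfl | rfl
        · exact SameCycle.refl _ _
        · exact hd
      intro g hg
      induction hg using Subgroup.closure_induction with
      | mem g hg =>
        intro x
        rcases hg with rfl | rfl
        · rw [hcyc, hcyc, sameCycle_apply_right]
        · rfl
      | one => exact fun x => Iff.rfl
      | mul a b _ _ ha hb => exact fun x => (ha (b x)).trans (hb x)
      | inv a _ ha =>
        intro x
        rw [← ha (a⁻¹ x), ← mul_apply, mul_inv_cancel, one_apply]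
    have : Subsingleton M.E := by
      refine ⟨fun e e' => ?_⟩
      obtain ⟨g, hg, hgx⟩ := hc d (e, true)
      obtain ⟨g', hg', hgx'⟩ := hc d (e', true)
      have h3 := (key g hg d).2 rfl
      have h4 := (key g' hg' d).2 rfl
      rw [hgx] at h3
      rw [hgx'] at h4
      exact h3.trans h4.symm
    have := Finite.card_le_one_iff_subsingleton.2 this
    omega

/-- The exploration of a non-separable planar map: the root vertex has one child, the second ends
are where the reconnection puts them, and the tree is decorated. -/
theorem Represents.of_isNonSeparablePlanar {M : RootedMap} {F : Forest M.Dart}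
    (h : Represents M F) (hM : M.IsNonSeparablePlanar) :
    ∃ sub rest, F = node M.root sub rest ∧ rest.toTrees = [] ∧ F.IsTight (-1) ∧
      F.IsDecorated (-1) := by
  obtain ⟨hpl, hcard, hsep⟩ := hM
  have hnc := h.isPlanar_iff_leaves.1 hpl
  obtain ⟨l, hl, hcyc⟩ := h.rootRotation
  have hdfs := h.dfs
  have hrot := h.rotation
  have hp := h.pairwise
  have hn := h.nodup
  have hneg := h.neg_one_le
  have hall := h.mem
  generalize F.pos = pos at hnc hp
  cases F with
  | nil => simp [tops] at hl
  | back d rest => simpa using hdfs.1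
  | leaf d j rest =>
    simp only [tops, List.cons.injEq] at hl
    obtain ⟨rfl, rfl⟩ := hl
    refine absurd (hpl.1.separable_of_loop hcard (d := M.root) ?_) hsep
    refine hcyc.sameCycle_iff.2 (List.mem_cons_of_mem _ (backs_subset_tops (hdfs.2.1 ?_)))
    have h1 := hdfs.1
    have h2 := hneg (M.root, j) (by simp [leaves])
    simp only at h2
    omega
  | node d sub rest =>
    simp only [tops, List.cons.injEq] at hl
    obtain ⟨rfl, rfl⟩ := hl
    simp only [contour, List.nodup_cons, List.nodup_append, List.mem_append, List.mem_cons,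
      not_or] at hn
    obtain ⟨⟨n1, n2, n3⟩, n4, ⟨n5, n6⟩, n7⟩ := hn
    obtain ⟨hc, hr1, hr2⟩ := hrot
    have hfd : flip M.root ∉ sub.contour := fun hf => n7 _ hf _ (Or.inl rfl) rfl
    simp only [leaves, List.mem_append] at hneg hnc
    have hesc1 := hdfs.1.hasEscapes hsep hr1 n4 (z := flip M.root)
      (fun x hx => hc.sameCycle_iff.2 (List.mem_cons_of_mem _ hx)) hfd
      (by rwa [RootedMap.flip_flip])
    have hesc2 := hdfs.2.2.hasEscapes hsep hr2 n6 (z := M.root)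
      (fun x hx => hcyc.sameCycle_iff.2 (List.mem_cons_of_mem _ hx)) n3 n5
    have hrest := hesc2.toTrees_eq_nil (fun l hl => hneg l (Or.inl hl))
    have hrl := leaves_eq_nil_of_toTrees_eq_nil hrest
    obtain ⟨hb1, hb2⟩ := initialBacks_of_toTrees_eq_nil hrest
    simp only [contour, List.pairwise_cons, List.pairwise_append, List.mem_append,
      List.mem_cons] at hp
    obtain ⟨h0, hp1, ⟨h4, hp2⟩, h3⟩ := hp
    obtain ⟨t1, t2⟩ := hdfs.1.isTight_and_isDecorated hesc1 hp1 (by simp)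
      (by
        intro l hl hlk y hy
        have hlk' : l.2 = -1 := by have := hneg l (Or.inr hl); omega
        exact h3 _ hy _ (Or.inr (backs_subset_contour (hdfs.2.1 l.1 (by rw [← hlk']; exact hl)))))
      (fun a ha b hb => hnc a (Or.inr (by simpa using ha)) b (Or.inr (by simpa using hb)))
      (fun l hl => hneg l (Or.inr hl))
    have hclose : rest.initialBacks = sub.closings (-1) := by
      refine eq_closings hp1 (pairwise_initialBacks hp2) (fun x hx y hy =>
        h3 x hx y (Or.inr (backs_subset_contour (initialBacks_subset hy)))) (fun x => ⟨fun hx => ?_,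
          fun hx => ?_⟩) (fun a ha b hb => hnc a (Or.inr ha) b (Or.inr hb))
      · simpa using hdfs.2.2.flip_initialBack_mem hx
      · rw [hb1]
        simpa using hdfs.2.1 _ hx
    obtain ⟨t3, t4⟩ := isTight_of_toTrees_eq_nil hrest (-1)
    refine ⟨sub, rest, rfl, hrest, ⟨hdfs.1.initialBacks_eq_nil, hclose, t1, t3⟩,
      fun h => by omega, ?_, ?_, t2, t4⟩
    · exact List.pairwise_of_forall_mem_list fun a ha b _ _ => hneg a (Or.inr ha)
    -- Without any subtree at its lower end, the root would be the only edge.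
    · intro hs
      obtain ⟨hs1, hs2⟩ := initialBacks_of_toTrees_eq_nil hs
      have e1 : sub.contour = [] := by rw [hs2, ← hs1, hdfs.1.initialBacks_eq_nil]
      have e2 : rest.contour = [] := by
        rw [hb2, ← hb1, hclose, closings, leaves_eq_nil_of_toTrees_eq_nil hs]
        rfl
      have : Subsingleton M.E := by
        refine ⟨fun e e' => ?_⟩
        have key : ∀ x : M.Dart, x.1 = M.root.1 := by
          intro x
          have := hall x
          simp only [contour, e1, e2, List.nil_append, List.mem_cons, List.not_mem_nil,
            or_false] at this
          rcases this with rfl | rfl <;> rfl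
        exact (key (e, true)).trans (key (e', true)).symm
      have := Finite.card_le_one_iff_subsingleton.2 this
      omega

end Forest

namespace Forest

open RootedMap (flip)
open Equiv.Perm

variable {E : Type}

/-! ### Reconnected trees are not separable -/

section Monochromatic

variable {M : RootedMap} {A : Set M.E} {w : M.Dart}

/-- A set of edges that is not separated at any vertex of a forest nor at the vertex of `z`, the
origin of the forest, contains all edges of the forest or none. -/
theorem mem_iff_of_not_sameCycle
    (hA : ∀ x y, M.cw.SameCycle x y → ¬ M.cw.SameCycle w x → (x.1 ∈ A ↔ y.1 ∈ A))
    {F : Forest M.Dart} (hrot : F.IsRotation M.cw) {z : M.Dart}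
    (hz : ∀ x ∈ F.tops, M.cw.SameCycle z x) (hwz : ¬ M.cw.SameCycle w z)
    (hw : ∀ d ∈ F.treeDarts, ¬ M.cw.SameCycle w (flip d)) :
    ∀ y ∈ F.contour, (y.1 ∈ A ↔ z.1 ∈ A) := by
  induction F generalizing z with
  | nil => simp [contour]
  | leaf d j rest ih =>
    simp only [contour, tops, List.mem_cons, forall_eq_or_imp] at hz ⊢
    exact ⟨(hA _ _ hz.1 hwz).symm, ih hrot hz.2 hwz hw⟩
  | back d rest ih =>
    simp only [contour, tops, List.mem_cons, forall_eq_or_imp] at hz ⊢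
    exact ⟨(hA _ _ hz.1 hwz).symm, ih hrot hz.2 hwz hw⟩
  | node d sub rest ih1 ih2 =>
    obtain ⟨hc, hr1, hr2⟩ := hrot
    simp only [contour, tops, treeDarts, List.mem_append, List.mem_cons, forall_eq_or_imp]
      at hz hw ⊢
    have hd := (hA _ _ hz.1 hwz).symm
    refine ⟨hd, ?_⟩
    rintro y (hy | rfl | hy)
    · exact (ih1 hr1 (z := flip d) (fun x hx => hc.sameCycle_iff.2 (List.mem_cons_of_mem _ hx))
        hw.1 (fun x hx => hw.2 x (Or.inl hx)) y hy).trans hd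
    · exact hd
    · exact ih2 hr2 hz.2 hwz (fun x hx => hw.2 x (Or.inr hx)) y hy

/-- The subtrees at the only vertex `w` where the set `A` may be separated: each has an edge to a
proper ancestor of `w`. -/
theorem mem_iff_of_hasEscapes
    (hA : ∀ x y, M.cw.SameCycle x y → ¬ M.cw.SameCycle w x → (x.1 ∈ A ↔ y.1 ∈ A))
    {F : Forest M.Dart} {k : ℤ} {pre : List (M.Dart × ℤ)} {p : Prop} (hdfs : F.IsDFS k pre)
    (hrot : F.IsRotation M.cw) (hesc : F.HasEscapes k)
    (hw : ∀ d ∈ F.treeDarts, ¬ M.cw.SameCycle w (flip d))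
    (hpre : ∀ l ∈ pre, (l.1.1 ∈ A ↔ p)) (hl : ∀ l ∈ F.leaves, l.2 ≤ k - 1 → (l.1.1 ∈ A ↔ p)) :
    ∀ y ∈ F.contour, (y.1 ∈ A ↔ p) := by
  induction F generalizing pre with
  | nil => simp [contour]
  | leaf d j rest ih =>
    simp only [contour, leaves, List.mem_append, List.mem_cons, List.not_mem_nil, or_false,
      forall_eq_or_imp] at hl ⊢
    have hd : d.1 ∈ A ↔ p := hl (d, j) (Or.inr rfl) hesc.1
    refine ⟨hd, ih hdfs.2.2 hrot hesc.2 hw ?_ fun l h => hl l (Or.inl h)⟩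
    intro l h
    rcases List.mem_append.1 h with h | h
    · exact hpre l h
    · rw [List.mem_singleton.1 h]; exact hd
  | back d rest ih =>
    simp only [contour, List.mem_cons, forall_eq_or_imp]
    exact ⟨hpre _ hdfs.1, ih hdfs.2 hrot hesc hw hpre hl⟩
  | node d sub rest ih1 ih2 =>
    obtain ⟨hc, hr1, hr2⟩ := hrot
    simp only [contour, leaves, treeDarts, List.mem_append, List.mem_cons,
      forall_eq_or_imp] at hl hw ⊢
    have h1 := mem_iff_of_not_sameCycle hA hr1 (z := flip d)
      (fun x hx => hc.sameCycle_iff.2 (List.mem_cons_of_mem _ hx)) hw.1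
      (fun x hx => hw.2 x (Or.inl hx))
    obtain ⟨l, hls, hlk⟩ := hesc.1
    have hd : d.1 ∈ A ↔ p :=
      (h1 _ (leaves_subset_contour hls)).symm.trans (hl l (Or.inr hls) hlk)
    have h1' : ∀ y ∈ sub.contour, (y.1 ∈ A ↔ p) := fun y hy => (h1 y hy).trans hd
    refine ⟨hd, ?_⟩
    rintro y (hy | rfl | hy)
    · exact h1' y hy
    · exact hd
    · refine ih2 hdfs.2.2 hr2 hesc.2.2 (fun x hx => hw.2 x (Or.inr hx)) ?_
        (fun l h => hl l (Or.inl h)) y hy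
      intro l h
      rcases List.mem_append.1 h with h | h
      · exact hpre l h
      · exact h1' _ (leaves_subset_contour h)

/-- If the set `A` is not separated at the vertex of `z`, which is the origin of the forest, and is
separated at most at one vertex `w` elsewhere, it contains all edges of the forest or none. -/
theorem mem_iff_of_isDecorated
    (hA : ∀ x y, M.cw.SameCycle x y → ¬ M.cw.SameCycle w x → (x.1 ∈ A ↔ y.1 ∈ A))
    {F : Forest M.Dart} {k : ℤ} {pre : List (M.Dart × ℤ)} {p : Prop} (hdfs : F.IsDFS k pre)
    (hrot : F.IsRotation M.cw) (hdec : F.IsDecorated k) (hk : -1 ≤ k) (hn : F.contour.Nodup)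
    {z : M.Dart} (hz : ∀ x ∈ F.tops, M.cw.SameCycle z x) (hwz : ¬ M.cw.SameCycle w z)
    (hzp : z.1 ∈ A ↔ p)
    (hl : ∀ l ∈ F.leaves, l.2 < k → flip l.1 ∉ F.contour ∧
      (¬ M.cw.SameCycle w (flip l.1) → (l.1.1 ∈ A ↔ p))) :
    ∀ y ∈ F.contour, (y.1 ∈ A ↔ p) := by
  induction F generalizing k pre z with
  | nil => simp [contour]
  | leaf d j rest ih =>
    simp only [contour, tops, leaves, List.mem_append, List.mem_cons, List.nodup_cons, not_or,
      forall_eq_or_imp] at hl hz hn ⊢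
    exact ⟨(hA _ _ hz.1 hwz).symm.trans hzp, ih hdfs.2.2 hrot hdec.2.2 hk hn.2 hz.2 hwz hzp
      fun l h hlk => ⟨(hl l (Or.inl h) hlk).1.2, (hl l (Or.inl h) hlk).2⟩⟩
  | back d rest ih =>
    simp only [contour, tops, leaves, List.mem_cons, List.nodup_cons, not_or,
      forall_eq_or_imp] at hl hz hn ⊢
    exact ⟨(hA _ _ hz.1 hwz).symm.trans hzp, ih hdfs.2 hrot hdec hk hn.2 hz.2 hwz hzp
      fun l h hlk => ⟨(hl l h hlk).1.2, (hl l h hlk).2⟩⟩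
  | node d sub rest ih1 ih2 =>
    obtain ⟨hc, hr1, hr2⟩ := hrot
    obtain ⟨-, -, -, hdec1, hdec2⟩ := hdec
    simp only [contour, tops, leaves, List.mem_append, List.mem_cons, not_or, List.nodup_cons,
      List.nodup_append, forall_eq_or_imp] at hl hz hn ⊢
    obtain ⟨⟨n1, n2, n3⟩, n4, ⟨n5, n6⟩, n7⟩ := hn
    have hd : d.1 ∈ A ↔ p := (hA _ _ hz.1 hwz).symm.trans hzp
    have hlsub : ∀ l ∈ sub.leaves, l.2 < k + 1 → flip l.1 ∉ sub.contour ∧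
        (¬ M.cw.SameCycle w (flip l.1) → (l.1.1 ∈ A ↔ p)) := by
      intro l h hlk
      rcases (Int.lt_add_one_iff.1 hlk).lt_or_eq with hlk | hlk
      · exact ⟨(hl l (Or.inr h) hlk).1.2.1, (hl l (Or.inr h) hlk).2⟩
      · have hb := hdfs.2.1 l.1 (by rw [← hlk]; exact h)
        exact ⟨fun hs => (n7 _ hs).2 _ (backs_subset_contour hb) rfl,
          fun _ => (hA _ _ (hz.2 _ (backs_subset_tops hb)) hwz).symm.trans hzp⟩
    refine ⟨hd, ?_⟩
    rintro y (hy | rfl | hy)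
    · by_cases hwd : M.cw.SameCycle w (flip d)
      · refine mem_iff_of_hasEscapes hA hdfs.1 hr1 (hdec1.hasEscapes (by omega)) ?_ (by simp) ?_
          y hy
        · intro x hx hwx
          have h1 := hc.sameCycle_iff.1 (hwd.symm.trans hwx)
          rcases List.mem_cons.1 h1 with h1 | h1
          · rw [flip.injective h1] at hx
            exact n1 (mem_contour_iff.2 (by simp [hx]))
          · exact flip_treeDart_notMem_tops n4 hx h1
        · intro l h hlk
          have h1 := hlsub l h (by omega)
          refine h1.2 fun hwl => ?_
          have h2 := hc.sameCycle_iff.1 (hwd.symm.trans hwl)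
          rcases List.mem_cons.1 h2 with h2 | h2
          · exact n1 (flip.injective h2 ▸ leaves_subset_contour h)
          · exact h1.1 (tops_subset_contour h2)
      · exact ih1 hdfs.1 hr1 hdec1 (by omega) n4
          (fun x hx => hc.sameCycle_iff.2 (List.mem_cons_of_mem _ hx)) hwd hd hlsub y hy
    · exact hd
    · exact ih2 hdfs.2.2 hr2 hdec2 hk n6 hz.2 hwz hzp
        (fun l h hlk => ⟨(hl l (Or.inl h) hlk).1.2.2.2, (hl l (Or.inl h) hlk).2⟩) y hy

end Monochromatic

/-- A map explored as a decorated tree, with the second ends at the prescribed places, is planar as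
its edges do not cross. It is non-separable: if a set of edges is separated at most at one vertex,
then every subtree at this vertex is connected to the rest elsewhere, by an edge that escapes. -/
theorem Represents.isNonSeparablePlanar {M : RootedMap} {sub rest : Forest M.Dart}
    (h : Represents M (node M.root sub rest)) (hrest : rest.toTrees = [])
    (ht : (node M.root sub rest).IsTight (-1)) (hdec : (node M.root sub rest).IsDecorated (-1))
    (hcard : 2 ≤ Nat.card M.E) : M.IsNonSeparablePlanar := by
  refine ⟨?_, hcard, ?_⟩
  · rw [h.isPlanar_iff_leaves]
    rintro a ha b hb ⟨h1, h2, h3⟩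
    have := ht.noncrossing_leaves hdec h.dfs h.pairwise ha hb (h.neg_one_le a ha) h1 h2
    omega
  · rintro ⟨A, ⟨e, he⟩, ⟨e', he'⟩, w', -, hw'⟩
    induction w' using Quotient.inductionOn with | _ w
    have hA : ∀ x y, M.cw.SameCycle x y → ¬ M.cw.SameCycle w x → (x.1 ∈ A ↔ y.1 ∈ A) := by
      have key : ∀ x y : M.Dart, M.cw.SameCycle x y → x.1 ∈ A → y.1 ∉ A → M.cw.SameCycle w x := by
        intro x y hxy hx hy
        have h1 := hw' (M.origin x) ⟨⟨x.1, hx, x.2, rfl⟩, ⟨y.1, hy, y.2,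
          RootedMap.origin_eq_iff_sameCycle.2 hxy.symm⟩⟩
        exact (RootedMap.origin_eq_iff_sameCycle (y := w)).1 h1 |>.symm
      intro x y hxy hwx
      by_contra hne
      by_cases hx : x.1 ∈ A
      · exact hwx (key x y hxy hx (by tauto))
      · exact hwx ((key y x hxy.symm (by tauto) hx).trans hxy.symm)
    obtain ⟨l, hl, hcyc⟩ := h.rootRotation
    simp only [tops, List.cons.injEq, true_and] at hl
    subst hl
    have htops : ∀ x ∈ (node M.root sub rest).tops, M.cw.SameCycle M.root x :=
      fun x hx => hcyc.sameCycle_iff.2 hx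
    have hall : ∀ y : M.Dart, y.1 ∈ A ↔ M.root.1 ∈ A := by
      by_cases hwr : M.cw.SameCycle w M.root
      · obtain ⟨hc, hr1, hr2⟩ := h.rotation
        have hw : ∀ d ∈ (node M.root sub rest).treeDarts, ¬ M.cw.SameCycle w (flip d) :=
          fun d hd hwd => flip_treeDart_notMem_tops h.nodup hd
            (hcyc.sameCycle_iff.1 (hwr.symm.trans hwd))
        simp only [treeDarts, List.mem_cons, List.mem_append, forall_eq_or_imp] at hw
        have h1 := mem_iff_of_not_sameCycle hA hr1 (z := flip M.root)
          (fun x hx => hc.sameCycle_iff.2 (List.mem_cons_of_mem _ hx)) hw.1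
          (fun x hx => hw.2 x (Or.inl hx))
        intro y
        have hy := h.mem y
        simp only [contour, List.mem_append, List.mem_cons] at hy
        rcases hy with rfl | hy | rfl | hy
        · rfl
        · exact h1 y hy
        · rfl
        · rw [(initialBacks_of_toTrees_eq_nil hrest).2] at hy
          have h2 := h.dfs.2.2.flip_back_mem hy
          rw [leaves_eq_nil_of_toTrees_eq_nil hrest] at h2
          simp only [List.nil_append, List.append_nil] at h2
          exact h1 (flip y) (leaves_subset_contour h2)
      · exact fun y => mem_iff_of_isDecorated hA h.dfs h.rotation hdec le_rfl h.nodup htops hwr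
          Iff.rfl (fun l hl hlk => absurd hlk (h.neg_one_le l hl).not_gt) y (h.mem y)
    exact he' (((hall (e', true)).2 ((hall (e, true)).1 he)))

end Forest

namespace Forest

open RootedMap (flip)
open Equiv.Perm

variable {E : Type}

/-! ### Existence of depth-first explorations -/

theorem mem_openings_iff {D : Type} {F : Forest D} {x : D} :
    x ∈ F.openings ↔ (∃ j, (x, j) ∈ F.leaves) ∨ x ∈ F.treeDarts := by
  induction F with
  | nil => simp [openings, leaves, treeDarts]
  | leaf d j rest ih =>
    simp only [openings, List.mem_cons, ih, leaves, List.mem_append, Prod.mk.injEq,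
      List.not_mem_nil, or_false, treeDarts, exists_or, exists_and_left, exists_eq, and_true]
    tauto
  | back d rest ih => exact ih
  | node d sub rest ih1 ih2 =>
    simp only [openings, List.mem_cons, ih1, ih2, leaves, List.mem_append, treeDarts, exists_or]
    tauto

theorem openings_subset_contour {F : Forest (E × Bool)} {x : E × Bool} (h : x ∈ F.openings) :
    x ∈ F.contour := by
  rw [mem_contour_iff]
  have := mem_openings_iff.1 h
  tauto

theorem mem_backs_of_mem_tops {D : Type} {F : Forest D} {x : D} (h : x ∈ F.tops)
    (hx : x ∉ F.openings) : x ∈ F.backs := by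
  induction F with
  | nil => simp [tops] at h
  | leaf d j rest ih =>
    simp only [tops, openings, backs, List.mem_cons, not_or] at *
    exact ih (h.resolve_left hx.1) hx.2
  | back d rest ih =>
    simp only [tops, openings, backs, List.mem_cons] at *
    exact h.imp id fun h => ih h hx
  | node d sub rest _ ih =>
    simp only [tops, openings, backs, List.mem_cons, List.mem_append, not_or] at *
    exact ih (h.resolve_left hx.1) hx.2.2

/-- What is known during an exploration, at a vertex of depth `k` with remaining darts `ds`:
`vis` consists of the darts at visited vertices and `used` of the darts of explored edges. The
partial function `env` gives the depths of the active vertices, those on the path to the current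
vertex. Each of the other visited vertices is exhausted. -/
structure ExploreInv (M : RootedMap) (k : ℤ) (env : M.Dart → Option ℤ) (vis used : Set M.Dart)
    (ds : List M.Dart) : Prop where
  depth_ge : -1 ≤ k
  flip_mem : ∀ x ∈ used, flip x ∈ used
  used_subset : ∀ x ∈ used, x ∈ vis
  vis_closed : ∀ x y, M.cw.SameCycle x y → x ∈ vis → y ∈ vis
  active : ∀ x ∈ vis, x ∉ used → ∃ j, env x = some j
  env_mem : ∀ x j, env x = some j → x ∈ vis ∧ j ≤ k ∧ -1 ≤ j
  env_darts : ∀ x ∈ ds, env x = some k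
  nodup : ds.Nodup
  remaining : ∀ x, env x = some k → x ∈ used ∨ x ∈ ds

/-- The outcome of exploring the darts `ds`. -/
structure ExploreResult (M : RootedMap) (k : ℤ) (env : M.Dart → Option ℤ) (vis used : Set M.Dart)
    (ds : List M.Dart) (F : Forest M.Dart) : Prop where
  tops_eq : F.tops = ds
  nodup : F.contour.Nodup
  fresh : ∀ x ∈ F.contour, x ∈ ds ∨ x ∉ vis
  vis_closed : ∀ x y, M.cw.SameCycle x y → x ∈ vis ∨ x ∈ F.contour → y ∈ vis ∨ y ∈ F.contour
  openings_fresh : ∀ x ∈ F.openings, x ∉ used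
  exhausted : ∀ x ∈ F.contour, x ∈ used ∨ x ∈ F.openings ∨ flip x ∈ F.openings
  leaf_label : ∀ l ∈ F.leaves, (l.2 ≤ k ∧ env (flip l.1) = some l.2) ∨
    (k < l.2 ∧ flip l.1 ∈ F.contour ∧ flip l.1 ∉ vis)
  rotation : F.IsRotation M.cw
  dfs : ∀ pre : List (M.Dart × ℤ), (∀ x ∈ ds, x ∈ used → (flip x, k) ∈ pre) → F.IsDFS k pre

theorem ExploreResult.flip_opening {M : RootedMap} {k : ℤ} {env : M.Dart → Option ℤ}
    {vis used : Set M.Dart} {ds : List M.Dart} {F : Forest M.Dart}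
    (h : ExploreResult M k env vis used ds F) (hi : ExploreInv M k env vis used ds) :
    ∀ x ∈ F.openings, flip x ∈ vis ∨ flip x ∈ F.contour := by
  intro x hx
  rcases mem_openings_iff.1 hx with ⟨j, hj⟩ | hx
  · rcases h.leaf_label _ hj with h1 | h1
    · exact Or.inl (hi.env_mem _ _ h1.2).1
    · exact Or.inr h1.2.1
  · exact Or.inr (mem_contour_iff.2 (by simp [hx]))

section Steps

variable {M : RootedMap} {k : ℤ} {env : M.Dart → Option ℤ} {vis used : Set M.Dart} {d : M.Dart}
  {ds : List M.Dart} {sub F : Forest M.Dart}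

/-- The situation after an edge already explored has been skipped. -/
theorem ExploreInv.back (h : ExploreInv M k env vis used (d :: ds)) (hd : d ∈ used) :
    ExploreInv M k env vis used ds where
  __ := h
  env_darts x hx := h.env_darts x (List.mem_cons_of_mem _ hx)
  nodup := h.nodup.of_cons
  remaining x hx := by
    rcases h.remaining x hx with h1 | h1
    · exact Or.inl h1
    · rcases List.mem_cons.1 h1 with rfl | h1
      · exact Or.inl hd
      · exact Or.inr h1

theorem ExploreResult.back (h : ExploreInv M k env vis used (d :: ds)) (hd : d ∈ used)
    (hF : ExploreResult M k env vis used ds F) :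
    ExploreResult M k env vis used (d :: ds) (back d F) := by
  have hvis := h.used_subset d hd
  have hdF : d ∉ F.contour := fun hdc =>
    (hF.fresh d hdc).elim (List.nodup_cons.1 h.nodup).1 (· hvis)
  refine ⟨by rw [tops, hF.tops_eq], List.nodup_cons.2 ⟨hdF, hF.nodup⟩, ?_, ?_, hF.openings_fresh,
    ?_, ?_, hF.rotation, ?_⟩
  · intro x hx
    rcases List.mem_cons.1 hx with rfl | hx
    · exact Or.inl List.mem_cons_self
    · exact (hF.fresh x hx).imp (List.mem_cons_of_mem _) id
  · intro x y hxy hx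
    have := hF.vis_closed x y hxy
    simp only [contour, List.mem_cons] at hx ⊢
    rcases hx with hx | rfl | hx
    · have := this (Or.inl hx); tauto
    · have := this (Or.inl hvis); tauto
    · have := this (Or.inr hx); tauto
  · intro x hx
    rcases List.mem_cons.1 hx with rfl | hx
    · exact Or.inl hd
    · exact hF.exhausted x hx
  · exact fun l hl => (hF.leaf_label l hl).imp id fun h1 => ⟨h1.1, List.mem_cons_of_mem _ h1.2.1,
      h1.2.2⟩
  · intro pre hpre
    exact ⟨hpre d List.mem_cons_self hd,
      hF.dfs pre fun x hx => hpre x (List.mem_cons_of_mem _ hx)⟩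

/-- The situation after the exploration of an edge leading to a visited vertex. -/
theorem ExploreInv.leaf (h : ExploreInv M k env vis used (d :: ds)) (hfd : flip d ∈ vis) :
    ExploreInv M k env vis (used ∪ {d, flip d}) ds where
  depth_ge := h.depth_ge
  flip_mem := by
    rintro x (hx | rfl | rfl)
    · exact Or.inl (h.flip_mem x hx)
    · exact Or.inr (Or.inr rfl)
    · exact Or.inr (Or.inl (RootedMap.flip_flip d))
  used_subset := by
    rintro x (hx | rfl | rfl)
    · exact h.used_subset x hx
    · exact (h.env_mem _ _ (h.env_darts x List.mem_cons_self)).1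
    · exact hfd
  vis_closed := h.vis_closed
  active x hx hx' := h.active x hx fun h1 => hx' (Or.inl h1)
  env_mem := h.env_mem
  env_darts x hx := h.env_darts x (List.mem_cons_of_mem _ hx)
  nodup := h.nodup.of_cons
  remaining x hx := by
    rcases h.remaining x hx with h1 | h1
    · exact Or.inl (Or.inl h1)
    · rcases List.mem_cons.1 h1 with rfl | h1
      · exact Or.inl (Or.inr (Or.inl rfl))
      · exact Or.inr h1

theorem ExploreResult.leaf (h : ExploreInv M k env vis used (d :: ds)) (hd : d ∉ used) {j : ℤ}
    (hj : env (flip d) = some j)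
    (hF : ExploreResult M k env vis (used ∪ {d, flip d}) ds F) :
    ExploreResult M k env vis used (d :: ds) (leaf d j F) := by
  have hvis := (h.env_mem _ _ (h.env_darts d List.mem_cons_self)).1
  have hfvis := h.env_mem _ _ hj
  have hdF : d ∉ F.contour := fun hdc =>
    (hF.fresh d hdc).elim (List.nodup_cons.1 h.nodup).1 (· hvis)
  have hfd : flip d ∉ used := fun h1 => hd (by simpa using h.flip_mem _ h1)
  refine ⟨by rw [tops, hF.tops_eq], List.nodup_cons.2 ⟨hdF, hF.nodup⟩, ?_, ?_, ?_, ?_, ?_,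
    hF.rotation, ?_⟩
  · intro x hx
    rcases List.mem_cons.1 hx with rfl | hx
    · exact Or.inl List.mem_cons_self
    · exact (hF.fresh x hx).imp (List.mem_cons_of_mem _) id
  · intro x y hxy hx
    have := hF.vis_closed x y hxy
    simp only [contour, List.mem_cons] at hx ⊢
    rcases hx with hx | rfl | hx
    · have := this (Or.inl hx); tauto
    · have := this (Or.inl hvis); tauto
    · have := this (Or.inr hx); tauto
  · intro x hx
    rcases List.mem_cons.1 hx with rfl | hx
    · exact hd
    · exact fun h1 => hF.openings_fresh x hx (Or.inl h1)
  · intro x hx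
    simp only [contour, openings, List.mem_cons] at hx ⊢
    rcases hx with rfl | hx
    · tauto
    · rcases hF.exhausted x hx with (h1 | rfl | rfl) | h1 | h1
      · tauto
      · tauto
      · rw [RootedMap.flip_flip]; tauto
      · tauto
      · tauto
  · intro l hl
    simp only [leaves, List.mem_append, List.mem_singleton] at hl
    rcases hl with hl | rfl
    · exact (hF.leaf_label l hl).imp id fun h1 => ⟨h1.1, List.mem_cons_of_mem _ h1.2.1, h1.2.2⟩
    · exact Or.inl ⟨hfvis.2.1, hj⟩
  · intro pre hpre
    refine ⟨hfvis.2.1, ?_, hF.dfs _ ?_⟩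
    · rintro rfl
      have h1 : flip d ∈ ds := by
        rcases h.remaining _ hj with h1 | h1
        · exact absurd h1 hfd
        · exact (List.mem_cons.1 h1).resolve_left (RootedMap.flip_ne d)
      refine mem_backs_of_mem_tops (by rwa [hF.tops_eq]) fun h2 => ?_
      exact hF.openings_fresh _ h2 (Or.inr (Or.inr rfl))
    · rintro x hx (hx' | rfl | rfl)
      · exact List.mem_append_left _ (hpre x (List.mem_cons_of_mem _ hx) hx')
      · exact absurd hx (List.nodup_cons.1 h.nodup).1
      · have := h.env_darts _ (List.mem_cons_of_mem _ hx)
        rw [hj, Option.some_inj] at this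
        subst this
        rw [RootedMap.flip_flip]
        simp

open Classical in
/-- The situation at a new vertex, which becomes active at depth `k + 1`. -/
theorem ExploreInv.node_sub (h : ExploreInv M k env vis used (d :: ds)) (hfd : flip d ∉ vis) :
    ExploreInv M (k + 1) (fun x => if M.cw.SameCycle (flip d) x then some (k + 1) else env x)
      (vis ∪ {x | M.cw.SameCycle (flip d) x}) (used ∪ {d, flip d})
      (M.around (flip d)).tail := by
  obtain ⟨h1, h2, h3⟩ := M.around_isCycList (flip d)
  have hvis := (h.env_mem _ _ (h.env_darts d List.mem_cons_self)).1
  refine ⟨by have := h.depth_ge; omega, ?_, ?_, ?_, ?_, ?_, ?_, h3.tail, ?_⟩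
  · rintro x (hx | rfl | rfl)
    · exact Or.inl (h.flip_mem x hx)
    · exact Or.inr (Or.inr rfl)
    · exact Or.inr (Or.inl (RootedMap.flip_flip d))
  · rintro x (hx | rfl | rfl)
    · exact Or.inl (h.used_subset x hx)
    · exact Or.inl hvis
    · exact Or.inr (SameCycle.refl _ _)
  · rintro x y hxy (hx | hx)
    · exact Or.inl (h.vis_closed x y hxy hx)
    · exact Or.inr (SameCycle.trans hx hxy)
  · rintro x hx hx'
    by_cases hs : M.cw.SameCycle (flip d) x
    · exact ⟨k + 1, if_pos hs⟩
    · obtain ⟨j, hj⟩ := h.active x (hx.resolve_right hs) fun h4 => hx' (Or.inl h4)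
      exact ⟨j, by rw [if_neg hs, hj]⟩
  · intro x j hj
    by_cases hs : M.cw.SameCycle (flip d) x
    · rw [if_pos hs, Option.some_inj] at hj
      have := h.depth_ge
      exact ⟨Or.inr hs, by omega, by omega⟩
    · rw [if_neg hs] at hj
      obtain ⟨h4, h5, h6⟩ := h.env_mem x j hj
      exact ⟨Or.inl h4, by omega, h6⟩
  · intro x hx
    exact if_pos (h2.sameCycle_iff.2 (List.mem_cons_of_mem _ hx))
  · intro x hx
    by_cases hs : M.cw.SameCycle (flip d) x
    · rcases List.mem_cons.1 (h2.sameCycle_iff.1 hs) with rfl | h4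
      · exact Or.inl (Or.inr (Or.inr rfl))
      · exact Or.inr h4
    · rw [if_neg hs] at hx
      have := (h.env_mem x _ hx).2.1
      omega

open Classical in
/-- The situation after the exploration of a new vertex. -/
theorem ExploreInv.node_rest (h : ExploreInv M k env vis used (d :: ds)) (hfd : flip d ∉ vis)
    (hs : ExploreResult M (k + 1)
      (fun x => if M.cw.SameCycle (flip d) x then some (k + 1) else env x)
      (vis ∪ {x | M.cw.SameCycle (flip d) x}) (used ∪ {d, flip d})
      (M.around (flip d)).tail sub) :
    ExploreInv M k env (vis ∪ {x | M.cw.SameCycle (flip d) x ∨ x ∈ sub.contour})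
      {x | x ∈ used ∨ x = d ∨ x = flip d ∨ x ∈ sub.openings ∨ flip x ∈ sub.openings} ds := by
  have hi := h.node_sub hfd
  obtain ⟨h1, h2, h3⟩ := M.around_isCycList (flip d)
  have hvis := (h.env_mem _ _ (h.env_darts d List.mem_cons_self)).1
  refine ⟨h.depth_ge, ?_, ?_, ?_, ?_, ?_, fun x hx => h.env_darts x (List.mem_cons_of_mem _ hx),
    h.nodup.of_cons, ?_⟩
  · rintro x (hx | rfl | rfl | hx | hx)
    · exact Or.inl (h.flip_mem x hx)
    · exact Or.inr (Or.inr (Or.inl rfl))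
    · exact Or.inr (Or.inl (RootedMap.flip_flip d))
    · exact Or.inr (Or.inr (Or.inr (Or.inr (by rwa [RootedMap.flip_flip]))))
    · exact Or.inr (Or.inr (Or.inr (Or.inl hx)))
  · rintro x (hx | rfl | rfl | hx | hx)
    · exact Or.inl (h.used_subset x hx)
    · exact Or.inl hvis
    · exact Or.inr (Or.inl (SameCycle.refl _ _))
    · exact Or.inr (Or.inr (openings_subset_contour hx))
    · rcases hs.flip_opening hi _ hx with (h4 | h4) | h4
      · rw [RootedMap.flip_flip] at h4; exact Or.inl h4
      · rw [RootedMap.flip_flip] at h4; exact Or.inr (Or.inl h4)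
      · rw [RootedMap.flip_flip] at h4; exact Or.inr (Or.inr h4)
  · rintro x y hxy hx
    have := hs.vis_closed x y hxy
    simp only [Set.mem_union, Set.mem_ofPred_eq] at hx this ⊢
    tauto
  · rintro x (hx | hx | hx) hx'
    · exact h.active x hx fun h4 => hx' (Or.inl h4)
    · exfalso
      rcases List.mem_cons.1 (h2.sameCycle_iff.1 hx) with rfl | h4
      · exact hx' (Or.inr (Or.inr (Or.inl rfl)))
      · rw [← hs.tops_eq] at h4
        have := hs.exhausted x (tops_subset_contour h4)
        simp only [Set.mem_union, Set.mem_insert_iff, Set.mem_singleton_iff,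
          Set.mem_ofPred_eq] at this hx'
        tauto
    · exfalso
      have := hs.exhausted x hx
      simp only [Set.mem_union, Set.mem_insert_iff, Set.mem_singleton_iff,
        Set.mem_ofPred_eq] at this hx'
      tauto
  · intro x j hj
    obtain ⟨h4, h5⟩ := h.env_mem x j hj
    exact ⟨Or.inl h4, h5⟩
  · intro x hx
    rcases h.remaining x hx with h4 | h4
    · exact Or.inl (Or.inl h4)
    · rcases List.mem_cons.1 h4 with rfl | h4
      · exact Or.inl (Or.inr (Or.inl rfl))
      · exact Or.inr h4

open Classical in
theorem ExploreResult.node (h : ExploreInv M k env vis used (d :: ds)) (hd : d ∉ used)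
    (hfd : flip d ∉ vis)
    (hs : ExploreResult M (k + 1)
      (fun x => if M.cw.SameCycle (flip d) x then some (k + 1) else env x)
      (vis ∪ {x | M.cw.SameCycle (flip d) x}) (used ∪ {d, flip d})
      (M.around (flip d)).tail sub)
    (hF : ExploreResult M k env (vis ∪ {x | M.cw.SameCycle (flip d) x ∨ x ∈ sub.contour})
      {x | x ∈ used ∨ x = d ∨ x = flip d ∨ x ∈ sub.openings ∨ flip x ∈ sub.openings} ds F) :
    ExploreResult M k env vis used (d :: ds) (node d sub F) := by
  obtain ⟨h1, h2, h3⟩ := M.around_isCycList (flip d)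
  have hdk := h.env_darts d List.mem_cons_self
  have hvis := (h.env_mem _ _ hdk).1
  have hdsvis : ∀ x ∈ ds, x ∈ vis := fun x hx =>
    (h.env_mem _ _ (h.env_darts x (List.mem_cons_of_mem _ hx))).1
  have hnew : ∀ x, M.cw.SameCycle (flip d) x → x ∉ vis := fun x hx hx' =>
    hfd (h.vis_closed _ _ hx.symm hx')
  have htail : ∀ x ∈ (M.around (flip d)).tail, M.cw.SameCycle (flip d) x := fun x hx =>
    h2.sameCycle_iff.2 (List.mem_cons_of_mem _ hx)
  have hsub : ∀ x ∈ sub.contour, x ∉ vis := fun x hx =>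
    (hs.fresh x hx).elim (fun h4 => hnew x (htail x h4)) fun h4 h5 => h4 (Or.inl h5)
  have hfsub : flip d ∉ sub.contour := fun h4 => by
    rcases hs.fresh _ h4 with h5 | h5
    · rw [h1] at h3
      exact (List.nodup_cons.1 h3).1 h5
    · exact h5 (Or.inr (SameCycle.refl _ _))
  have hrest : ∀ x ∈ F.contour, x ∈ ds ∨ (x ∉ vis ∧ x ∉ sub.contour ∧ x ≠ flip d) := by
    intro x hx
    refine (hF.fresh x hx).imp id fun h4 => ⟨fun h5 => h4 (Or.inl h5),
      fun h5 => h4 (Or.inr (Or.inr h5)), ?_⟩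
    rintro rfl
    exact h4 (Or.inr (Or.inl (SameCycle.refl _ _)))
  have hlab : ∀ l ∈ sub.leaves, (l.2 ≤ k ∧ env (flip l.1) = some l.2) ∨
      (k < l.2 ∧ (flip l.1 = flip d ∨ flip l.1 ∈ sub.contour) ∧ flip l.1 ∉ vis) := by
    intro l hl
    rcases hs.leaf_label l hl with ⟨h4, h5⟩ | ⟨h4, h5, h6⟩
    · by_cases hsc : M.cw.SameCycle (flip d) (flip l.1)
      · rw [if_pos hsc, Option.some_inj] at h5
        refine Or.inr ⟨by omega, ?_, hnew _ hsc⟩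
        refine (List.mem_cons.1 (h2.sameCycle_iff.1 hsc)).imp id fun h6 => ?_
        rw [← hs.tops_eq] at h6
        exact tops_subset_contour h6
      · rw [if_neg hsc] at h5
        exact Or.inl ⟨(h.env_mem _ _ h5).2.1, h5⟩
    · exact Or.inr ⟨by omega, Or.inr h5, hsub _ h5⟩
  refine ⟨by rw [tops, hF.tops_eq], ?_, ?_, ?_, ?_, ?_, ?_, ⟨?_, hs.rotation, hF.rotation⟩, ?_⟩
  · simp only [contour, List.nodup_cons, List.nodup_append, List.mem_append, List.mem_cons, not_or]
    refine ⟨⟨fun h4 => hsub _ h4 hvis, (RootedMap.flip_ne d).symm, fun h4 => ?_⟩, hs.nodup,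
      ⟨fun h4 => ?_, hF.nodup⟩, ?_⟩
    · exact (hrest _ h4).elim (List.nodup_cons.1 h.nodup).1 fun h5 => h5.1 hvis
    · exact (hrest _ h4).elim (fun h5 => hfd (hdsvis _ h5)) fun h5 => h5.2.2 rfl
    · rintro x hx y (rfl | hy) rfl
      · exact hfsub hx
      · exact (hrest _ hy).elim (fun h5 => hsub _ hx (hdsvis _ h5)) fun h5 => h5.2.1 hx
  · intro x hx
    simp only [contour, List.mem_append, List.mem_cons] at hx ⊢
    rcases hx with rfl | hx | rfl | hx
    · exact Or.inl (Or.inl rfl)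
    · exact Or.inr (hsub x hx)
    · exact Or.inr hfd
    · exact (hrest x hx).imp Or.inr fun h4 => h4.1
  · intro x y hxy hx
    have hof : ∀ z, M.cw.SameCycle (flip d) z → z = flip d ∨ z ∈ sub.contour := fun z hz =>
      (List.mem_cons.1 (h2.sameCycle_iff.1 hz)).imp id fun h6 => by
        rw [← hs.tops_eq] at h6
        exact tops_subset_contour h6
    have h4 : x ∈ vis ∪ {x | M.cw.SameCycle (flip d) x ∨ x ∈ sub.contour} ∨ x ∈ F.contour := by
      simp only [contour, List.mem_append, List.mem_cons] at hx
      rcases hx with hx | rfl | hx | rfl | hx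
      · exact Or.inl (Or.inl hx)
      · exact Or.inl (Or.inl hvis)
      · exact Or.inl (Or.inr (Or.inr hx))
      · exact Or.inl (Or.inr (Or.inl (SameCycle.refl _ _)))
      · exact Or.inr hx
    simp only [contour, List.mem_append, List.mem_cons]
    rcases hF.vis_closed x y hxy h4 with (h5 | h5 | h5) | h5
    · exact Or.inl h5
    · exact Or.inr (Or.inr ((hof y h5).elim (fun h6 => Or.inr (Or.inl h6)) Or.inl))
    · exact Or.inr (Or.inr (Or.inl h5))
    · exact Or.inr (Or.inr (Or.inr (Or.inr h5)))
  · intro x hx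
    simp only [openings, List.mem_append, List.mem_cons] at hx
    rcases hx with rfl | hx | hx
    · exact hd
    · exact fun h4 => hs.openings_fresh x hx (Or.inl h4)
    · exact fun h4 => hF.openings_fresh x hx (Or.inl h4)
  · intro x hx
    simp only [contour, openings, List.mem_append, List.mem_cons] at hx ⊢
    rcases hx with rfl | hx | rfl | hx
    · exact Or.inr (Or.inl (Or.inl rfl))
    · rcases hs.exhausted x hx with (h1 | rfl | rfl) | h1 | h1
      · exact Or.inl h1
      · exact Or.inr (Or.inl (Or.inl rfl))
      · exact Or.inr (Or.inr (Or.inl (RootedMap.flip_flip d)))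
      · exact Or.inr (Or.inl (Or.inr (Or.inl h1)))
      · exact Or.inr (Or.inr (Or.inr (Or.inl h1)))
    · exact Or.inr (Or.inr (Or.inl (RootedMap.flip_flip d)))
    · rcases hF.exhausted x hx with (h1 | rfl | rfl | h1 | h1) | h1 | h1
      · exact Or.inl h1
      · exact Or.inr (Or.inl (Or.inl rfl))
      · exact Or.inr (Or.inr (Or.inl (RootedMap.flip_flip d)))
      · exact Or.inr (Or.inl (Or.inr (Or.inl h1)))
      · exact Or.inr (Or.inr (Or.inr (Or.inl h1)))
      · exact Or.inr (Or.inl (Or.inr (Or.inr h1)))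
      · exact Or.inr (Or.inr (Or.inr (Or.inr h1)))
  · intro l hl
    simp only [leaves, List.mem_append, contour, List.mem_cons] at hl ⊢
    rcases hl with hl | hl
    · exact (hF.leaf_label l hl).imp id fun h1 => ⟨h1.1, Or.inr (Or.inr (Or.inr h1.2.1)),
        fun h4 => h1.2.2 (Or.inl h4)⟩
    · exact (hlab l hl).imp id fun h1 => ⟨h1.1,
        Or.inr (h1.2.1.elim (fun h4 => Or.inr (Or.inl h4)) Or.inl), h1.2.2⟩
  · rw [hs.tops_eq]
    exact h2
  · intro pre hpre
    refine ⟨hs.dfs [] ?_, ?_, hF.dfs _ ?_⟩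
    · rintro x hx (hx' | rfl | rfl)
      · exact absurd (h.used_subset x hx') (hnew x (htail x hx))
      · exact absurd hvis (hnew x (htail x hx))
      · rw [h1] at h3
        exact absurd hx (List.nodup_cons.1 h3).1
    · intro l hl
      have hlo : l ∈ sub.openings := mem_openings_iff.2 (Or.inl ⟨_, hl⟩)
      have hlu := hs.openings_fresh l hlo
      rcases hlab _ hl with ⟨-, h5⟩ | ⟨h4, -⟩
      · have h6 : flip l ∈ ds := by
          rcases h.remaining _ h5 with h6 | h6
          · exact absurd (Or.inl (by simpa using h.flip_mem _ h6)) hlu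
          · refine (List.mem_cons.1 h6).resolve_left fun h7 => hlu (Or.inr (Or.inr ?_))
            simp only at h7
            rw [← h7, RootedMap.flip_flip]
            rfl
        refine mem_backs_of_mem_tops (by rwa [hF.tops_eq]) fun h7 => ?_
        refine hF.openings_fresh _ h7 ?_
        simp [hlo]
      · exact absurd h4 (lt_irrefl _)
    · rintro x hx (hx' | rfl | rfl | hx' | hx')
      · exact List.mem_append_left _ (hpre x (List.mem_cons_of_mem _ hx) hx')
      · exact absurd hx (List.nodup_cons.1 h.nodup).1
      · exact absurd (hdsvis _ hx) hfd
      · exact absurd (hdsvis _ hx) (hsub x (openings_subset_contour hx'))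
      · rcases mem_openings_iff.1 hx' with ⟨j, hj⟩ | hx'
        · rcases hlab _ hj with ⟨-, h5⟩ | ⟨-, -, h5⟩
          · have h6 := h.env_darts x (List.mem_cons_of_mem _ hx)
            simp only [RootedMap.flip_flip] at h5
            rw [h6, Option.some_inj] at h5
            subst h5
            exact List.mem_append_right _ hj
          · simp only [RootedMap.flip_flip] at h5
            exact absurd (hdsvis _ hx) h5
        · exact absurd (hdsvis _ hx) (hsub x (mem_contour_iff.2 (by simp [hx'])))

/-- The exploration ends, as every step either skips a dart or explores a new edge. -/
theorem ExploreInv.exists_result (n : ℕ) :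
    ∀ {k : ℤ} {env : M.Dart → Option ℤ} {vis used : Set M.Dart} {ds : List M.Dart},
      ExploreInv M k env vis used ds → usedᶜ.ncard ≤ n →
      ∃ F, ExploreResult M k env vis used ds F := by
  classical
  induction n using Nat.strong_induction_on with
  | _ n ihn =>
    intro k env vis used ds
    induction ds generalizing vis used with
    | nil =>
      intro h _
      exact ⟨nil, rfl, List.nodup_nil, by simp [contour], by simpa [contour] using h.vis_closed,
        by simp [openings], by simp [contour], by simp [leaves], trivial, fun _ _ => trivial⟩
    | cons d ds ih =>
      intro h hn
      by_cases hd : d ∈ used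
      · obtain ⟨F, hF⟩ := ih (h.back hd) hn
        exact ⟨_, hF.back h hd⟩
      have hlt : ∀ s : Set M.Dart, used ⊆ s → d ∈ s → sᶜ.ncard < n := by
        intro s hs hds
        refine lt_of_lt_of_le (Set.ncard_lt_ncard ⟨Set.compl_subset_compl.2 hs, fun h1 => ?_⟩
          (Set.toFinite _)) hn
        exact h1 hd hds
      by_cases hfd : flip d ∈ vis
      · obtain ⟨F, hF⟩ := ih (h.leaf hfd) (hlt _ Set.subset_union_left (by simp)).le
        obtain ⟨j, hj⟩ := h.active _ hfd fun h1 => hd (by simpa using h.flip_mem _ h1)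
        exact ⟨_, hF.leaf h hd hj⟩
      · obtain ⟨sub, hs⟩ := ihn _ (hlt _ Set.subset_union_left (by simp)) (h.node_sub hfd) le_rfl
        obtain ⟨F, hF⟩ := ih (h.node_rest hfd hs) (hlt {x | x ∈ used ∨ x = d ∨ x = flip d ∨
          x ∈ sub.openings ∨ flip x ∈ sub.openings} (fun x hx => Or.inl hx)
          (Or.inr (Or.inl rfl))).le
        exact ⟨_, ExploreResult.node h hd hfd hs hF⟩

end Steps

/-- A connected map has a depth-first exploration. -/
theorem exists_represents {M : RootedMap} (hM : M.Connected) : ∃ F, Represents M F := by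
  classical
  obtain ⟨h1, h2, h3⟩ := M.around_isCycList M.root
  have hmem : ∀ x, M.cw.SameCycle M.root x ↔ x ∈ M.around M.root := fun x => by
    rw [h2.sameCycle_iff, ← h1]
  have hi : ExploreInv M (-1) (fun x => if M.cw.SameCycle M.root x then some (-1) else none)
      {x | M.cw.SameCycle M.root x} ∅ (M.around M.root) := by
    refine ⟨le_rfl, by simp, by simp, fun x y hxy hx => SameCycle.trans hx hxy, ?_, ?_, ?_, h3, ?_⟩
    · intro x hx _
      exact ⟨-1, if_pos hx⟩
    · intro x j hj
      by_cases hx : M.cw.SameCycle M.root x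
      · rw [if_pos hx, Option.some_inj] at hj
        subst hj
        exact ⟨hx, le_rfl, le_rfl⟩
      · rw [if_neg hx] at hj
        simp at hj
    · intro x hx
      exact if_pos ((hmem x).2 hx)
    · intro x hx
      by_cases hx' : M.cw.SameCycle M.root x
      · exact Or.inr ((hmem x).1 hx')
      · rw [if_neg hx'] at hx
        simp at hx
  obtain ⟨F, hF⟩ := hi.exists_result _ le_rfl
  have hvis : ∀ x, M.cw.SameCycle M.root x → x ∈ F.contour := fun x hx =>
    tops_subset_contour (by rw [hF.tops_eq, ← hmem]; exact hx)
  refine ⟨F, hF.nodup, fun x => ?_, ⟨_, hF.tops_eq.trans h1, h2⟩, hF.rotation,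
    hF.dfs [] (by simp), fun l hl => ?_⟩
  · obtain ⟨g, hg, rfl⟩ := hM M.root x
    have hcl : ∀ y, M.cw.SameCycle M.root y ∨ y ∈ F.contour → y ∈ F.contour :=
      fun y hy => hy.elim (hvis y) id
    have key : ∀ y, g y ∈ F.contour ↔ y ∈ F.contour := by
      induction hg using Subgroup.closure_induction with
      | mem g hg =>
        intro y
        rcases hg with rfl | rfl
        · refine ⟨fun hy => hcl _ (hF.vis_closed (M.cw y) y ?_ (Or.inr hy)),
            fun hy => hcl _ (hF.vis_closed y (M.cw y) ?_ (Or.inr hy))⟩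
          · exact sameCycle_apply_left.2 (SameCycle.refl _ _)
          · exact sameCycle_apply_right.2 (SameCycle.refl _ _)
        · have hfl : ∀ y ∈ F.contour, flip y ∈ F.contour := by
            intro y hy
            rcases hF.exhausted y hy with h4 | h4 | h4
            · exact absurd h4 (Set.notMem_empty y)
            · exact hcl _ (hF.flip_opening hi y h4)
            · exact openings_subset_contour h4
          exact ⟨fun hy => by simpa using hfl _ hy, hfl y⟩
      | one => exact fun y => Iff.rfl
      | mul a b _ _ ha hb => exact fun y => (ha (b y)).trans (hb y)
      | inv a _ ha =>
        intro y
        rw [← ha (a⁻¹ y), ← mul_apply, mul_inv_cancel, one_apply]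
    exact (key _).2 (hvis _ (SameCycle.refl _ _))
  · rcases hF.leaf_label l hl with h4 | h4
    · exact (hi.env_mem _ _ h4.2).2.2
    · exact h4.1.le

end Forest

namespace Forest

open RootedMap (flip)
open Equiv.Perm

variable {E : Type}

/-! ### The exploration of a represented map -/

theorem backs_subset_allBacks {D : Type} {F : Forest D} {x : D} (h : x ∈ F.backs) :
    x ∈ F.allBacks := by
  induction F with
  | nil => simp [backs] at h
  | leaf d j rest ih => exact ih h
  | back d rest ih =>
    simp only [backs, allBacks, List.mem_cons] at h ⊢
    exact h.imp id ih
  | node d sub rest _ ih => exact List.mem_append_right _ (ih h)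

theorem IsDFS.flip_leaf_mem_allBacks {k : ℤ} {pre : List ((E × Bool) × ℤ)}
    {F : Forest (E × Bool)} (h : F.IsDFS k pre) {l : (E × Bool) × ℤ} (hl : l ∈ F.leaves)
    (hk : k ≤ l.2) : flip l.1 ∈ F.allBacks := by
  induction F generalizing pre k with
  | nil => simp [leaves] at hl
  | leaf d j rest ih =>
    simp only [leaves, List.mem_append, List.mem_singleton] at hl
    rcases hl with hl | rfl
    · exact ih h.2.2 hl hk
    · exact backs_subset_allBacks (h.2.1 (le_antisymm h.1 hk))
  | back d rest ih => exact List.mem_cons_of_mem _ (ih h.2 hl hk)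
  | node d sub rest ih1 ih2 =>
    simp only [leaves, List.mem_append, allBacks] at hl ⊢
    rcases hl with hl | hl
    · exact Or.inr (ih2 h.2.2 hl hk)
    · rcases hk.lt_or_eq with hk | hk
      · exact Or.inl (ih1 h.1 hl hk)
      · exact Or.inr (backs_subset_allBacks (h.2.1 l.1 (by rw [hk]; exact hl)))

/-- No edge is explored from both ends. -/
theorem Represents.flip_notMem_openings {M : RootedMap} {F : Forest M.Dart}
    (h : Represents M F) : ∀ x ∈ F.openings, flip x ∉ F.openings := by
  have hn := F.contour_perm.nodup_iff.1 h.nodup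
  simp only [List.nodup_append, List.mem_append, List.mem_map] at hn
  have key : ∀ x ∈ F.treeDarts, flip x ∉ F.openings := by
    intro x hx hfx
    rcases mem_openings_iff.1 hfx with ⟨j, hj⟩ | hfx
    · exact hn.2.2 _ ⟨_, hj, rfl⟩ _ (Or.inr (Or.inr ⟨x, hx, rfl⟩)) rfl
    · exact hn.2.1.2.1.2.2 _ hfx _ ⟨x, hx, rfl⟩ rfl
  intro x hx hfx
  rcases mem_openings_iff.1 hx with ⟨j, hj⟩ | hx'
  · have h1 := h.dfs.flip_leaf_mem_allBacks hj (h.neg_one_le _ hj)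
    rcases mem_openings_iff.1 hfx with ⟨i, hi⟩ | hfx'
    · exact hn.2.2 _ ⟨_, hi, rfl⟩ _ (Or.inl h1) rfl
    · exact hn.2.1.2.2 _ h1 _ (Or.inl hfx') rfl
  · exact key x hx' hfx

theorem tops_sublist_contour (F : Forest (E × Bool)) : F.tops.Sublist F.contour := by
  induction F with
  | nil => exact List.Sublist.refl _
  | leaf d j rest ih => exact ih.cons_cons d
  | back d rest ih => exact ih.cons_cons d
  | node d sub rest _ ih =>
    exact ((ih.trans (List.sublist_cons_self _ _)).trans
      (List.sublist_append_right _ _)).cons_cons d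

theorem IsRotation.mem_contour_of_sameCycle [Finite E] {σ : Equiv.Perm (E × Bool)}
    {F : Forest (E × Bool)} (h : F.IsRotation σ) {d x : E × Bool} (hd : d ∈ F.treeDarts)
    (hx : σ.SameCycle (flip d) x) : x ∈ F.contour := by
  induction F with
  | nil => simp [treeDarts] at hd
  | leaf d' j rest ih => exact List.mem_cons_of_mem _ (ih h hd)
  | back d' rest ih => exact List.mem_cons_of_mem _ (ih h hd)
  | node d' sub rest ih1 ih2 =>
    simp only [treeDarts, List.mem_cons, List.mem_append, contour] at hd ⊢
    rcases hd with rfl | hd | hd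
    · rcases List.mem_cons.1 (h.1.sameCycle_iff.1 hx) with h1 | h1
      · exact Or.inr (Or.inr (Or.inl h1))
      · exact Or.inr (Or.inl (tops_subset_contour h1))
    · exact Or.inr (Or.inl (ih1 h.2.1 hd))
    · exact Or.inr (Or.inr (Or.inr (ih2 h.2.2 hd)))

/-- The exploration along the darts at the vertex of a depth-first forest gives the trees of this
forest, as long as the state agrees with the forest: the edges with first ends in `pre` are used,
the edges explored in the forest are not, the vertices reached by the leaves with labels at most
`k` are visited, and those reached by the tree edges are not. The length of the contour bounds the
number of nested calls. -/
theorem explore_eq {M : RootedMap} {F : Forest M.Dart} {fuel : ℕ} {k : ℤ}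
    {pre : List (M.Dart × ℤ)} {st : ExploreState M.Dart} (hfuel : F.contour.length ≤ fuel)
    (hrot : F.IsRotation M.cw) (hn : F.contour.Nodup) (hdfs : F.IsDFS k pre)
    (hpre : ∀ l ∈ pre, flip l.1 ∈ st.used)
    (hop : ∀ x ∈ F.openings, x ∉ st.used) (hfo : ∀ x ∈ F.openings, flip x ∉ F.openings)
    (hv : ∀ x y, M.cw.SameCycle x y → st.depth x = st.depth y)
    (hleaf : ∀ l ∈ F.leaves, l.2 ≤ k → st.depth (flip l.1) = some l.2)
    (hnode : ∀ d ∈ F.treeDarts, st.depth (flip d) = none) :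
    (M.explore fuel k F.tops st).1 = F.toTrees ∧
      (∀ x, x ∈ (M.explore fuel k F.tops st).2.used ↔
        x ∈ st.used ∨ x ∈ F.openings ∨ flip x ∈ F.openings) ∧
      (∀ x y, M.cw.SameCycle x y → (M.explore fuel k F.tops st).2.depth x =
        (M.explore fuel k F.tops st).2.depth y) ∧
      ∀ x, (∀ d ∈ F.treeDarts, ¬ M.cw.SameCycle (flip d) x) →
        (M.explore fuel k F.tops st).2.depth x = st.depth x := by
  induction F generalizing fuel k pre st with
  | nil => cases fuel <;> simpa [RootedMap.explore, tops, toTrees, openings] using hv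
  | leaf d j rest ih =>
    obtain ⟨fuel, rfl⟩ : ∃ m, fuel = m + 1 := ⟨fuel - 1, by simp [contour] at hfuel; omega⟩
    simp only [contour, List.length_cons, Nat.add_le_add_iff_right] at hfuel
    simp only [openings, List.mem_cons, forall_eq_or_imp, not_or] at hop hfo
    have hd : st.depth (flip d) = some j := hleaf (d, j) (by simp [leaves]) hdfs.1
    obtain ⟨h1, h2, h3, h4⟩ := ih (st := M.markEdge d st) hfuel hrot
      (List.nodup_cons.1 hn).2 hdfs.2.2
      (by
        intro l hl
        simp only [List.mem_append, List.mem_singleton] at hl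
        rcases hl with hl | rfl
        · exact Or.inl (hpre l hl)
        · exact Or.inr (Or.inr rfl))
      (by
        rintro x hx (h1 | rfl | rfl)
        · exact hop.2 x hx h1
        · exact (List.nodup_cons.1 hn).1 (openings_subset_contour hx)
        · exact hfo.1.2 hx)
      (fun x hx => (hfo.2 x hx).2) hv
      (fun l hl => hleaf l (by simp [leaves, hl])) hnode
    simp only [tops, RootedMap.explore]
    rw [if_neg hop.1, hd]
    refine ⟨by simp only [h1, toTrees], fun x => ?_, h3, h4⟩
    refine (h2 x).trans ?_
    have h5 : x ∈ (M.markEdge d st).used ↔ x ∈ st.used ∨ x = d ∨ x = flip d := Iff.rfl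
    rw [h5]
    simp only [openings, List.mem_cons, ← RootedMap.eq_flip_iff (x := x)]
    tauto
  | back d rest ih =>
    obtain ⟨fuel, rfl⟩ : ∃ m, fuel = m + 1 := ⟨fuel - 1, by simp [contour] at hfuel; omega⟩
    simp only [contour, List.length_cons, Nat.add_le_add_iff_right] at hfuel
    have hd : d ∈ st.used := by simpa using hpre _ hdfs.1
    simp only [tops, RootedMap.explore]
    rw [if_pos hd]
    exact ih hfuel hrot (List.nodup_cons.1 hn).2 hdfs.2 hpre hop hfo hv hleaf hnode
  | node d sub rest ih1 ih2 =>
    obtain ⟨fuel, rfl⟩ : ∃ m, fuel = m + 1 := ⟨fuel - 1, by simp [contour] at hfuel; omega⟩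
    simp only [contour, List.length_cons, List.length_append, Nat.add_le_add_iff_right] at hfuel
    simp only [openings, List.mem_cons, List.mem_append, forall_eq_or_imp, not_or] at hop hfo
    simp only [treeDarts, List.mem_cons, List.mem_append, forall_eq_or_imp] at hnode
    simp only [contour, List.nodup_cons, List.nodup_append, List.mem_append, List.mem_cons,
      not_or] at hn
    obtain ⟨⟨n1, n2, n3⟩, n4, ⟨n5, n6⟩, n7⟩ := hn
    obtain ⟨hc, hr1, hr2⟩ := hrot
    have hfd : flip d ∉ sub.contour := fun h => n7 _ h _ (Or.inl rfl) rfl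
    have htail : (M.around (flip d)).tail = sub.tops := by
      rw [RootedMap.around_eq hc (List.nodup_cons.2 ⟨fun h => hfd (tops_subset_contour h),
        (tops_sublist_contour sub).nodup n4⟩)]
      rfl
    have hsome : ∀ x j, st.depth x = some j → ¬ M.cw.SameCycle (flip d) x ∧
        ∀ d' ∈ sub.treeDarts, ¬ M.cw.SameCycle (flip d') x := by
      intro x j hx
      refine ⟨fun h => ?_, fun d' hd' h => ?_⟩
      · rw [← hv _ _ h, hnode.1] at hx; simp at hx
      · rw [← hv _ _ h, hnode.2 d' (Or.inl hd')] at hx; simp at hx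
    let st₁ := M.visit (flip d) (k + 1) (M.markEdge d st)
    have hin : ∀ x, M.cw.SameCycle (flip d) x → st₁.depth x = some (k + 1) := fun x hx =>
      if_pos (RootedMap.origin_eq_iff_sameCycle.2 hx.symm)
    have hout : ∀ x, ¬ M.cw.SameCycle (flip d) x → st₁.depth x = st.depth x := fun x hx =>
      if_neg fun h => hx (RootedMap.origin_eq_iff_sameCycle.1 h).symm
    have hu₁ : ∀ x, x ∈ st₁.used ↔ x ∈ st.used ∨ x = d ∨ x = flip d := fun x => Iff.rfl
    obtain ⟨a1, a2, a3, a4⟩ := ih1 (st := st₁) (k := k + 1) (fuel := fuel) (by omega) hr1 n4 hdfs.1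
      (by simp)
      (by
        intro x hx
        rw [hu₁]
        rintro (h1 | rfl | rfl)
        · exact hop.2 x (Or.inl hx) h1
        · exact n1 (openings_subset_contour hx)
        · exact hfd (openings_subset_contour hx))
      (fun x hx => (hfo.2 x (Or.inl hx)).2.1)
      (by
        intro x y hxy
        by_cases hx : M.cw.SameCycle (flip d) x
        · rw [hin x hx, hin y (hx.trans hxy)]
        · rw [hout x hx, hout y fun hy => hx (hy.trans hxy.symm), hv x y hxy])
      (by
        intro l hl hlk
        rcases hlk.lt_or_eq with hlk | hlk
        · have h1 := hleaf l (by simp [leaves, hl]) (by omega)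
          rw [hout _ (hsome _ _ h1).1, h1]
        · have h1 := hdfs.1.flip_leaf_mem_backs (x := l.1) (by rw [← hlk]; exact hl)
          rw [hin _ (hc.sameCycle_iff.2 (List.mem_cons_of_mem _ (backs_subset_tops h1))), hlk])
      (by
        intro d' hd'
        rw [hout, hnode.2 d' (Or.inl hd')]
        intro h
        rcases List.mem_cons.1 (hc.sameCycle_iff.1 h) with h1 | h1
        · rw [flip.injective h1] at hd'
          exact n1 (mem_contour_iff.2 (by simp [hd']))
        · exact flip_treeDart_notMem_tops n4 hd' h1)
    have hsub : ∀ d' ∈ rest.treeDarts, flip d' ∈ rest.contour := fun d' hd' =>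
      mem_contour_iff.2 (by simp [hd'])
    set st₂ := (M.explore fuel (k + 1) sub.tops st₁).2 with hst₂
    have hdep : ∀ x, ¬ M.cw.SameCycle (flip d) x →
        (∀ d' ∈ sub.treeDarts, ¬ M.cw.SameCycle (flip d') x) → st₂.depth x = st.depth x :=
      fun x h1 h2 => (a4 x h2).trans (hout x h1)
    obtain ⟨b1, b2, b3, b4⟩ := ih2 (st := st₂) (k := k) (fuel := fuel) (by omega) hr2 n6 hdfs.2.2
      (by
        intro l hl
        rw [a2, hu₁]
        rcases List.mem_append.1 hl with hl | hl
        · exact Or.inl (Or.inl (hpre l hl))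
        · refine Or.inr (Or.inr ?_)
          rw [RootedMap.flip_flip]
          exact mem_openings_iff.2 (Or.inl ⟨l.2, hl⟩))
      (by
        intro x hx
        rw [a2, hu₁]
        rintro ((h1 | rfl | rfl) | h1 | h1)
        · exact hop.2 x (Or.inr hx) h1
        · exact n3 (openings_subset_contour hx)
        · exact n5 (openings_subset_contour hx)
        · exact n7 x (openings_subset_contour h1) _ (Or.inr (openings_subset_contour hx)) rfl
        · exact (hfo.2 x (Or.inr hx)).2.1 h1)
      (fun x hx => (hfo.2 x (Or.inr hx)).2.2) a3
      (by
        intro l hl hlk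
        have h1 := hleaf l (by simp [leaves, hl]) hlk
        rw [hdep _ (hsome _ _ h1).1 (hsome _ _ h1).2, h1])
      (by
        intro d' hd'
        rw [hdep _ _ _, hnode.2 d' (Or.inr hd')]
        · intro h
          rcases List.mem_cons.1 (hc.sameCycle_iff.1 h) with h1 | h1
          · exact n5 (h1 ▸ hsub d' hd')
          · exact n7 _ (tops_subset_contour h1) _ (Or.inr (hsub d' hd')) rfl
        · intro d'' hd'' h
          exact n7 _ (hr1.mem_contour_of_sameCycle hd'' h) _ (Or.inr (hsub d' hd')) rfl)
    simp only [tops, RootedMap.explore]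
    rw [if_neg hop.1, hnode.1, htail]
    refine ⟨by simp only [toTrees, ← b1, ← a1]; rfl, fun x => ?_, b3, fun x hx => ?_⟩
    · refine (b2 x).trans ?_
      rw [a2, hu₁]
      simp only [openings, List.mem_cons, List.mem_append, ← RootedMap.eq_flip_iff (x := x)]
      tauto
    · simp only [treeDarts, List.mem_cons, List.mem_append, forall_eq_or_imp] at hx
      exact (b4 x fun d' hd' => hx.2 d' (Or.inr hd')).trans
        (hdep x hx.1 fun d' hd' => hx.2 d' (Or.inl hd'))

theorem Represents.explorationForest_eq {M : RootedMap} {F : Forest M.Dart}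
    (h : Represents M F) : M.explorationForest = F.toTrees := by
  obtain ⟨l, hl, hc⟩ := h.rootRotation
  have hlen : F.contour.length ≤ Nat.card M.Dart := by
    have := Fintype.ofFinite M.Dart
    rw [Nat.card_eq_fintype_card]
    exact h.nodup.length_le_card
  have hat : M.around M.root = F.tops := by
    rw [hl]
    exact RootedMap.around_eq hc (by rw [← hl]; exact (tops_sublist_contour F).nodup h.nodup)
  have hin : ∀ x, M.cw.SameCycle M.root x →
      (M.visit M.root (-1) ⟨fun _ => none, ∅⟩).depth x = some (-1) := fun x hx =>
    if_pos (RootedMap.origin_eq_iff_sameCycle.2 hx.symm)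
  have hout : ∀ x, ¬ M.cw.SameCycle M.root x →
      (M.visit M.root (-1) ⟨fun _ => none, ∅⟩).depth x = none := fun x hx =>
    if_neg fun h => hx (RootedMap.origin_eq_iff_sameCycle.1 h).symm
  have hcyc : ∀ x, M.cw.SameCycle M.root x ↔ x ∈ F.tops := fun x => by
    rw [hl, hc.sameCycle_iff]
  rw [RootedMap.explorationForest, hat]
  refine (explore_eq hlen h.rotation h.nodup h.dfs (by simp)
    (fun x _ hx => Set.notMem_empty x hx) h.flip_notMem_openings ?_ ?_ ?_).1
  · intro x y hxy
    by_cases hx : M.cw.SameCycle M.root x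
    · rw [hin x hx, hin y (hx.trans hxy)]
    · rw [hout x hx, hout y fun hy => hx (hy.trans hxy.symm)]
  · intro l hl hlk
    have h1 : l.2 = -1 := le_antisymm hlk (h.neg_one_le l hl)
    have h2 := h.dfs.flip_leaf_mem_backs (x := l.1) (by rw [← h1]; exact hl)
    rw [hin _ ((hcyc _).2 (backs_subset_tops h2)), h1]
  · intro d hd
    exact hout _ fun h1 => flip_treeDart_notMem_tops h.nodup hd ((hcyc _).1 h1)

end Forest

namespace Forest

open RootedMap (flip)
open Equiv.Perm

/-! ### Maps with the same tree -/

/-- The forest obtained by applying a function to all darts. -/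
def map {D D' : Type} (f : D → D') : Forest D → Forest D'
  | nil => nil
  | leaf d j rest => leaf (f d) j (rest.map f)
  | back d rest => back (f d) (rest.map f)
  | node d sub rest => node (f d) (sub.map f) (rest.map f)

section Map

variable {D D' : Type} (f : D → D')

theorem tops_map (F : Forest D) : (F.map f).tops = F.tops.map f := by
  induction F <;> simp_all [map, tops]

theorem leaves_map (F : Forest D) :
    (F.map f).leaves = F.leaves.map (fun l => (f l.1, l.2)) := by
  induction F <;> simp_all [map, leaves]

end Map

variable {E E' : Type} {f : E × Bool → E' × Bool}

theorem contour_map (hf : ∀ x, f (flip x) = flip (f x)) (F : Forest (E × Bool)) :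
    (F.map f).contour = F.contour.map f := by
  induction F with
  | nil => rfl
  | leaf d j rest ih => simp only [map, contour, ih, List.map_cons]
  | back d rest ih => simp only [map, contour, ih, List.map_cons]
  | node d sub rest ih1 ih2 =>
    simp only [map, contour, ih1, ih2, List.map_cons, List.map_append, hf]

theorem closings_map (hf : ∀ x, f (flip x) = flip (f x)) (k : ℤ) (F : Forest (E × Bool)) :
    (F.map f).closings k = (F.closings k).map f := by
  simp only [closings, leaves_map, List.filter_map, List.map_map]
  congr 1
  funext l
  exact (hf l.1).symm

/-- The trees have one edge for each explored edge. -/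
theorem length_openings {D : Type} (F : Forest D) :
    F.openings.length = (F.toTrees.map (fun t => t.numEdges + 1)).sum := by
  induction F with
  | nil => rfl
  | leaf d j rest ih => simp [openings, toTrees, ih, PTree.numEdges]
  | back d rest ih => exact ih
  | node d sub rest ih1 ih2 =>
    simp only [openings, toTrees, List.length_cons, List.length_append, ih1, ih2, List.map_append,
      List.map_cons, List.map_nil, List.sum_append, List.sum_cons, List.sum_nil, PTree.numEdges]
    omega

/-- A forest with the second ends at the prescribed places is determined by its trees and by the
darts along which edges are explored. -/
theorem map_eq_of_isTight (hf : ∀ x, f (flip x) = flip (f x))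
    {F : Forest (E × Bool)} {G : Forest (E' × Bool)} {k : ℤ}
    (hF : F.IsTight k) (hG : G.IsTight k) (ht : F.toTrees = G.toTrees)
    (hi : F.initialBacks.map f = G.initialBacks) (ho : F.openings.map f = G.openings) :
    F.map f = G := by
  induction F generalizing G k with
  | nil =>
    cases G with
    | nil => rfl
    | leaf => simp [toTrees] at ht
    | back => simp [initialBacks] at hi
    | node => simp [toTrees] at ht
  | back d rest ih =>
    cases G with
    | nil => simp [initialBacks] at hi
    | leaf => simp [initialBacks] at hi
    | node => simp [initialBacks] at hi
    | back d' rest' =>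
      simp only [initialBacks, List.map_cons, List.cons.injEq] at hi
      rw [map, ih (G := rest') hF hG ht hi.2 ho, hi.1]
  | leaf d j rest ih =>
    cases G with
    | nil => simp [toTrees] at ht
    | back => simp [initialBacks] at hi
    | node => simp [toTrees] at ht
    | leaf d' j' rest' =>
      simp only [toTrees] at ht
      have ht := List.append_inj' ht rfl
      simp only [openings, List.map_cons, List.cons.injEq, PTree.leaf.injEq, and_true] at ho ht
      rw [map, ih hF.2 hG.2 ht.1 (by rw [hF.1, hG.1]; rfl) ho.2, ho.1, ht.2]
  | node d sub rest ih1 ih2 =>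
    cases G with
    | nil => simp [toTrees] at ht
    | back => simp [initialBacks] at hi
    | leaf => simp [toTrees] at ht
    | node d' sub' rest' =>
      simp only [toTrees] at ht
      have ht := List.append_inj' ht rfl
      simp only [openings, List.map_cons, List.cons.injEq, PTree.node.injEq, and_true,
        List.map_append] at ho ht
      obtain ⟨ho1, ho2⟩ := List.append_inj ho.2
        (by rw [List.length_map, length_openings, length_openings, ht.2])
      obtain ⟨f1, f2, f3, f4⟩ := hF
      obtain ⟨g1, g2, g3, g4⟩ := hG
      have h1 := ih1 f3 g3 ht.2 (by rw [f1, g1]; rfl) ho1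
      have h2 := ih2 f4 g4 ht.1 (by rw [f2, g2, ← closings_map hf, h1]) ho2
      rw [map, h1, h2, ho.1]

/-- A map from one cycle onto another commutes with the permutations along them. -/
theorem _root_.Equiv.Perm.IsCycList.map_apply {α β : Type*} {σ : Equiv.Perm α}
    {τ : Equiv.Perm β} {f : α → β} {a : α} {l : List α} (h : σ.IsCycList a l)
    (h' : τ.IsCycList (f a) (l.map f)) : ∀ x ∈ a :: l, τ (f x) = f (σ x) := by
  have key : ∀ (l : List α) (a b : α), List.IsChain (fun x y => σ x = y) (a :: (l ++ [b])) →
      List.IsChain (fun x y => τ x = y) (f a :: (l.map f ++ [f b])) →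
      ∀ x ∈ a :: l, τ (f x) = f (σ x) := by
    intro l
    induction l with
    | nil =>
      intro a b h h' x hx
      simp only [List.nil_append, List.isChain_cons_cons, List.map_nil, List.mem_singleton] at *
      rw [hx, h.1, h'.1]
    | cons c l ih =>
      intro a b h h' x hx
      simp only [List.cons_append, List.map_cons, List.isChain_cons_cons (a := a) (b := c),
        List.isChain_cons_cons (a := f a) (b := f c)] at h h'
      rcases List.mem_cons.1 hx with rfl | hx
      · rw [h.1, h'.1]
      · exact ih c b h.2 h'.2 x hx
  exact key l a a h h'

theorem IsRotation.map_apply (hf : ∀ x, f (flip x) = flip (f x))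
    {σ : Equiv.Perm (E × Bool)} {τ : Equiv.Perm (E' × Bool)}
    {F : Forest (E × Bool)} (h : F.IsRotation σ) (h' : (F.map f).IsRotation τ)
    (htop : ∀ x ∈ F.tops, τ (f x) = f (σ x)) : ∀ x ∈ F.contour, τ (f x) = f (σ x) := by
  induction F with
  | nil => simp [contour]
  | leaf d j rest ih =>
    simp only [tops, contour, List.mem_cons, forall_eq_or_imp] at htop ⊢
    exact ⟨htop.1, ih h h' htop.2⟩
  | back d rest ih =>
    simp only [tops, contour, List.mem_cons, forall_eq_or_imp] at htop ⊢
    exact ⟨htop.1, ih h h' htop.2⟩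
  | node d sub rest ih1 ih2 =>
    simp only [tops, contour, List.mem_cons, List.mem_append, forall_eq_or_imp] at htop ⊢
    obtain ⟨h1, h2, h3⟩ := h
    obtain ⟨h4, h5, h6⟩ := h'
    rw [tops_map, ← hf] at h4
    have h7 := h1.map_apply h4
    refine ⟨htop.1, ?_⟩
    rintro x (hx | rfl | hx)
    · exact ih1 h2 h5 (fun x hx => h7 x (List.mem_cons_of_mem _ hx)) x hx
    · exact h7 _ List.mem_cons_self
    · exact ih2 h3 h6 htop.2 x hx

theorem openings_sublist_contour (F : Forest (E × Bool)) : F.openings.Sublist F.contour := by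
  induction F with
  | nil => exact List.Sublist.refl _
  | leaf d j rest ih => exact ih.cons_cons d
  | back d rest ih => exact ih.cons d
  | node d sub rest ih1 ih2 => exact (ih1.append (ih2.cons _)).cons_cons d

/-- Represented maps are isomorphic if their forests correspond to each other. -/
theorem Represents.nonempty_iso {M N : RootedMap} {F : Forest M.Dart} {f : M.Dart → N.Dart}
    (hf : ∀ x, f (flip x) = flip (f x)) (hM : Represents M F) (hN : Represents N (F.map f)) :
    Nonempty (RootedMap.Iso M N) := by
  have hn := hN.nodup
  have hm := hN.mem
  rw [contour_map hf] at hn hm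
  have hbij : Function.Bijective f := by
    refine ⟨fun x y hxy => ?_, fun y => ?_⟩
    · exact List.inj_on_of_nodup_map hn (hM.mem x) (hM.mem y) hxy
    · obtain ⟨x, -, hx⟩ := List.mem_map.1 (hm y)
      exact ⟨x, hx⟩
  obtain ⟨l, hl, hc⟩ := hM.rootRotation
  obtain ⟨l', hl', hc'⟩ := hN.rootRotation
  rw [tops_map, hl, List.map_cons, List.cons.injEq] at hl'
  obtain ⟨hroot, rfl⟩ := hl'
  rw [← hroot] at hc'
  have hcw := hM.rotation.map_apply hf hN.rotation (by rw [hl]; exact hc.map_apply hc')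
  exact ⟨⟨Equiv.ofBijective f hbij, hf, fun d => (hcw d (hM.mem d)).symm, hroot⟩⟩

/-- A represented map is determined by its trees, if the second ends are at the prescribed
places. -/
theorem Represents.nonempty_iso_of_toTrees_eq {M N : RootedMap} {F : Forest M.Dart}
    {G : Forest N.Dart} (hM : Represents M F) (hN : Represents N G) (hF : F.IsTight (-1))
    (hG : G.IsTight (-1)) (ht : F.toTrees = G.toTrees) (ho : ∀ x ∈ F.openings, x.2 = true) :
    Nonempty (RootedMap.Iso M N) := by
  classical
  -- The edges correspond in the order of the exploration. In `F` they are explored along the darts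
  -- `(e, true)`, so that it is enough to say where these go.
  let g : M.E → N.Dart := fun e => G.openings.getD (F.openings.idxOf (e, true)) N.root
  let f : M.Dart → N.Dart := fun x => if x.2 then g x.1 else flip (g x.1)
  have hf : ∀ x, f (flip x) = flip (f x) := by
    rintro ⟨e, b⟩
    cases b <;> simp [f]
  have hlen : F.openings.length = G.openings.length := by
    rw [length_openings, length_openings, ht]
  have hmap : F.map f = G := by
    refine map_eq_of_isTight hf hF hG ht
      (by rw [hM.dfs.initialBacks_eq_nil, hN.dfs.initialBacks_eq_nil]; rfl) ?_
    refine List.ext_getElem (by simpa using hlen) fun i h1 h2 => ?_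
    have h3 : i < F.openings.length := by simpa using h1
    have h4 := ho _ (List.getElem_mem h3)
    have h5 : F.openings[i] = (F.openings[i].1, true) := Prod.ext rfl h4
    have h6 : F.openings.idxOf F.openings[i] = i :=
      ((openings_sublist_contour F).nodup hM.nodup).idxOf_getElem _ _
    simp only [List.getElem_map, f, h4, if_true, g]
    rw [← h5, h6, List.getD_eq_getElem _ _ h2]
  rw [← hmap] at hN
  exact hM.nonempty_iso hf hN

end Forest

/-! ### Decorated trees -/

namespace PTree

theorem at?_nil (t : PTree) : t.at? [] = some t := by
  cases t <;> rfl

theorem at?_node_cons (cs : List PTree) (i : ℕ) (p : List ℕ) :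
    (node cs).at? (i :: p) = cs[i]?.bind (fun c => c.at? p) := by
  rw [at?]

theorem at?_leaf_eq_node {z : ℤ} {p : List ℕ} {cs : List PTree} :
    (leaf z).at? p ≠ some (node cs) := by
  cases p <;> simp [at?]

theorem at?_append (p q : List ℕ) (t : PTree) :
    t.at? (p ++ q) = (t.at? p).bind (fun c => c.at? q) := by
  induction p generalizing t with
  | nil => simp [at?_nil]
  | cons i p ih =>
    cases t with
    | leaf z => simp [at?]
    | node cs =>
      rw [List.cons_append, at?_node_cons, at?_node_cons]
      cases cs[i]? with
      | none => rfl
      | some c => exact ih c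

theorem at?_concat_eq_some {t c : PTree} {p : List ℕ} {i : ℕ} :
    t.at? (p ++ [i]) = some c ↔ ∃ cs, t.at? p = some (node cs) ∧ cs[i]? = some c := by
  rw [at?_append]
  cases h : t.at? p with
  | none => simp
  | some s =>
    cases s with
    | leaf z => simp [at?]
    | node cs =>
      simp only [Option.bind_some, at?_node_cons, Option.some_inj, node.injEq, exists_eq_left']
      cases cs[i]? <;> simp [at?_nil]

theorem leafLabels_node (cs : List PTree) : (node cs).leafLabels = cs.flatMap leafLabels := by
  rw [leafLabels, List.flatMap_def]

theorem leafLabels_subset {t s : PTree} {p : List ℕ} (h : t.at? p = some s) :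
    ∀ z ∈ s.leafLabels, z ∈ t.leafLabels := by
  induction p generalizing t with
  | nil =>
    rw [at?_nil, Option.some_inj] at h
    rw [h]
    exact fun z hz => hz
  | cons i p ih =>
    cases t with
    | leaf z => simp [at?] at h
    | node cs =>
      rw [at?_node_cons, Option.bind_eq_some_iff] at h
      obtain ⟨c, hc, h⟩ := h
      intro z hz
      rw [leafLabels_node, List.mem_flatMap]
      exact ⟨c, List.mem_of_getElem? hc, ih h z hz⟩

/-- The local conditions at the nodes of a tree whose root has depth `d`. -/
def NodesDecorated (d : ℤ) (t : PTree) : Prop :=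
  ∀ p cs, t.at? p = some (node cs) → cs ≠ [] ∧ (∀ z, leaf z ∈ cs → -1 ≤ z ∧ z < d + p.length) ∧
    (0 < d + p.length → ∃ z ∈ (node cs).leafLabels, z ≤ d + p.length - 2) ∧
    ∀ c ∈ cs, c.leafLabels.Pairwise (fun a b => b = d + p.length → d + p.length ≤ a)

theorem nodesDecorated_leaf (d z : ℤ) : NodesDecorated d (leaf z) :=
  fun _ _ h => absurd h at?_leaf_eq_node

theorem nodesDecorated_node {d : ℤ} {cs : List PTree} :
    NodesDecorated d (node cs) ↔ cs ≠ [] ∧ (∀ z, leaf z ∈ cs → -1 ≤ z ∧ z < d) ∧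
      (0 < d → ∃ z ∈ (node cs).leafLabels, z ≤ d - 2) ∧
      (∀ c ∈ cs, c.leafLabels.Pairwise (fun a b => b = d → d ≤ a)) ∧
      ∀ c ∈ cs, NodesDecorated (d + 1) c := by
  constructor
  · intro h
    have h0 := h [] cs (at?_nil _)
    simp only [List.length_nil, Nat.cast_zero, add_zero] at h0
    refine ⟨h0.1, h0.2.1, h0.2.2.1, h0.2.2.2, fun c hc p cs' hp => ?_⟩
    obtain ⟨i, hi, rfl⟩ := List.mem_iff_getElem.1 hc
    have h1 := h (i :: p) cs' (by rw [at?_node_cons, List.getElem?_eq_getElem hi]; exact hp)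
    have e : d + ((i :: p).length : ℤ) = d + 1 + p.length := by
      push_cast [List.length_cons]; ring
    rwa [e] at h1
  · rintro ⟨h1, h2, h3, h4, h5⟩ p cs' hp
    cases p with
    | nil =>
      rw [at?_nil, Option.some_inj, node.injEq] at hp
      subst hp
      simp only [List.length_nil, Nat.cast_zero, add_zero]
      exact ⟨h1, h2, h3, h4⟩
    | cons i p =>
      rw [at?_node_cons, Option.bind_eq_some_iff] at hp
      obtain ⟨c, hc, hp⟩ := hp
      have h6 := h5 c (List.mem_of_getElem? hc) p cs' hp
      have e : d + ((i :: p).length : ℤ) = d + 1 + p.length := by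
        push_cast [List.length_cons]; ring
      rwa [e]

theorem exists_leaf_of_mem_leafLabels {t : PTree} {z : ℤ} (h : z ∈ t.leafLabels) :
    ∃ p, t.at? p = some (leaf z) := by
  match t with
  | leaf y =>
    rw [leafLabels, List.mem_singleton] at h
    exact ⟨[], by rw [h]; rfl⟩
  | node cs =>
    rw [leafLabels_node, List.mem_flatMap] at h
    obtain ⟨c, hc, hz⟩ := h
    obtain ⟨p, hp⟩ := exists_leaf_of_mem_leafLabels hz
    obtain ⟨i, hi, rfl⟩ := List.mem_iff_getElem.1 hc
    exact ⟨i :: p, by rw [at?_node_cons, List.getElem?_eq_getElem hi]; exact hp⟩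

theorem pairwise_iff_forall_split {d : ℤ} {l : List ℤ} :
    l.Pairwise (fun a b => b = d → d ≤ a) ↔
      ∀ l₁ l₂ : List ℤ, l = l₁ ++ d :: l₂ → ∀ y ∈ l₁, d ≤ y := by
  constructor
  · rintro h l₁ l₂ rfl y hy
    exact (List.pairwise_append.1 h).2.2 y hy d List.mem_cons_self rfl
  · intro h
    induction l with
    | nil => exact List.Pairwise.nil
    | cons a l ih =>
      refine List.pairwise_cons.2 ⟨?_, ih fun l₁ l₂ e y hy =>
        h (a :: l₁) l₂ (by rw [e]; rfl) y (List.mem_cons_of_mem _ hy)⟩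
      rintro b hb rfl
      obtain ⟨l₁, l₂, rfl⟩ := List.append_of_mem hb
      exact h (a :: l₁) l₂ rfl a List.mem_cons_self

theorem isDecorated_iff {cs : List PTree} :
    (node cs).IsDecorated ↔ NodesDecorated 0 (node cs) := by
  constructor
  · intro h p cs' hp
    simp only [zero_add]
    refine ⟨fun e => h.children_ne_nil p (by rw [hp, e]), fun z hz => ?_,
      fun h0 => h.exists_le p cs' hp (by exact_mod_cast h0),
      fun c hc => pairwise_iff_forall_split.2 (h.le_of_before p cs' hp c hc)⟩
    obtain ⟨i, hi, hiz⟩ := List.mem_iff_getElem.1 hz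
    refine ⟨h.neg_one_le z (leafLabels_subset hp z ?_), h.label_lt p i z ?_⟩
    · rw [leafLabels_node, List.mem_flatMap]
      exact ⟨_, hz, by simp [leafLabels]⟩
    · rw [at?_concat_eq_some]
      exact ⟨cs', hp, by rw [List.getElem?_eq_getElem hi, hiz]⟩
  · intro h
    simp only [NodesDecorated, zero_add] at h
    have hleaf : ∀ p i z, (node cs).at? (p ++ [i]) = some (leaf z) →
        -1 ≤ z ∧ z < (p.length : ℤ) := by
      intro p i z hz
      obtain ⟨cs', hp, hi⟩ := at?_concat_eq_some.1 hz
      exact (h p cs' hp).2.1 z (List.mem_of_getElem? hi)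
    refine ⟨fun p hp => (h p [] hp).1 rfl, fun z hz => ?_, fun p i z hz => (hleaf p i z hz).2,
      fun p cs' hp h0 => (h p cs' hp).2.2.1 (by exact_mod_cast h0),
      fun p cs' hp c hc => pairwise_iff_forall_split.1 ((h p cs' hp).2.2.2 c hc)⟩
    obtain ⟨p, hp⟩ := exists_leaf_of_mem_leafLabels hz
    rcases List.eq_nil_or_concat' p with rfl | ⟨q, i, rfl⟩
    · simp [at?] at hp
    · exact (hleaf q i z hp).1

end PTree

namespace Forest

open PTree

theorem leaves_map_snd {D : Type} (F : Forest D) :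
    F.leaves.map Prod.snd = F.toTrees.flatMap leafLabels := by
  induction F with
  | nil => rfl
  | leaf d j rest ih => simp [leaves, toTrees, ih, leafLabels]
  | back d rest ih => exact ih
  | node d sub rest ih1 ih2 => simp [leaves, toTrees, ih1, ih2, leafLabels_node]

theorem isDecorated_iff_forall {D : Type} {F : Forest D} {k : ℤ} :
    F.IsDecorated k ↔ ∀ c ∈ F.toTrees, (∀ z, c = PTree.leaf z → -1 ≤ z ∧ z < k) ∧
      c.leafLabels.Pairwise (fun a b => b = k → k ≤ a) ∧ NodesDecorated (k + 1) c := by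
  induction F generalizing k with
  | nil => simp [IsDecorated, toTrees]
  | leaf d j rest ih =>
    simp only [IsDecorated, ih, toTrees, List.mem_append, List.mem_singleton]
    constructor
    · rintro ⟨h1, h2, h3⟩ c (hc | rfl)
      · exact h3 c hc
      · refine ⟨?_, by simp [leafLabels], nodesDecorated_leaf _ _⟩
        rintro z ⟨⟩
        exact ⟨h1, h2⟩
    · intro h
      have h1 := (h _ (Or.inr rfl)).1 j rfl
      exact ⟨h1.1, h1.2, fun c hc => h c (Or.inl hc)⟩
  | back d rest ih => exact ih
  | node d sub rest ih1 ih2 =>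
    have hpw : (PTree.node sub.toTrees).leafLabels.Pairwise (fun a b => b = k → k ≤ a) ↔
        sub.leaves.Pairwise (fun a b => b.2 = k → k ≤ a.2) := by
      rw [leafLabels_node, ← leaves_map_snd, List.pairwise_map]
    have hex : (0 < k + 1 → ∃ z ∈ (PTree.node sub.toTrees).leafLabels, z ≤ k + 1 - 2) ↔
        (0 ≤ k → ∃ l ∈ sub.leaves, l.2 ≤ k - 1) := by
      rw [leafLabels_node, ← leaves_map_snd]
      simp only [List.mem_map, exists_exists_and_eq_and]
      rw [Int.lt_add_one_iff, show k + 1 - 2 = k - 1 by ring]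
    simp only [IsDecorated, ih1, ih2, toTrees, List.mem_append, List.mem_singleton, ← hpw, ← hex]
    constructor
    · rintro ⟨h1, h2, h3, h4, h5⟩ c (hc | rfl)
      · exact h5 c hc
      · refine ⟨by simp, h2, nodesDecorated_node.2 ⟨h3, ?_, h1, fun c hc => (h4 c hc).2.1,
          fun c hc => (h4 c hc).2.2⟩⟩
        exact fun z hz => (h4 _ hz).1 z rfl
    · intro h
      obtain ⟨-, h2, h3⟩ := h _ (Or.inr rfl)
      obtain ⟨h4, h5, h6, h7, h8⟩ := nodesDecorated_node.1 h3
      exact ⟨h6, h2, h4, fun c hc => ⟨fun z hz => h5 z (hz ▸ hc), h7 c hc, h8 c hc⟩,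
        fun c hc => h c (Or.inl hc)⟩

/-- The conditions on forests express the conditions on decorated trees. -/
theorem isDecorated_node_iff {D : Type} {F : Forest D} :
    (PTree.node F.toTrees).IsDecorated ↔ F.toTrees ≠ [] ∧ F.IsDecorated 0 := by
  rw [PTree.isDecorated_iff, nodesDecorated_node, isDecorated_iff_forall]
  constructor
  · rintro ⟨h1, h2, -, h3, h4⟩
    exact ⟨h1, fun c hc => ⟨fun z hz => h2 z (hz ▸ hc), h3 c hc, h4 c hc⟩⟩
  · rintro ⟨h1, h2⟩
    exact ⟨h1, fun z hz => (h2 _ hz).1 z rfl, fun h => absurd h (lt_irrefl _),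
      fun c hc => (h2 c hc).2.1, fun c hc => (h2 c hc).2.2⟩

end Forest

/-! ### The forest of a plane tree -/

namespace PTree

/-- Induction on plane trees, adding one last child at a time. -/
theorem concat_induction {motive : PTree → Prop} (leaf : ∀ z, motive (leaf z))
    (nil : motive (node [])) (concat : ∀ cs c, motive (node cs) → motive c →
      motive (node (cs ++ [c]))) : ∀ t, motive t
  | .leaf z => leaf z
  | node cs => by
    have h : ∀ c ∈ cs, motive c := fun c hc => concat_induction leaf nil concat c
    induction cs using List.reverseRecOn with
    | nil => exact nil
    | append_singleton cs c ih =>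
      exact concat cs c (ih fun c hc => h c (by simp [hc])) (h c (by simp))

theorem nodes_nil : (node []).nodes = [[]] := by
  simp [nodes]

theorem nodes_concat (cs : List PTree) (c : PTree) :
    (node (cs ++ [c])).nodes = (node cs).nodes ++ c.nodes.map (cs.length :: ·) := by
  simp [nodes, List.mapIdx_append]

theorem lt_of_cons_mem_nodes {cs : List PTree} {i : ℕ} {p : List ℕ}
    (h : i :: p ∈ (node cs).nodes) : i < cs.length := by
  rw [mem_nodes_iff, at?_node_cons] at h
  by_contra hi
  rw [List.getElem?_eq_none (by omega)] at h
  simp at h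

theorem nodup_nodes (t : PTree) : t.nodes.Nodup := by
  induction t using concat_induction with
  | leaf z => simp [nodes]
  | nil => simp [nodes]
  | concat cs c h1 h2 =>
    rw [nodes_concat]
    refine h1.append (h2.map fun a b h => (List.cons.inj h).2) ?_
    intro p hp hp'
    obtain ⟨q, -, rfl⟩ := List.mem_map.1 hp'
    exact absurd (lt_of_cons_mem_nodes hp) (lt_irrefl _)

theorem numEdges_concat (cs : List PTree) (c : PTree) :
    (node (cs ++ [c])).numEdges = (node cs).numEdges + (c.numEdges + 1) := by
  simp [numEdges]

theorem length_nodes (t : PTree) : t.nodes.length = t.numEdges + 1 := by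
  induction t using concat_induction with
  | leaf z => simp [nodes, numEdges]
  | nil => simp [nodes, numEdges]
  | concat cs c h1 h2 =>
    rw [nodes_concat, numEdges_concat, List.length_append, List.length_map, h1, h2]
    omega

theorem at?_concat_of_mem {cs : List PTree} {c : PTree} {p : List ℕ} (hp : p ∈ (node cs).nodes)
    (hne : p ≠ []) : (node (cs ++ [c])).at? p = (node cs).at? p := by
  cases p with
  | nil => exact absurd rfl hne
  | cons i p =>
    rw [at?_node_cons, at?_node_cons, List.getElem?_append_left (lt_of_cons_mem_nodes hp)]

theorem at?_concat_cons (cs : List PTree) (c : PTree) (p : List ℕ) :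
    (node (cs ++ [c])).at? (cs.length :: p) = c.at? p := by
  simp [at?_node_cons]

/-- The vertices below a given one are consecutive in the preorder. -/
theorem filter_prefix_nodes {t s : PTree} {p : List ℕ} (h : t.at? p = some s) :
    t.nodes.filter (fun q => p <+: q) = s.nodes.map (p ++ ·) := by
  induction p generalizing t with
  | nil =>
    rw [at?_nil, Option.some_inj] at h
    simp [h]
  | cons i p ih =>
    cases t with
    | leaf z => simp [at?] at h
    | node cs =>
      have key : ∀ cs : List PTree, ∀ c, cs[i]? = some c →
          (node cs).nodes.filter (fun q => i :: p <+: q) =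
            (c.nodes.filter (fun q => p <+: q)).map (i :: ·) := by
        intro cs
        induction cs using List.reverseRecOn with
        | nil => simp
        | append_singleton cs d ih2 =>
          intro c hc
          rw [nodes_concat, List.filter_append, List.filter_map]
          rcases lt_trichotomy i cs.length with hi | hi | hi
          · rw [List.getElem?_append_left hi] at hc
            rw [ih2 c hc, List.append_right_eq_self, List.map_eq_nil_iff, List.filter_eq_nil_iff]
            intro q _
            simp only [Function.comp_apply, List.cons_prefix_cons, decide_eq_true_eq]
            omega
          · subst hi
            simp only [List.getElem?_concat_length, Option.some_inj] at hc
            subst hc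
            rw [List.filter_eq_nil_iff.2, List.nil_append]
            · congr 2
              funext q
              simp
            · rintro q hq
              simp only [decide_eq_true_eq]
              rintro ⟨r, rfl⟩
              exact lt_irrefl _ (lt_of_cons_mem_nodes hq)
          · rw [List.getElem?_eq_none (by simp; omega)] at hc
            cases hc
      rw [at?_node_cons, Option.bind_eq_some_iff] at h
      obtain ⟨c, hc, h⟩ := h
      rw [key cs c hc, ih h, List.map_map]
      rfl

theorem filter_length_nodes (cs : List PTree) :
    (node cs).nodes.filter (fun q => q.length = 1) = (List.range cs.length).map ([·]) := by
  induction cs using List.reverseRecOn with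
  | nil => simp [nodes_nil]
  | append_singleton cs c ih =>
    rw [nodes_concat, List.filter_append, ih, List.length_append, List.length_singleton,
      List.range_succ, List.map_append, List.filter_map]
    congr 1
    have : c.nodes.filter ((fun q => decide (q.length = 1)) ∘ fun x => cs.length :: x) = [[]] := by
      have h : c.nodes = [] :: c.nodes.tail := by cases c <;> simp [nodes]
      have h2 := c.nodup_nodes
      rw [h] at h2 ⊢
      rw [List.filter_cons_of_pos (by simp), List.filter_eq_nil_iff.2]
      intro q hq
      simp only [Function.comp_apply, List.length_cons, Nat.add_eq_right, List.length_eq_zero_iff,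
        decide_eq_true_eq]
      rintro rfl
      exact (List.nodup_cons.1 h2).1 hq
    rw [this]
    simp

/-- The addresses of the leaves, with their labels, in traversal order. -/
def leafAddresses (t : PTree) : List (List ℕ × ℤ) :=
  t.nodes.filterMap fun p =>
    match t.at? p with
    | some (leaf z) => some (p, z)
    | _ => none

theorem mem_leafAddresses {t : PTree} {a : List ℕ × ℤ} :
    a ∈ t.leafAddresses ↔ t.at? a.1 = some (leaf a.2) := by
  rw [leafAddresses, List.mem_filterMap]
  constructor
  · rintro ⟨p, -, h⟩
    split at h
    · cases h; assumption
    · cases h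
  · intro h
    refine ⟨a.1, ?_, by rw [h]⟩
    rw [mem_nodes_iff, h]
    rfl

theorem leafAddresses_leaf (z : ℤ) : (leaf z).leafAddresses = [([], z)] := by
  simp [leafAddresses, nodes, at?]

theorem leafAddresses_nil : (node []).leafAddresses = [] := by
  simp [leafAddresses, nodes, at?]

theorem leafAddresses_concat (cs : List PTree) (c : PTree) :
    (node (cs ++ [c])).leafAddresses =
      (node cs).leafAddresses ++ c.leafAddresses.map (fun a => (cs.length :: a.1, a.2)) := by
  rw [leafAddresses, nodes_concat, List.filterMap_append, List.filterMap_map]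
  congr 1
  · refine List.filterMap_congr fun p hp => ?_
    by_cases hne : p = []
    · subst hne
      simp [at?_nil]
    · rw [at?_concat_of_mem hp hne]
  · rw [leafAddresses, List.map_filterMap]
    refine List.filterMap_congr fun p _ => ?_
    simp only [Function.comp_apply, at?_concat_cons]
    split <;> simp

theorem filter_prefix_leafAddresses {t s : PTree} {p : List ℕ} (h : t.at? p = some s) :
    t.leafAddresses.filter (fun a => p <+: a.1) =
      s.leafAddresses.map (fun a => (p ++ a.1, a.2)) := by
  have h1 : t.leafAddresses.filter (fun a => p <+: a.1) =
      (t.nodes.filter (fun q => p <+: q)).filterMap fun p =>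
        match t.at? p with
        | some (leaf z) => some (p, z)
        | _ => none := by
    rw [leafAddresses, List.filter_filterMap, List.filterMap_filter]
    refine List.filterMap_congr fun q _ => ?_
    split <;> split_ifs <;> simp_all [Option.filter]
  rw [h1, filter_prefix_nodes h, List.filterMap_map, leafAddresses, List.map_filterMap]
  refine List.filterMap_congr fun q _ => ?_
  simp only [Function.comp_apply, at?_append, h, Option.bind_some]
  split <;> simp

end PTree

namespace Forest

open RootedMap (flip)

/-- Put a list of second ends before a forest. -/
def consBacks {D : Type} (l : List D) (F : Forest D) : Forest D := l.foldr back F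

section ConsBacks

variable {D E : Type} (l : List D) (F : Forest D)

theorem tops_consBacks : (consBacks l F).tops = l ++ F.tops := by
  induction l <;> simp_all [consBacks, tops]

theorem initialBacks_consBacks : (consBacks l F).initialBacks = l ++ F.initialBacks := by
  induction l <;> simp_all [consBacks, initialBacks]

theorem leaves_consBacks : (consBacks l F).leaves = F.leaves := by
  induction l <;> simp_all [consBacks, leaves]

theorem openings_consBacks : (consBacks l F).openings = F.openings := by
  induction l <;> simp_all [consBacks, openings]

theorem toTrees_consBacks : (consBacks l F).toTrees = F.toTrees := by
  induction l <;> simp_all [consBacks, toTrees]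

theorem isTight_consBacks {l : List (E × Bool)} {F : Forest (E × Bool)} {k : ℤ} :
    (consBacks l F).IsTight k ↔ F.IsTight k := by
  induction l <;> simp_all [consBacks, IsTight]

theorem isRotation_consBacks {σ : Equiv.Perm (E × Bool)} {l : List (E × Bool)}
    {F : Forest (E × Bool)} : (consBacks l F).IsRotation σ ↔ F.IsRotation σ := by
  induction l <;> simp_all [consBacks, IsRotation]

end ConsBacks

variable {E : Type} (N : List ℕ → E)

/-- Add the edge to the last child `c`, at the address `p`, in front of the forest `rest` of the
other children; `sub` is the forest at `c`. The leaves of `c` labelled by the depth of its parent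
are closed immediately after `c`. -/
def attachChild (p : List ℕ) (c : PTree) (sub rest : Forest (E × Bool)) : Forest (E × Bool) :=
  match c with
  | .leaf z => leaf (N p, true) z rest
  | .node _ => node (N p, true) sub (consBacks (sub.closings (p.length - 1)) rest)

end Forest

namespace PTree

open RootedMap (flip)
open Forest (attachChild)

variable {E : Type} (N : List ℕ → E)

/-- The forest at the vertex with address `p` of a larger tree, where `t` is the sub-tree at this
vertex, with the second ends at the places prescribed by the reconnection. The edge from the
vertex with address `q` to its parent is `N q`. -/
def forest : PTree → List ℕ → Forest (E × Bool)
  | leaf _, _ => .nil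
  | node cs, p => ((cs.map (fun c => (c, forest c))).mapIdx (fun i g =>
      attachChild N (p ++ [i]) g.1 (g.2 (p ++ [i])))).foldl (fun F f => f F) .nil

theorem forest_leaf (z : ℤ) (p : List ℕ) : (leaf z).forest N p = .nil := by
  simp [forest]

theorem forest_nil (p : List ℕ) : (node []).forest N p = .nil := by
  simp [forest]

theorem forest_concat (cs : List PTree) (c : PTree) (p : List ℕ) :
    (node (cs ++ [c])).forest N p = attachChild N (p ++ [cs.length]) c
      (c.forest N (p ++ [cs.length])) ((node cs).forest N p) := by
  simp [forest, List.mapIdx_append]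

theorem toTrees_forest (t : PTree) : ∀ cs p, t = node cs → (t.forest N p).toTrees = cs := by
  induction t using concat_induction with
  | leaf z => rintro cs p ⟨⟩
  | nil =>
    rintro cs p ⟨⟩
    rw [forest_nil, Forest.toTrees]
  | concat cs c h1 h2 =>
    rintro _ p ⟨⟩
    rw [forest_concat]
    cases c with
    | leaf z => rw [attachChild, Forest.toTrees, h1 cs p rfl]
    | node ds =>
      rw [attachChild, Forest.toTrees, Forest.toTrees_consBacks, h1 cs p rfl, h2 ds _ rfl]

theorem initialBacks_forest (t : PTree) (p : List ℕ) : (t.forest N p).initialBacks = [] := by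
  induction t using concat_induction with
  | leaf z => rw [forest_leaf, Forest.initialBacks]; simp
  | nil => rw [forest_nil, Forest.initialBacks]; simp
  | concat cs c h1 h2 =>
    rw [forest_concat]
    cases c <;> rfl

theorem isTight_forest (t : PTree) (p : List ℕ) : (t.forest N p).IsTight p.length := by
  induction t using concat_induction generalizing p with
  | leaf z => rw [forest_leaf]; trivial
  | nil => rw [forest_nil]; trivial
  | concat cs c h1 h2 =>
    rw [forest_concat]
    cases c with
    | leaf z => exact ⟨initialBacks_forest _ _ _, h1 p⟩
    | node ds =>
      have h3 := h2 (p ++ [cs.length])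
      simp only [attachChild, Forest.IsTight, initialBacks_forest, Forest.initialBacks_consBacks,
        List.append_nil, Forest.isTight_consBacks, h1 p, List.length_append, List.length_singleton,
        Nat.cast_add, Nat.cast_one, add_sub_cancel_right, true_and, and_true] at h3 ⊢
      exact h3

theorem leaves_forest (t : PTree) : ∀ p, (∀ z, t ≠ leaf z) →
    (t.forest N p).leaves = t.leafAddresses.map (fun a => ((N (p ++ a.1), true), a.2)) := by
  induction t using concat_induction with
  | leaf z => exact fun p h => absurd rfl (h z)
  | nil => simp [forest_nil, leafAddresses_nil, Forest.leaves]
  | concat cs c h1 h2 =>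
    intro p _
    rw [forest_concat, leafAddresses_concat]
    cases c with
    | leaf z => simp [attachChild, Forest.leaves, h1, leafAddresses_leaf]
    | node ds =>
      simp [attachChild, Forest.leaves, Forest.leaves_consBacks, h1, h2]

theorem openings_forest (t : PTree) (p : List ℕ) :
    ((N p, true) :: (t.forest N p).openings).Perm (t.nodes.map (fun q => (N (p ++ q), true))) := by
  induction t using concat_induction generalizing p with
  | leaf z => simp [forest_leaf, nodes, Forest.openings]
  | nil => simp [forest_nil, nodes, Forest.openings]
  | concat cs c h1 h2 =>
    have h3 : ((node (cs ++ [c])).forest N p).openings = (N (p ++ [cs.length]), true) ::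
        ((c.forest N (p ++ [cs.length])).openings ++ ((node cs).forest N p).openings) := by
      rw [forest_concat]
      cases c <;> simp [attachChild, Forest.openings, forest_leaf, Forest.openings_consBacks]
    rw [h3, nodes_concat, List.map_append, List.map_map]
    have h4 := (h1 p).append (h2 (p ++ [cs.length]))
    simp only [List.append_assoc, List.singleton_append] at h4
    refine List.Perm.trans ?_ h4
    rw [List.cons_append]
    refine List.Perm.cons _ ?_
    rw [← List.cons_append]
    exact List.perm_append_comm

theorem isRotation_forest {σ : Equiv.Perm (E × Bool)} (t : PTree) : ∀ p,
    (∀ q cs, q ≠ [] → t.at? q = some (node cs) →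
      σ.IsCycList (N (p ++ q), false) ((node cs).forest N (p ++ q)).tops) →
    (t.forest N p).IsRotation σ := by
  induction t using concat_induction with
  | leaf z => exact fun p _ => by rw [forest_leaf]; trivial
  | nil => exact fun p _ => by rw [forest_nil]; trivial
  | concat cs c h1 h2 =>
    intro p h
    rw [forest_concat]
    have h3 : ((node cs).forest N p).IsRotation σ := by
      refine h1 p fun q ds hq hds => h q ds hq ?_
      rw [at?_concat_of_mem ?_ hq, hds]
      rw [mem_nodes_iff, hds]
      rfl
    cases c with
    | leaf z => exact h3
    | node ds =>
      refine ⟨h _ ds (List.cons_ne_nil _ _) (by simp [at?_concat_cons, at?_nil]), h2 _ ?_,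
        Forest.isRotation_consBacks.2 h3⟩
      intro q es hq hes
      have := h (cs.length :: q) es (List.cons_ne_nil _ _) (by rw [at?_concat_cons, hes])
      simpa using this

theorem tops_forest (cs : List PTree) (p : List ℕ) :
    ((node cs).forest N p).tops = (List.range cs.length).reverse.flatMap (fun i =>
      (N (p ++ [i]), true) :: ((cs.getD i (leaf 0)).forest N (p ++ [i])).closings p.length) := by
  induction cs using List.reverseRecOn with
  | nil => simp [forest_nil, Forest.tops]
  | append_singleton cs c ih =>
    rw [forest_concat, List.length_append, List.length_singleton, List.range_succ,
      List.reverse_append, List.reverse_singleton, List.singleton_append, List.flatMap_cons]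
    have h1 : (List.range cs.length).reverse.flatMap (fun i => (N (p ++ [i]), true) ::
        (((cs ++ [c]).getD i (leaf 0)).forest N (p ++ [i])).closings p.length) =
        ((node cs).forest N p).tops := by
      rw [ih]
      refine List.flatMap_congr fun i hi => ?_
      rw [List.mem_reverse, List.mem_range] at hi
      simp only [List.getD_eq_getElem?_getD, List.getElem?_append_left hi]
    rw [h1]
    cases c with
    | leaf z => simp [attachChild, Forest.tops, forest_leaf, Forest.closings, Forest.leaves]
    | node ds => simp [attachChild, Forest.tops, Forest.tops_consBacks]

end PTree

/-! ### The rotation of the reconnected map -/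

namespace Equiv.Perm

theorem IsCycList.congr {α : Type*} {σ τ : Equiv.Perm α} {a : α} {l : List α}
    (h : σ.IsCycList a l) (hστ : ∀ x ∈ a :: l, τ x = σ x) : τ.IsCycList a l := by
  rw [IsCycList, ← List.cons_append, List.isChain_iff_getElem] at h ⊢
  intro i hi
  have hi' : i < (a :: l).length := by simpa using hi
  rw [← h i hi, List.getElem_append_left hi']
  exact hστ _ (List.getElem_mem _)

variable {α : Type*} [DecidableEq α]

/-- If `x` is fixed for every pair `(e, x)` of the list `P`, then multiplying by the transpositions
`swap e x`, the last pair coming first, inserts after every other element `d` the partners of `d`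
in the order of `P`. -/
theorem isChain_foldr_mul_swap {τ : Equiv.Perm α} {P : List (α × α)}
    (hfix : ∀ p ∈ P, τ p.2 = p.2) (hnodup : (P.map Prod.snd).Nodup)
    (hne : ∀ p ∈ P, ∀ q ∈ P, p.1 ≠ q.2) {d : α} (hd : ∀ p ∈ P, d ≠ p.2) :
    List.IsChain (fun x y => P.foldr (fun p r => r * swap p.1 p.2) τ x = y)
      (d :: ((P.filter (fun p => p.1 = d)).map Prod.snd ++ [τ d])) := by
  induction P with
  | nil => simp
  | cons p P ih =>
    obtain ⟨e, x⟩ := p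
    simp only [List.mem_cons, forall_eq_or_imp, List.map_cons, List.nodup_cons, List.mem_map,
      not_exists, not_and] at hfix hnodup hne hd
    have h := ih hfix.2 hnodup.2 (fun p hp q hq => (hne.2 p hp).2 q hq) hd.2
    rw [List.foldr_cons]
    set σ := P.foldr (fun p r => r * swap p.1 p.2) τ with hσ
    have hx : σ x = x := by
      have : ∀ Q : List (α × α), (∀ q ∈ Q, q ∈ P) →
          Q.foldr (fun p r => r * swap p.1 p.2) τ x = x := by
        intro Q hQ
        induction Q with
        | nil => exact hfix.1
        | cons q Q ihQ =>
          rw [List.foldr_cons, mul_apply, swap_apply_of_ne_of_ne,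
            ihQ fun q hq => hQ q (by simp [hq])]
          · exact ((hne.2 q (hQ q (by simp))).1).symm
          · exact fun h => hnodup.1 q (hQ q (by simp)) h.symm
      exact this P fun q hq => hq
    -- The transposition does not act on the elements that are already in place after `d`.
    have hX : ∀ y ∈ (P.filter (fun p => p.1 = d)).map Prod.snd, y ≠ e ∧ y ≠ x := by
      intro y hy
      obtain ⟨q, hq, rfl⟩ := List.mem_map.1 hy
      have hq := (List.mem_filter.1 hq).1
      exact ⟨(hne.1.2 q hq).symm, hnodup.1 q hq⟩
    have hcongr : ∀ (l : List α) (b : α), (∀ y ∈ l, y ≠ e ∧ y ≠ x) →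
        List.IsChain (fun x y => σ x = y) (l ++ [b]) →
        List.IsChain (fun x' y => (σ * swap e x) x' = y) (l ++ [b]) := by
      intro l b hl hc
      rw [List.isChain_iff_getElem] at hc ⊢
      intro i hi
      rw [mul_apply, swap_apply_of_ne_of_ne]
      · exact hc i hi
      all_goals
        rw [List.getElem_append_left (by simpa using hi)]
      · exact (hl _ (List.getElem_mem _)).1
      · exact (hl _ (List.getElem_mem _)).2
    by_cases hed : e = d
    · subst hed
      simp only [decide_true, List.filter_cons_of_pos, List.map_cons, List.cons_append]
      rw [List.isChain_cons] at h
      rw [List.isChain_cons_cons, List.isChain_cons, mul_apply, mul_apply, swap_apply_left,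
        swap_apply_right]
      exact ⟨hx, h.1, hcongr _ _ hX h.2⟩
    · rw [List.filter_cons_of_neg (by simpa using hed)]
      refine hcongr (d :: _) _ ?_ h
      simp only [List.mem_cons, forall_eq_or_imp]
      exact ⟨⟨fun h => hed h.symm, hd.1⟩, hX⟩

/-- Multiplication by transpositions as in `isChain_foldr_mul_swap`, along a whole cycle. -/
theorem IsCycList.foldr_mul_swap {τ : Equiv.Perm α} {a : α} {m : List α} (h : τ.IsCycList a m)
    {P : List (α × α)} (hfix : ∀ p ∈ P, τ p.2 = p.2) (hnodup : (P.map Prod.snd).Nodup)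
    (hne : ∀ p ∈ P, ∀ q ∈ P, p.1 ≠ q.2) (hm : ∀ d ∈ a :: m, ∀ p ∈ P, d ≠ p.2) :
    (P.foldr (fun p r => r * swap p.1 p.2) τ).IsCycList a
      ((P.filter (fun p => p.1 = a)).map Prod.snd ++
        m.flatMap (fun d => d :: (P.filter (fun p => p.1 = d)).map Prod.snd)) := by
  have key : ∀ (m : List α) (b c : α), List.IsChain (fun x y => τ x = y) (b :: (m ++ [c])) →
      (∀ d ∈ b :: m, ∀ p ∈ P, d ≠ p.2) →
      List.IsChain (fun x y => P.foldr (fun p r => r * swap p.1 p.2) τ x = y)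
        (b :: ((P.filter (fun p => p.1 = b)).map Prod.snd ++
          (m.flatMap (fun d => d :: (P.filter (fun p => p.1 = d)).map Prod.snd) ++ [c]))) := by
    intro m
    induction m with
    | nil =>
      intro b c hc hb
      rw [List.nil_append, List.isChain_cons_cons] at hc
      rw [List.flatMap_nil, List.nil_append, ← hc.1]
      exact isChain_foldr_mul_swap hfix hnodup hne (hb b List.mem_cons_self)
    | cons d m ih =>
      intro b c hc hb
      rw [List.cons_append, List.isChain_cons_cons] at hc
      have h1 := isChain_foldr_mul_swap hfix hnodup hne (hb b List.mem_cons_self)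
      have h2 := ih d c hc.2 fun d hd => hb d (List.mem_cons_of_mem _ hd)
      rw [hc.1] at h1
      rw [List.flatMap_cons, List.cons_append, List.cons_append, ← List.cons_append,
        List.isChain_split, List.append_assoc]
      exact ⟨h1, h2⟩
  have := key m a a h hm
  rw [IsCycList, List.append_assoc]
  exact this

theorem isCycList_formPerm {a : α} {m : List α} (h : (a :: m).Nodup) :
    (a :: m).formPerm.IsCycList a m := by
  rw [IsCycList, List.isChain_iff_getElem]
  intro i hi
  simp only [← List.cons_append] at hi ⊢
  have hi' : i < (a :: m).length := by simpa using hi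
  rw [List.getElem_append_left hi', List.formPerm_apply_getElem _ h]
  rcases (show i + 1 < (a :: m).length ∨ i + 1 = (a :: m).length by omega) with h1 | h1
  · rw [List.getElem_append_left h1]
    simp only [Nat.mod_eq_of_lt h1]
  · rw [List.getElem_append_right (by omega)]
    simp only [h1, Nat.mod_self, List.getElem_cons_zero, List.getElem_singleton]

theorem prod_formPerm_apply_of_notMem {L : List (List α)} {x : α} (hx : ∀ l ∈ L, x ∉ l) :
    (L.map List.formPerm).prod x = x := by
  induction L with
  | nil => rfl
  | cons l L ih =>
    rw [List.map_cons, List.prod_cons, mul_apply, ih fun l hl => hx l (List.mem_cons_of_mem _ hl)]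
    exact List.formPerm_apply_of_notMem (hx l List.mem_cons_self)

theorem prod_formPerm_apply {L : List (List α)} (hL : L.Pairwise List.Disjoint) {l : List α}
    (hl : l ∈ L) {x : α} (hx : x ∈ l) : (L.map List.formPerm).prod x = l.formPerm x := by
  induction L with
  | nil => simp at hl
  | cons l' L ih =>
    rw [List.pairwise_cons] at hL
    rw [List.map_cons, List.prod_cons, mul_apply]
    rcases List.mem_cons.1 hl with rfl | hl
    · rw [prod_formPerm_apply_of_notMem fun m hm hxm => hL.1 m hm hx hxm]
    · rw [ih hL.2 hl]
      exact List.formPerm_apply_of_notMem fun h => hL.1 l hl h (List.formPerm_apply_mem_of_mem hx)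

end Equiv.Perm

namespace PTree

open RootedMap (flip)
open Equiv.Perm

variable (t : PTree)

/-- The vertex with a given address; the root if there is none. -/
def nodeAt (p : List ℕ) : t.Node := if h : p ∈ t.nodes then ⟨p, h⟩ else ⟨[], t.nil_mem_nodes⟩

variable {t}

theorem nodeAt_of_mem {p : List ℕ} (h : p ∈ t.nodes) : t.nodeAt p = ⟨p, h⟩ := dif_pos h

theorem nodeAt_val (p : t.Node) : t.nodeAt p.1 = p := nodeAt_of_mem p.2

theorem nodeAt_inj {p q : List ℕ} (hp : p ∈ t.nodes) (hq : q ∈ t.nodes) :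
    t.nodeAt p = t.nodeAt q ↔ p = q := by
  rw [nodeAt_of_mem hp, nodeAt_of_mem hq, Subtype.mk.injEq]

theorem attach_nodes : t.nodes.attach = t.nodes.map t.nodeAt := by
  conv_rhs => rw [← List.attach_map_subtype_val t.nodes, List.map_map]
  refine (List.map_id _).symm.trans (List.map_congr_left fun p _ => (nodeAt_val p).symm)

theorem childNodes_eq {q : List ℕ} {cs : List PTree} (h : t.at? q = some (node cs)) :
    t.childNodes (t.nodeAt q) = (List.range cs.length).map (fun i => t.nodeAt (q ++ [i])) := by
  have hq : q ∈ t.nodes := by rw [mem_nodes_iff, h]; rfl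
  have h1 : t.childNodes (t.nodeAt q) =
      (t.nodes.filter (fun p => p ≠ [] ∧ p.dropLast = q)).map t.nodeAt := by
    rw [childNodes, attach_nodes, List.filter_map]
    congr 1
    refine List.filter_congr fun p hp => ?_
    simp [nodeAt_of_mem hp, nodeAt_of_mem hq]
  have h2 : t.nodes.filter (fun p => p ≠ [] ∧ p.dropLast = q) =
      (t.nodes.filter (fun p => q <+: p)).filter (fun p => p.length = q.length + 1) := by
    rw [List.filter_filter]
    refine List.filter_congr fun p _ => ?_
    rw [← Bool.decide_and, decide_eq_decide]
    constructor
    · rintro ⟨hp, rfl⟩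
      refine ⟨?_, List.dropLast_prefix p⟩
      have := List.length_pos_of_ne_nil hp
      rw [List.length_dropLast]
      omega
    · rintro ⟨hlen, r, rfl⟩
      obtain ⟨i, rfl⟩ := List.length_eq_one_iff.1 (show r.length = 1 by simpa using hlen)
      simp
  have h3 : ((fun p : List ℕ => decide (p.length = q.length + 1)) ∘ fun x => q ++ x) =
      fun p => decide (p.length = 1) := by
    funext p
    simp
  rw [h1, h2, filter_prefix_nodes h, List.filter_map, h3, filter_length_nodes]
  simp

theorem childNodes_leaf {q : List ℕ} {z : ℤ} (h : t.at? q = some (leaf z)) :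
    t.childNodes (t.nodeAt q) = [] := by
  have hq : q ∈ t.nodes := by rw [mem_nodes_iff, h]; rfl
  rw [childNodes, List.filter_eq_nil_iff]
  rintro ⟨p, hp⟩ -
  rw [nodeAt_of_mem hq]
  simp only [decide_eq_true_eq]
  rintro ⟨hne, rfl⟩
  rw [mem_nodes_iff, ← List.dropLast_append_getLast hne, at?_append, h] at hp
  simp [at?] at hp

theorem mem_nodeDarts {p : t.Node} {x : t.Node × Bool} :
    x ∈ t.nodeDarts p ↔
      if x.2 then x.1.1 ≠ [] ∧ x.1.1.dropLast = p.1 else x.1 = p := by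
  obtain ⟨y, b⟩ := x
  cases b <;> simp [nodeDarts, childNodes]

theorem nodup_nodeDarts (p : t.Node) : (t.nodeDarts p).Nodup := by
  rw [nodeDarts, List.nodup_cons]
  refine ⟨by simp, List.Nodup.map (fun a b h => (Prod.mk.inj h).1) ?_⟩
  rw [List.nodup_reverse]
  exact (List.nodup_attach.2 t.nodup_nodes).filter _

theorem pairwise_disjoint_nodeDarts : (t.nodes.attach.map t.nodeDarts).Pairwise List.Disjoint := by
  rw [List.pairwise_map]
  refine (List.nodup_attach.2 t.nodup_nodes).imp fun {p q} hpq x hp hq => ?_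
  rw [mem_nodeDarts] at hp hq
  obtain ⟨y, b⟩ := x
  cases b
  · exact hpq (hp.symm.trans hq)
  · exact hpq (Subtype.ext (hp.2.symm.trans hq.2))

theorem treeRotation_eq : t.treeRotation = ((t.nodes.attach.map t.nodeDarts).map
    List.formPerm).prod := by
  rw [List.map_map]
  rfl

theorem isCycList_treeRotation (p : t.Node) :
    t.treeRotation.IsCycList (p, false) ((t.childNodes p).reverse.map (fun q => (q, true))) := by
  refine (isCycList_formPerm (nodup_nodeDarts p)).congr fun x hx => ?_
  rw [treeRotation_eq]
  exact prod_formPerm_apply pairwise_disjoint_nodeDarts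
    (List.mem_map.2 ⟨p, List.mem_attach _ _, rfl⟩) hx

theorem treeRotation_root : t.treeRotation (t.nodeAt [], true) = (t.nodeAt [], true) := by
  rw [treeRotation_eq]
  refine prod_formPerm_apply_of_notMem fun l hl => ?_
  obtain ⟨p, -, rfl⟩ := List.mem_map.1 hl
  rw [mem_nodeDarts, nodeAt_of_mem t.nil_mem_nodes]
  simp

/-- Before the reconnection, the end of an edge at a leaf forms a vertex of its own. -/
theorem treeRotation_leaf {q : List ℕ} {z : ℤ} (h : t.at? q = some (leaf z)) :
    t.treeRotation (t.nodeAt q, false) = (t.nodeAt q, false) := by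
  have := isCycList_treeRotation (t.nodeAt q)
  rw [childNodes_leaf h] at this
  simpa [IsCycList] using this

theorem leavesList_eq : t.leavesList = t.leafAddresses.map (fun a => (t.nodeAt a.1, a.2)) := by
  rw [leavesList, attach_nodes, List.filterMap_map, leafAddresses, List.map_filterMap]
  refine List.filterMap_congr fun p hp => ?_
  simp only [Function.comp_apply]
  rw [nodeAt_of_mem hp]
  dsimp only
  split <;> simp_all [nodeAt_of_mem hp]

/-- The reconnections: each edge `e` with the second end that is moved just after `e`. -/
def reconnections (t : PTree) : List ((t.Node × Bool) × (t.Node × Bool)) :=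
  t.leafAddresses.map (fun a => ((t.nodeAt (a.1.take (a.2 + 1).toNat), true),
    (t.nodeAt a.1, false)))

theorem cw_reconnect :
    t.reconnect.cw = t.reconnections.foldr (fun p r => r * Equiv.swap p.1 p.2) t.treeRotation := by
  change t.leavesList.reverse.foldl t.reconnectLeaf t.treeRotation = _
  rw [List.foldl_reverse, leavesList_eq, reconnections, List.foldr_map, List.foldr_map]
  have : ∀ L : List (List ℕ × ℤ), (∀ a ∈ L, a ∈ t.leafAddresses) →
      L.foldr (fun a r => t.reconnectLeaf r (t.nodeAt a.1, a.2)) t.treeRotation =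
      L.foldr (fun a r => r * Equiv.swap (t.nodeAt (a.1.take (a.2 + 1).toNat), true)
        (t.nodeAt a.1, false)) t.treeRotation := by
    intro L hL
    induction L with
    | nil => rfl
    | cons a L ih =>
      rw [List.foldr_cons, List.foldr_cons, ih fun a ha => hL a (List.mem_cons_of_mem _ ha),
        reconnectLeaf]
      have ha : a.1 ∈ t.nodes := by
        rw [mem_nodes_iff, mem_leafAddresses.1 (hL a List.mem_cons_self)]
        rfl
      rw [firstEdge, nodeAt_of_mem (take_mem_nodes _ t _ ha)]
      simp only [nodeAt_of_mem ha]
  exact this _ fun a ha => ha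

theorem mem_nodes_of_mem_leafAddresses {a : List ℕ × ℤ} (ha : a ∈ t.leafAddresses) :
    a.1 ∈ t.nodes := by
  rw [mem_nodes_iff, mem_leafAddresses.1 ha]
  rfl

theorem nodup_reconnections : (t.reconnections.map Prod.snd).Nodup := by
  rw [reconnections, List.map_map]
  have h1 : (t.leafAddresses.map Prod.fst).Nodup := by
    refine List.Nodup.sublist ?_ t.nodup_nodes
    rw [leafAddresses, List.map_filterMap]
    have : ∀ L : List (List ℕ), (L.filterMap fun p => Option.map Prod.fst
        (match t.at? p with
        | some (leaf z) => some (p, z)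
        | _ => none)).Sublist L := by
      intro L
      induction L with
      | nil => exact List.Sublist.refl _
      | cons p L ih =>
        rw [List.filterMap_cons]
        split
        · exact ih.cons _
        · rename_i h
          split at h
          · cases h
            exact ih.cons_cons _
          · cases h
    exact this _
  have h2 := List.Nodup.of_map _ h1
  refine (List.nodup_map_iff_inj_on h2).2 fun a ha b hb hab => ?_
  simp only [Function.comp_apply, Prod.mk.injEq, and_true] at hab
  rw [nodeAt_inj (mem_nodes_of_mem_leafAddresses ha) (mem_nodes_of_mem_leafAddresses hb)] at hab
  exact List.inj_on_of_nodup_map h1 ha hb hab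

theorem IsDecorated.neg_one_le_of_mem {a : List ℕ × ℤ} (h : t.IsDecorated)
    (ha : a ∈ t.leafAddresses) : -1 ≤ a.2 :=
  h.neg_one_le _ (leafLabels_subset (mem_leafAddresses.1 ha) _ (by simp [leafLabels]))

/-- The second ends moved after an edge are those prescribed by the forest. -/
theorem filter_reconnections (h : t.IsDecorated) {c : List ℕ} {s : PTree} (hs : t.at? c = some s)
    (hne : ∀ z, t ≠ leaf z) :
    (t.reconnections.filter (fun p => p.1 = (t.nodeAt c, true))).map Prod.snd =
      (s.forest t.nodeAt c).closings (c.length - 1) := by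
  have hc : c ∈ t.nodes := by rw [mem_nodes_iff, hs]; rfl
  -- The label is less than the depth of the parent, so that truncation to the depth of the first
  -- edge gives an address of the expected length.
  have hlt : ∀ a ∈ t.leafAddresses, a.2 < (a.1.length : ℤ) - 1 := by
    rintro ⟨q, z⟩ ha
    have ha := mem_leafAddresses.1 ha
    rcases List.eq_nil_or_concat' q with rfl | ⟨p, i, rfl⟩
    · rw [at?_nil, Option.some_inj] at ha
      exact absurd ha (hne z)
    · simpa using h.label_lt p i z ha
  have h1 : (t.reconnections.filter (fun p => p.1 = (t.nodeAt c, true))).map Prod.snd =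
      ((t.leafAddresses.filter (fun a => c <+: a.1)).filter
        (fun a => a.2 = (c.length : ℤ) - 1)).map (fun a => (t.nodeAt a.1, false)) := by
    rw [reconnections, List.filter_map, List.map_map, List.filter_filter]
    congr 1
    refine List.filter_congr fun a ha => ?_
    have hmem := mem_nodes_of_mem_leafAddresses ha
    have h2 := h.neg_one_le_of_mem ha
    have h3 := hlt a ha
    have hlen : (a.1.take (a.2 + 1).toNat).length = (a.2 + 1).toNat := by
      rw [List.length_take]
      omega
    simp only [Function.comp_apply, Prod.mk.injEq, and_true, ← Bool.decide_and,
      nodeAt_inj (take_mem_nodes _ t _ hmem) hc]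
    rw [decide_eq_decide]
    constructor
    · rintro rfl
      exact ⟨by rw [hlen]; omega, List.take_prefix _ _⟩
    · rintro ⟨h4, h5⟩
      rw [List.prefix_iff_eq_take.1 h5]
      congr 1
      omega
  rw [h1, filter_prefix_leafAddresses hs]
  cases s with
  | leaf z =>
    have h2 := hlt (c, z) (mem_leafAddresses.2 hs)
    simp only at h2
    rw [forest_leaf, leafAddresses_leaf]
    simp only [List.map_cons, List.append_nil, List.map_nil, Forest.closings, Forest.leaves,
      List.filter_nil, List.map_eq_nil_iff, List.filter_eq_nil_iff, List.mem_singleton,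
      decide_eq_true_eq, forall_eq]
    omega
  | node cs =>
    rw [Forest.closings, leaves_forest _ _ _ (by simp), List.filter_map, List.filter_map,
      List.map_map, List.map_map]
    rfl

end PTree

/-! ### The exploration of the reconnected map -/

namespace Forest

open RootedMap (flip)

theorem openings_perm {D : Type} (F : Forest D) :
    F.openings.Perm (F.leaves.map Prod.fst ++ F.treeDarts) := by
  rw [← Multiset.coe_eq_coe]
  induction F with
  | nil => rfl
  | leaf d j rest ih =>
    simp only [openings, leaves, treeDarts, List.map_append, List.map_cons, List.map_nil,
      ← Multiset.coe_add, ← Multiset.cons_coe, ih, ← Multiset.singleton_add, Multiset.coe_nil]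
    abel
  | back d rest ih => exact ih
  | node d sub rest ih1 ih2 =>
    simp only [openings, leaves, treeDarts, List.map_append,
      ← Multiset.coe_add, ← Multiset.cons_coe, ih1, ih2, ← Multiset.singleton_add]
    abel

variable {E : Type}

/-- At the vertices of a forest at depth `k`, exactly the leaves with labels at least `k` are
closed. -/
theorem IsTight.allBacks_perm {F : Forest (E × Bool)} {k : ℤ} (h : F.IsTight k)
    (hd : F.IsDecorated k) :
    F.allBacks.Perm (F.initialBacks ++
      (F.leaves.filter (fun l => k ≤ l.2)).map (fun l => flip l.1)) := by
  induction F generalizing k with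
  | nil => exact List.Perm.refl _
  | leaf d j rest ih =>
    have h1 := ih h.2 hd.2.2
    rw [h.1] at h1
    simpa [allBacks, leaves, initialBacks, List.filter_append, not_le.2 hd.2.1] using h1
  | back d rest ih => exact (ih h hd).cons d
  | node d sub rest ih1 ih2 =>
    obtain ⟨t1, t2, t3, t4⟩ := h
    obtain ⟨-, -, -, d4, d5⟩ := hd
    have h1 := ih1 t3 d4
    have h2 := ih2 t4 d5
    rw [t1, List.nil_append] at h1
    rw [t2] at h2
    have h3 : (sub.leaves.filter (fun l => k ≤ l.2)).Perm
        (sub.leaves.filter (fun l => k + 1 ≤ l.2) ++ sub.leaves.filter (fun l => l.2 = k)) := by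
      refine (List.filter_append_perm (fun l => decide (k + 1 ≤ l.2)) _).symm.trans ?_
      rw [List.filter_filter, List.filter_filter]
      refine List.Perm.of_eq ?_
      congr 1 <;> refine List.filter_congr fun l _ => ?_ <;> rw [Bool.eq_iff_iff] <;> simp <;> omega
    have h4 := h3.map (fun l => flip l.1)
    rw [List.map_append] at h4
    simp only [allBacks, initialBacks, leaves, List.filter_append, List.map_append, List.nil_append]
    rw [closings] at h2
    rw [← Multiset.coe_eq_coe] at h1 h2 h4 ⊢
    simp only [← Multiset.coe_add] at h1 h2 h4 ⊢
    rw [h1, h2, h4]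
    abel

end Forest

namespace PTree

open RootedMap (flip)
open Equiv.Perm

variable {t : PTree}

theorem IsDecorated.eq_node (h : t.IsDecorated) (ht : 0 < t.numEdges) : ∃ cs, t = node cs := by
  cases t with
  | leaf z => simp [numEdges] at ht
  | node cs => exact ⟨cs, rfl⟩

theorem card_node (t : PTree) : Nat.card t.Node = t.numEdges + 1 := by
  rw [← length_nodes, ← List.toFinset_card_of_nodup t.nodup_nodes]
  exact Nat.subtype_card _ fun p => List.mem_toFinset

theorem reconnections_spec {p : (t.Node × Bool) × (t.Node × Bool)} (hp : p ∈ t.reconnections) :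
    p.1.2 = true ∧ ∃ q z, t.at? q = some (leaf z) ∧ p.2 = (t.nodeAt q, false) := by
  obtain ⟨a, ha, rfl⟩ := List.mem_map.1 hp
  exact ⟨rfl, a.1, a.2, mem_leafAddresses.1 ha, rfl⟩

/-- A cycle of the tree rotation, made of darts that do not belong to leaves, with the second ends
inserted by the reconnection. -/
theorem IsCycList.reconnect {a : t.Node × Bool} {m : List (t.Node × Bool)}
    (h : t.treeRotation.IsCycList a m) (hm : ∀ x ∈ m, x.2 = true)
    (ha : ∀ q z, t.at? q = some (leaf z) → a ≠ (t.nodeAt q, false)) :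
    t.reconnect.cw.IsCycList a ((t.reconnections.filter (fun p => p.1 = a)).map Prod.snd ++
      m.flatMap (fun d => d :: (t.reconnections.filter (fun p => p.1 = d)).map Prod.snd)) := by
  rw [cw_reconnect]
  refine h.foldr_mul_swap (fun p hp => ?_) nodup_reconnections (fun p hp q hq => ?_)
    fun d hd p hp => ?_
  · obtain ⟨-, q, z, hq, h1⟩ := reconnections_spec hp
    rw [h1, treeRotation_leaf hq]
  · obtain ⟨-, r, z, hr, h1⟩ := reconnections_spec hq
    rw [h1]
    intro h2
    have h3 := (reconnections_spec hp).1
    rw [h2] at h3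
    cases h3
  · obtain ⟨-, q, z, hq, h1⟩ := reconnections_spec hp
    rcases List.mem_cons.1 hd with rfl | hd
    · rw [h1]
      exact ha q z hq
    · rw [h1]
      rintro rfl
      cases hm _ hd

/-- The vertex of an internal node after the reconnection: the edge to the parent, then each child,
from the last one to the first one, with the edges closed after it. -/
theorem isCycList_reconnect_node (h : t.IsDecorated) {q : List ℕ} {cs : List PTree}
    (hq : t.at? q = some (node cs)) :
    t.reconnect.cw.IsCycList (t.nodeAt q, false) ((node cs).forest t.nodeAt q).tops := by
  have hne : ∀ z, t ≠ leaf z := by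
    rintro z rfl
    exact at?_leaf_eq_node hq
  have h1 := IsCycList.reconnect (isCycList_treeRotation (t.nodeAt q)) (by simp) (by
    intro r z hr h2
    have h3 : q ∈ t.nodes := by rw [mem_nodes_iff, hq]; rfl
    have h4 : r ∈ t.nodes := by rw [mem_nodes_iff, hr]; rfl
    rw [Prod.mk.injEq, nodeAt_inj h3 h4] at h2
    rw [h2.1, hr] at hq
    cases hq)
  have h2 : t.reconnections.filter (fun p => p.1 = (t.nodeAt q, false)) = [] := by
    rw [List.filter_eq_nil_iff]
    intro p hp
    have h3 := (reconnections_spec hp).1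
    rw [decide_eq_true_eq]
    intro h4
    rw [h4] at h3
    cases h3
  rw [h2, List.map_nil, List.nil_append, childNodes_eq hq] at h1
  rw [tops_forest]
  rw [← List.map_reverse, List.map_map, List.flatMap_map] at h1
  refine Eq.mp (congrArg _ ?_) h1
  symm
  refine List.flatMap_congr fun i hi => ?_
  rw [List.mem_reverse, List.mem_range] at hi
  have h3 : t.at? (q ++ [i]) = some (cs.getD i (leaf 0)) := by
    rw [at?_concat_eq_some]
    exact ⟨cs, hq, by simp [hi]⟩
  have h4 := filter_reconnections h h3 hne
  simp only [Function.comp_apply]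
  rw [h4]
  simp

/-- The vertex added above the root of the tree, after the reconnection. -/
theorem isCycList_reconnect_root (h : t.IsDecorated) (hne : ∀ z, t ≠ leaf z) :
    t.reconnect.cw.IsCycList (t.nodeAt [], true) ((t.forest t.nodeAt []).closings (-1)) := by
  have h1 : t.treeRotation.IsCycList (t.nodeAt [], true) [] := by
    simpa [IsCycList] using treeRotation_root
  have h2 := IsCycList.reconnect h1 (by simp) (by simp)
  rw [filter_reconnections h (at?_nil t) hne, List.flatMap_nil, List.append_nil, List.length_nil,
    Nat.cast_zero, zero_sub] at h2
  exact h2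

/-- The exploration forest of the reconnected map: its second ends are at the prescribed places, and
its only tree is the given one. -/
theorem IsDecorated.exists_represents (h : t.IsDecorated) (ht : 0 < t.numEdges) :
    ∃ sub rest : Forest t.reconnect.Dart,
      Forest.Represents t.reconnect (.node t.reconnect.root sub rest) ∧ rest.toTrees = [] ∧
      PTree.node sub.toTrees = t ∧ (Forest.node t.reconnect.root sub rest).IsTight (-1) ∧
      (Forest.node t.reconnect.root sub rest).IsDecorated (-1) ∧
      ∀ x ∈ (Forest.node t.reconnect.root sub rest).openings, x.2 = true := by
  obtain ⟨cs, hcs⟩ := h.eq_node ht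
  have hne : ∀ z, t ≠ leaf z := by
    rintro z rfl
    cases hcs
  have hroot : t.reconnect.root = (t.nodeAt [], true) := by
    rw [nodeAt_of_mem t.nil_mem_nodes]
    rfl
  let sub : Forest t.reconnect.Dart := t.forest t.nodeAt []
  let rest : Forest t.reconnect.Dart := Forest.consBacks (sub.closings (-1)) .nil
  have hrest : rest.toTrees = [] := Forest.toTrees_consBacks _ _
  have hsub : sub.toTrees = cs := toTrees_forest _ t cs [] hcs
  have htree : PTree.node sub.toTrees = t := by rw [hsub, hcs]
  have htight : (Forest.node t.reconnect.root sub rest).IsTight (-1) := by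
    refine ⟨initialBacks_forest _ _ _, ?_, isTight_forest _ t [],
      (Forest.isTight_of_toTrees_eq_nil hrest _).1⟩
    exact (Forest.initialBacks_consBacks _ _).trans (List.append_nil _)
  have hle : ∀ l ∈ sub.leaves, -1 ≤ l.2 := by
    intro l hl
    refine h.neg_one_le _ ?_
    have hlab : t.leafLabels = sub.leaves.map Prod.snd := by
      rw [Forest.leaves_map_snd, hsub, hcs, leafLabels_node]
    rw [hlab]
    exact List.mem_map.2 ⟨l, hl, rfl⟩
  have hdec0 := Forest.isDecorated_node_iff.1 (htree.symm ▸ h)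
  have hdec : (Forest.node t.reconnect.root sub rest).IsDecorated (-1) :=
    ⟨fun h0 => absurd h0 (by decide),
      List.pairwise_of_forall_mem_list fun a ha b hb _ => hle a ha, hdec0.1, hdec0.2,
      (Forest.isTight_of_toTrees_eq_nil hrest _).2⟩
  have hleaves : (Forest.node t.reconnect.root sub rest).leaves = sub.leaves := by
    rw [Forest.leaves, Forest.leaves_eq_nil_of_toTrees_eq_nil hrest, List.nil_append]
  have hopen : (Forest.node t.reconnect.root sub rest).openings.Perm
      (t.nodes.map (fun q => (t.nodeAt q, true))) := by
    rw [Forest.openings, Forest.openings_consBacks, Forest.openings, List.append_nil, hroot]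
    exact openings_forest t.nodeAt t []
  have htrue : ∀ x ∈ (Forest.node t.reconnect.root sub rest).openings, x.2 = true := by
    intro x hx
    obtain ⟨q, -, rfl⟩ := List.mem_map.1 (hopen.mem_iff.1 hx)
    rfl
  -- All labels are at least `-1`, so that every leaf is closed, and the contour consists of the
  -- explored darts and of their opposites.
  have hcontour : (Forest.node t.reconnect.root sub rest).contour.Perm
      (t.nodes.map (fun q => (t.nodeAt q, true)) ++
        t.nodes.map (fun q => (t.nodeAt q, false))) := by
    have h1 := htight.allBacks_perm hdec
    rw [List.filter_eq_self.2 (by rw [hleaves]; simpa using hle), Forest.initialBacks,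
      List.nil_append] at h1
    · have h2 := hopen.map flip
      rw [List.map_map] at h2
      refine (Forest.contour_perm _).trans (List.Perm.trans ?_ (hopen.append h2))
      have h3 := Forest.openings_perm (Forest.node t.reconnect.root sub rest)
      have h4 := h3.map flip
      rw [List.map_append, List.map_map] at h4
      rw [← Multiset.coe_eq_coe] at h1 h3 h4 ⊢
      simp only [← Multiset.coe_add] at h1 h3 h4 ⊢
      rw [h1, h3, h4]
      simp only [Function.comp_def]
      abel
    · simp
  refine ⟨sub, rest, ⟨?_, ?_, ?_, ?_, ?_, ?_⟩, hrest, htree, htight, hdec, htrue⟩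
  · rw [hcontour.nodup_iff]
    have hinj : ∀ b : Bool, (t.nodes.map (fun q => (t.nodeAt q, b))).Nodup := by
      intro b
      refine (List.nodup_map_iff_inj_on t.nodup_nodes).2 fun p hp q hq hpq => ?_
      exact (nodeAt_inj hp hq).1 (Prod.mk.inj hpq).1
    refine (hinj true).append (hinj false) ?_
    intro x hx hx'
    obtain ⟨p, -, rfl⟩ := List.mem_map.1 hx
    obtain ⟨q, -, hq⟩ := List.mem_map.1 hx'
    cases (Prod.mk.inj hq).2
  · rintro ⟨p, b⟩
    refine hcontour.mem_iff.2 (List.mem_append.2 ?_)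
    cases b
    · exact Or.inr (List.mem_map.2 ⟨p.1, p.2, congrArg (·, false) (nodeAt_val (t := t) p)⟩)
    · exact Or.inl (List.mem_map.2 ⟨p.1, p.2, congrArg (·, true) (nodeAt_val (t := t) p)⟩)
  · refine ⟨rest.tops, rfl, ?_⟩
    rw [hroot, Forest.tops_consBacks, Forest.tops, List.append_nil]
    exact isCycList_reconnect_root h hne
  · refine ⟨?_, isRotation_forest _ t [] fun q ds _ hds => isCycList_reconnect_node h hds,
      Forest.isRotation_consBacks.2 trivial⟩
    rw [hroot]
    have := isCycList_reconnect_node h (q := []) (cs := cs) (by rw [at?_nil, hcs])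
    rw [← hcs] at this
    exact this
  · exact htight.isDFS hdec (by simp [Forest.initialBacks])
  · rw [hleaves]
    exact hle

end PTree

/-! ### The two transformations are inverse to each other -/

/-- The exploration of a non-separable planar map gives a decorated tree. -/
theorem RootedMap.IsNonSeparablePlanar.exists_represents {M : RootedMap}
    (hM : M.IsNonSeparablePlanar) : ∃ F : Forest M.Dart, Forest.Represents M F ∧ F.IsTight (-1) ∧
      F.toTrees = [M.explorationTree] ∧ M.explorationTree.IsDecorated ∧
      0 < M.explorationTree.numEdges := by
  obtain ⟨F, hF⟩ := Forest.exists_represents hM.1.1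
  obtain ⟨sub, rest, rfl, hrest, ht, hd⟩ := hF.of_isNonSeparablePlanar hM
  have h1 : (Forest.node M.root sub rest).toTrees = [PTree.node sub.toTrees] := by
    rw [Forest.toTrees, hrest, List.nil_append]
  have h2 : M.explorationTree = PTree.node sub.toTrees := by
    rw [explorationTree, hF.explorationForest_eq, h1]
  refine ⟨_, hF, ht, by rw [h1, h2], ?_, ?_⟩
  · rw [h2, Forest.isDecorated_node_iff]
    exact ⟨hd.2.2.1, hd.2.2.2.1⟩
  · rw [h2]
    obtain ⟨c, cs, hc⟩ := List.exists_cons_of_ne_nil hd.2.2.1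
    simp [hc, PTree.numEdges]

/-- Reconnecting the exploration tree of a non-separable planar map gives the map back. -/
theorem RootedMap.IsNonSeparablePlanar.nonempty_iso {M : RootedMap}
    (hM : M.IsNonSeparablePlanar) : Nonempty (Iso M.explorationTree.reconnect M) := by
  obtain ⟨F, hF, ht, htree, hdec, hpos⟩ := hM.exists_represents
  obtain ⟨sub, rest, h1, h2, h3, h4, -, h5⟩ := hdec.exists_represents hpos
  refine h1.nonempty_iso_of_toTrees_eq hF h4 ht ?_ h5
  rw [htree, Forest.toTrees, h2, h3, List.nil_append]

theorem PTree.IsDecorated.isNonSeparablePlanar {t : PTree} (h : t.IsDecorated)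
    (ht : 0 < t.numEdges) : t.reconnect.IsNonSeparablePlanar := by
  obtain ⟨sub, rest, h1, h2, -, h3, h4, -⟩ := h.exists_represents ht
  refine h1.isNonSeparablePlanar h2 h3 h4 ?_
  have : Nat.card t.reconnect.E = t.numEdges + 1 := t.card_node
  omega

/-- Exploring the map reconnected from a decorated tree gives the tree back. -/
theorem PTree.IsDecorated.explorationTree_reconnect {t : PTree} (h : t.IsDecorated)
    (ht : 0 < t.numEdges) : t.reconnect.explorationTree = t := by
  obtain ⟨sub, rest, h1, h2, h3, -⟩ := h.exists_represents ht
  rw [RootedMap.explorationTree, h1.explorationForest_eq, Forest.toTrees, h2, List.nil_append, h3]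

theorem mainTheorem2 (n : ℕ) (hn : 0 < n) :
    Set.BijOn explorationMap (nonSeparableMaps n) (decoratedTrees n) ∧
    Set.MapsTo reconnectionMap (decoratedTrees n) (nonSeparableMaps n) ∧
    Set.InvOn reconnectionMap explorationMap (nonSeparableMaps n) (decoratedTrees n) := by
  have hT : Set.MapsTo explorationMap (nonSeparableMaps n) (decoratedTrees n) := by
    rintro _ ⟨M, hM, hcard, rfl⟩
    obtain ⟨-, -, -, -, hdec, -⟩ := hM.exists_represents
    refine ⟨hdec, ?_⟩
    obtain ⟨f⟩ := hM.nonempty_iso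
    -- The number of edges is half the number of darts.
    have h1 := Nat.card_congr f.toEquiv
    have h2 : Nat.card M.explorationTree.reconnect.E = M.explorationTree.numEdges + 1 :=
      M.explorationTree.card_node
    rw [Nat.card_prod, Nat.card_prod, h2, hcard, Nat.card_eq_fintype_card, Fintype.card_bool] at h1
    change M.explorationTree.numEdges = n
    omega
  have hS : Set.MapsTo reconnectionMap (decoratedTrees n) (nonSeparableMaps n) := by
    rintro t ⟨h, rfl⟩
    exact ⟨t.reconnect, h.isNonSeparablePlanar hn, t.card_node, rfl⟩
  have hinv : Set.InvOn reconnectionMap explorationMap (nonSeparableMaps n) (decoratedTrees n) := by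
    constructor
    · rintro _ ⟨M, hM, -, rfl⟩
      exact Quotient.sound hM.nonempty_iso
    · rintro t ⟨h, rfl⟩
      exact h.explorationTree_reconnect hn
  exact ⟨hinv.bijOn hT hS, hS, hinv⟩
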